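/- Let $n\ge 3$, let $M$ be a compact smooth $n$-dimensional manifold with (possibly empty) boundary $\partial M$, and let $m\in[0,\infty)$. For a smooth Riemannian metric $g$ on $M$ and $\phi\in C^\infty(M)$ (with $\phi=0$ if $m=0$), the weighted scalar curvature is $$R^m_\phi=R_g+2\Delta_g\phi-\frac{m+1}{m}|\nabla\phi|_g^2\quad\text{in }M$$ (read as $R_g$ if $m=0$), and the weighted mean curvature is $$H^m_\phi=H_g+\varepsilon\,\frac{\partial\phi}{\partial\nu_g}\quad\text{on }\partial M,$$ where $\nu_g$ is the outward unit normal and $H_g$ is the trace of the second fundamental form $A(X,Y)=g(\nabla_X\nu_g,Y)$ of $\partial M$ (so $H_g>0$ on the boundary of a Euclidean ball). The sign $\varepsilon$ is either $-1$ (the sign for which $H^m_\phi$ has the conformal transformation law $H^m_\phi=w^{-\frac{n+m}{n+m-2}}\bigl(\frac{2(n+m-1)}{n+m-2}\frac{\partial w}{\partial\nu_{g_0}}+H^m_{\phi_0}w\bigr)$ under $g=w^{\frac{4}{m+n-2}}g_0$, $e^{-\phi}=w^{\frac{2m}{m+n-2}}e^{-\phi_0}$), or $+1$, and if $\varepsilon=+1$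 it is assumed that $m\ne n-1$. Let $0<T\le\infty$, let $\sigma:[0,T)\to(0,\infty)$ be differentiable with $\sigma(0)=1$, and let $\psi_t:M\to M$, $t\in[0,T)$, be a smooth one-parameter family of diffeomorphisms with $\psi_0=\mathrm{id}$. Let $g_0$ be a smooth Riemannian metric on $M$ and $\phi_0\in C^\infty(M)$, with $\phi_0=0$ if $m=0$, and suppose that $$g(t)=\sigma(t)\,\psi_t^*g_0,\qquad \phi(t)=\psi_t^*\phi_0-\frac m2\log\sigma(t)\qquad(0\le t<T)$$ is a weighted Yamabe soliton with boundary, i.e. solves the unnormalized weighted Yamabe flow with boundary $$\frac{\partial}{\partial t}g(t)=-R^m_{\phi(t)}g(t),\quad \frac{\partial}{\partial t}\phi(t)=\frac m2R^m_{\phi(t)}\ \text{ in }M,\qquad H^m_{\phi(t)}=0\ \text{ on }\partial M,$$ with $g(0)=g_0$ and $\phi(0)=\phi_0$. Then for every $t\in[0,T)$ the weighted scalar curvature $R^m_{\phi(t)}$ is constant in $M$ and the weighted mean curvature $H^m_{\phi(t)}$ vanishes on $\partial M$; in particular this holds for $(g_0,\phi_0)$. -/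

import Mathlib

open scoped Manifold ContDiff

noncomputable section

namespace WeightedYamabe

/-- The half-open time interval `[0, T)`, where `T = ∞` is allowed. -/
def timeInterval (T : EReal) : Set ℝ := {t | 0 ≤ t ∧ (t : EReal) < T}

section Geometry

variable {n : ℕ} [NeZero n] {M : Type*} [TopologicalSpace M]
  [ChartedSpace (EuclideanHalfSpace n) M]

/-- A smooth Riemannian metric on the manifold with boundary `M`. -/
abbrev Metric (n : ℕ) [NeZero n] (M : Type*) [TopologicalSpace M]
    [ChartedSpace (EuclideanHalfSpace n) M] [IsManifold (𝓡∂ n) ∞ M] : Type _ :=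
  Bundle.ContMDiffRiemannianMetric (𝓡∂ n) ∞ (EuclideanSpace ℝ (Fin n))
    (fun p : M => TangentSpace (𝓡∂ n) p)

/-- The inverse of the chart of `M` at `x`; its natural domain is a relatively open subset of the
closed half space `{y | 0 ≤ y 0}`. -/
def chartInv (x : M) : EuclideanSpace ℝ (Fin n) → M := (extChartAt (𝓡∂ n) x).symm

/-- The coordinate vector field `∂ᵢ` of the chart at `x`, at the point with coordinates `y`. -/
def coordVec (x : M) (i : Fin n) (y : EuclideanSpace ℝ (Fin n)) :
    TangentSpace (𝓡∂ n) (chartInv x y) :=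
  mfderivWithin 𝓘(ℝ, EuclideanSpace ℝ (Fin n)) (𝓡∂ n) (chartInv x) (Set.range (𝓡∂ n)) y
    (EuclideanSpace.single i (1 : ℝ))

/-- The partial derivative `∂ᵢ u` of a function of the coordinates on the closed half space
(one-sided at the boundary). -/
def pderiv (i : Fin n) (u : EuclideanSpace ℝ (Fin n) → ℝ) (y : EuclideanSpace ℝ (Fin n)) : ℝ :=
  fderivWithin ℝ u (Set.range (𝓡∂ n)) y (EuclideanSpace.single i (1 : ℝ))

variable [IsManifold (𝓡∂ n) ∞ M]

/-- The matrix `g_{ij}` of the metric in the chart at `x`. -/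
def gram (g : Metric n M) (x : M) (y : EuclideanSpace ℝ (Fin n)) : Matrix (Fin n) (Fin n) ℝ :=
  Matrix.of fun i j => g.inner (chartInv x y) (coordVec x i y) (coordVec x j y)

/-- The Christoffel symbol `Γ^k_{ij}` in the chart at `x`. -/
def christoffel (g : Metric n M) (x : M) (k i j : Fin n) (y : EuclideanSpace ℝ (Fin n)) : ℝ :=
  (1 / 2) * ∑ l, (gram g x y)⁻¹ k l *
    (pderiv i (fun z => gram g x z j l) y + pderiv j (fun z => gram g x z i l) y
      - pderiv l (fun z => gram g x z i j) y)

/-- The Ricci tensor `R_{jk}` in the chart at `x` (positive on round spheres). -/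
def ricci (g : Metric n M) (x : M) (j k : Fin n) (y : EuclideanSpace ℝ (Fin n)) : ℝ :=
  ∑ i, (pderiv i (christoffel g x i j k) y - pderiv j (christoffel g x i i k) y
    + ∑ p, (christoffel g x i i p y * christoffel g x p j k y
      - christoffel g x i j p y * christoffel g x p i k y))

/-- The scalar curvature `R_g` at `p`. -/
def scalarCurvature (g : Metric n M) (p : M) : ℝ :=
  ∑ j, ∑ k, (gram g p (extChartAt (𝓡∂ n) p p))⁻¹ j k * ricci g p j k (extChartAt (𝓡∂ n) p p)

/-- The Laplacian `Δ_g f = g^{ij} (∂ᵢ∂ⱼ f - Γ^k_{ij} ∂ₖ f)` at `p`. -/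
def laplacian (g : Metric n M) (f : M → ℝ) (p : M) : ℝ :=
  ∑ i, ∑ j, (gram g p (extChartAt (𝓡∂ n) p p))⁻¹ i j *
    (pderiv i (pderiv j (f ∘ chartInv p)) (extChartAt (𝓡∂ n) p p)
      - ∑ k, christoffel g p k i j (extChartAt (𝓡∂ n) p p) *
          pderiv k (f ∘ chartInv p) (extChartAt (𝓡∂ n) p p))

/-- The squared gradient length `|∇f|²_g = g^{ij} ∂ᵢf ∂ⱼf` at `p`. -/
def gradNormSq (g : Metric n M) (f : M → ℝ) (p : M) : ℝ :=
  ∑ i, ∑ j, (gram g p (extChartAt (𝓡∂ n) p p))⁻¹ i j *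
    pderiv i (f ∘ chartInv p) (extChartAt (𝓡∂ n) p p) *
    pderiv j (f ∘ chartInv p) (extChartAt (𝓡∂ n) p p)

/-- The component `ν^k` of the outward unit normal at the boundary point `p`, in the chart at `p`.
In this chart `M` is `{y | 0 ≤ y 0}`, so `ν = -∇y₀ / |∇y₀|`, that is `ν^k = -g^{k0} / √g^{00}`. -/
def normal (g : Metric n M) (p : M) (k : Fin n) : ℝ :=
  -(gram g p (extChartAt (𝓡∂ n) p p))⁻¹ k 0 /
    √((gram g p (extChartAt (𝓡∂ n) p p))⁻¹ 0 0)

/-- The outward normal derivative `∂f/∂ν_g` at the boundary point `p`. -/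
def normalDeriv (g : Metric n M) (f : M → ℝ) (p : M) : ℝ :=
  ∑ k, normal g p k * pderiv k (f ∘ chartInv p) (extChartAt (𝓡∂ n) p p)

/-- The mean curvature `H_g` at the boundary point `p`: the trace over `T_p ∂M` of the second
fundamental form `A(X, Y) = g(∇_X ν, Y) = -g(∇_X Y, ν)`, with `ν` the outward unit normal (so that
it is positive on the boundary of a Euclidean ball). The trace over `T_p ∂M` is taken with
`g^{ij} - ν^i ν^j`, which is the inverse of the induced metric. -/
def meanCurvature (g : Metric n M) (p : M) : ℝ :=
  -∑ i, ∑ j, ((gram g p (extChartAt (𝓡∂ n) p p))⁻¹ i j - normal g p i * normal g p j) *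
    ∑ k, ∑ l, christoffel g p k i j (extChartAt (𝓡∂ n) p p) *
      gram g p (extChartAt (𝓡∂ n) p p) k l * normal g p l

end Geometry

/-- A smooth metric measure space `(M, g, e^{-φ}dV_g, e^{-φ}dA_g, m)` with underlying manifold with
boundary `M` and dimensional parameter `m`; it is determined by `g`, `φ` and `m`. -/
structure SMMS (n : ℕ) [NeZero n] (M : Type*) [TopologicalSpace M]
    [ChartedSpace (EuclideanHalfSpace n) M] [IsManifold (𝓡∂ n) ∞ M] (m : ℝ) where
  /-- The Riemannian metric. -/
  g : Metric n M
  /-- The weight function. -/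
  φ : M → ℝ
  smooth_φ : ContMDiff (𝓡∂ n) 𝓘(ℝ, ℝ) ∞ φ
  φ_eq_zero : m = 0 → ∀ p, φ p = 0

section Flow

variable {n : ℕ} [NeZero n] {M : Type*} [TopologicalSpace M]
  [ChartedSpace (EuclideanHalfSpace n) M] [IsManifold (𝓡∂ n) ∞ M] {m : ℝ}

/-- The weighted scalar curvature `R_φ^m = R_g + 2 Δ_g φ - ((m + 1) / m) |∇φ|²_g`
(equal to `R_g` if `m = 0`, since then `φ = 0`). -/
def SMMS.weightedScalarCurvature (S : SMMS n M m) (p : M) : ℝ :=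
  scalarCurvature S.g p + 2 * laplacian S.g S.φ p - (m + 1) / m * gradNormSq S.g S.φ p

/-- The weighted mean curvature `H_g + ε ∂φ/∂ν_g` at a boundary point, with sign `ε`. -/
def SMMS.weightedMeanCurvature (ε : ℝ) (S : SMMS n M m) (p : M) : ℝ :=
  meanCurvature S.g p + ε * normalDeriv S.g S.φ p

/-- `S t`, `t ∈ [0, T)`, solves the unnormalized weighted Yamabe flow with boundary
`∂g/∂t = -R_φ^m g`, `∂φ/∂t = (m / 2) R_φ^m` in `M`, `H_φ^m = 0` on `∂M`, starting at `S₀`. -/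
structure IsUnnormalizedFlow (ε : ℝ) (T : EReal) (S₀ : SMMS n M m) (S : ℝ → SMMS n M m) :
    Prop where
  initial : S 0 = S₀
  metric_eq : ∀ t ∈ timeInterval T, ∀ (p : M) (v w : TangentSpace (𝓡∂ n) p),
    HasDerivWithinAt (fun s => (S s).g.inner p v w)
      (-(S t).weightedScalarCurvature p * (S t).g.inner p v w) (timeInterval T) t
  weight_eq : ∀ t ∈ timeInterval T, ∀ p : M,
    HasDerivWithinAt (fun s => (S s).φ p)
      (m / 2 * (S t).weightedScalarCurvature p) (timeInterval T) t
  boundary_eq : ∀ t ∈ timeInterval T, ∀ p ∈ (𝓡∂ n).boundary M,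
    (S t).weightedMeanCurvature ε p = 0

/-- `S t`, `t ∈ [0, T)`, is a weighted Yamabe soliton with boundary: it is the self-similar family
`g(t) = σ(t) ψ_t^* g₀`, `φ(t) = ψ_t^* φ₀ - (m / 2) log σ(t)` and it solves the unnormalized
weighted Yamabe flow. -/
structure IsSoliton (ε : ℝ) (T : EReal) (S₀ : SMMS n M m) (S : ℝ → SMMS n M m)
    (σ : ℝ → ℝ) (ψ : ℝ → (M ≃ₘ^∞⟮𝓡∂ n, 𝓡∂ n⟯ M)) : Prop where
  σ_pos : ∀ t ∈ timeInterval T, 0 < σ t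
  σ_diff : DifferentiableOn ℝ σ (timeInterval T)
  σ_zero : σ 0 = 1
  ψ_smooth : ContMDiffOn (𝓘(ℝ, ℝ).prod (𝓡∂ n)) (𝓡∂ n) ∞ (fun q : ℝ × M => ψ q.1 q.2)
    (timeInterval T ×ˢ Set.univ)
  ψ_zero : ∀ p, ψ 0 p = p
  metric_selfSimilar : ∀ t ∈ timeInterval T, ∀ (p : M) (v w : TangentSpace (𝓡∂ n) p),
    (S t).g.inner p v w = σ t *
      S₀.g.inner (ψ t p) (mfderiv (𝓡∂ n) (𝓡∂ n) (ψ t) p v) (mfderiv (𝓡∂ n) (𝓡∂ n) (ψ t) p w)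
  weight_selfSimilar : ∀ t ∈ timeInterval T, ∀ p : M,
    (S t).φ p = S₀.φ (ψ t p) - m / 2 * Real.log (σ t)
  flow : IsUnnormalizedFlow ε T S₀ S

end Flow

end WeightedYamabe

end

open scoped Topology

noncomputable section

namespace WeightedYamabe

set_option linter.unusedSectionVars false

open Set Filter

/-! Put N = n + m and α = (N - 2)/2 > 0, and let R_t be the weighted scalar curvature at time t. The
flow moves g and φ pointwise in proportion, so it stays in one weighted conformal class: g(t) =
e^{2f_t} g₀ and φ(t) = φ₀ - m f_t, with f₀ = 0 and ∂_t f_t = -R_t/2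
(`IsUnnormalizedFlow.conformalTo`). Self-similarity says how everything scales: R_t = σ⁻¹ R₀∘ψ_t,
and ∫ e^{N f_t} k∘ψ_t dμ = σ^{N/2} ∫ k dμ for μ = e^{-φ₀} dV_{g₀} (`IsSoliton.integral_comp`).
Comparing the two descriptions to first order at t = 0 forces R₀ to be constant.

Let V = μ(M), E = ∫ R₀ dμ, κ = σ'(0). With k = 1 the derivative at t = 0 gives E = -κV. With k = R₀
the scaling identity reads ∫ e^{(2+2α) f_t} R_t dμ = σ^α E. The conformal law of the weighted scalar
curvature (`IsConformal.wscal_eq`), multiplied by e^{αf}, expresses e^{αf}(R₀ - e^{2f} R_t) as a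
multiple of the weighted divergence of e^{αf}∇f. Both mean curvatures vanish and n - 1 - εm ≠ 0, so
∂f/∂ν = 0 and this integrates to zero (`SMMS.ConformalTo.integral_eq`). Adding the two facts, σ^α E
- E = ∫ (R_t e^{(2+α) f_t} + R₀)(e^{α f_t} - 1) dμ. The last factor vanishes at t = 0, so dividing
by t needs continuity of R_t in t and no time derivative of it; the limit is ακE = -α ∫ R₀² dμ.
Hence ∫ (R₀ + κ)² dμ = -κE + 2κE + κ²V = 0, so R₀ = -κ, and R_t = σ⁻¹ R₀∘ψ_t carries this to all t.

The geometric input is proved for matrix-valued functions on the closed half space: covariance under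
maps (`IsPullback.wscal_eq`), conformal laws, and the divergence formula
(`IsMetricOn.divergence_eq`). It is carried to M by charts; the weighted volume is glued from chart
measures, and the divergence theorem (`SMMS.integral_eq_zero_of_isNeumann`) uses a partition of
unity. -/

/-- Euclidean space with coordinates indexed by `Fin n`. -/
abbrev Euc (n : ℕ) : Type := EuclideanSpace ℝ (Fin n)

/-- The closed half space `{y | 0 ≤ y 0}`, in the form in which it is the range of the model. -/
abbrev half (n : ℕ) [NeZero n] : Set (Euc n) := range (𝓡∂ n)

/-- The `i`-th standard basis vector. -/
abbrev stdv {n : ℕ} (i : Fin n) : Euc n := EuclideanSpace.single i (1 : ℝ)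

/-- The `i`-th coordinate. -/
abbrev crd {n : ℕ} (i : Fin n) : Euc n →L[ℝ] ℝ := EuclideanSpace.proj i

/-! ### Differential calculus on the closed half space -/

section Calculus

variable {n : ℕ} [NeZero n] {F : Type*} [NormedAddCommGroup F] [NormedSpace ℝ F]

/-- The derivative of a function on the closed half space. -/
abbrev dH (f : Euc n → F) (y : Euc n) : Euc n →L[ℝ] F := fderivWithin ℝ f (half n) y

/-- Smoothness at a point of the closed half space. -/
abbrev SmoothH (f : Euc n → F) (y : Euc n) : Prop := ContDiffWithinAt ℝ ∞ f (half n) y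

theorem mem_half {y : Euc n} : y ∈ half n ↔ 0 ≤ y 0 := by
  simp only [half, range_modelWithCornersEuclideanHalfSpace, mem_ofPred_eq]

theorem uniqueDiffOn_half : UniqueDiffOn ℝ (half n) := (𝓡∂ n).uniqueDiffOn

theorem SmoothH.hasFDeriv {f : Euc n → F} {y : Euc n} (h : SmoothH f y) :
    HasFDerivWithinAt f (dH f y) (half n) y :=
  (h.differentiableWithinAt (by simp)).hasFDerivWithinAt

theorem SmoothH.deriv {f : Euc n → F} {y : Euc n} (h : SmoothH f y) (hy : y ∈ half n) :
    SmoothH (dH f) y :=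
  h.fderivWithin_right uniqueDiffOn_half (by simp) hy

theorem dH_eq {f : Euc n → F} {f' : Euc n →L[ℝ] F} {y : Euc n}
    (h : HasFDerivWithinAt f f' (half n) y) (hy : y ∈ half n) : dH f y = f' :=
  h.fderivWithin (uniqueDiffOn_half y hy)

/-- The half space lies in the closure of its interior, so the symmetry of second derivatives
persists up to the boundary. -/
theorem SmoothH.dH_symm {f : Euc n → F} {y : Euc n} (h : SmoothH f y) (hy : y ∈ half n)
    (u v : Euc n) :
    dH (dH f) y u v = dH (dH f) y v u := by
  have := ContDiffWithinAt.isSymmSndFDerivWithinAt (𝕜 := ℝ) (n := ∞) (s := half n) h (by simp [minSmoothness_of_isRCLikeNormedField]; exact ENat.LEInfty.out)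
    uniqueDiffOn_half (by
      have := (𝓡∂ n).range_subset_closure_interior
      exact this hy) hy
  exact this u v

/-- Freezing the argument passes from derivatives of operator-valued maps to derivatives of their
components, which is how coordinate formulas and invariant ones are matched below. -/
theorem dH_clm_apply {V W : Type*} [NormedAddCommGroup V] [NormedSpace ℝ V]
    [NormedAddCommGroup W] [NormedSpace ℝ W] {f : Euc n → V →L[ℝ] W} {y : Euc n}
    (h : SmoothH f y) (hy : y ∈ half n) (v : V) (u : Euc n) :
    dH (fun z => f z v) y u = dH f y u v := by
  have h1 := h.hasFDeriv.clm_apply (hasFDerivWithinAt_const v y (half n))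
  rw [dH_eq h1 hy]
  simp

theorem smoothH_smul_const {f : Euc n → ℝ} {y : Euc n} (h : SmoothH f y) (c : F) :
    SmoothH (fun z => f z • c) y :=
  (ContinuousLinearMap.toSpanSingleton ℝ c).contDiff.comp_contDiffWithinAt h

theorem dH_congr {f g : Euc n → F} {y : Euc n} (h : f =ᶠ[𝓝[half n] y] g) (hy : y ∈ half n) :
    dH f y = dH g y := h.fderivWithin_eq (h.eq_of_nhdsWithin hy)

theorem dH_coord {f : Euc n → Euc n} {y : Euc n} (h : SmoothH f y) (hy : y ∈ half n)
    (k : Fin n) (u : Euc n) : dH (fun z => f z k) y u = dH f y u k := by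
  have h1 := (crd k).hasFDerivAt.comp_hasFDerivWithinAt
    y h.hasFDeriv
  have h2 := dH_eq h1 hy
  have : (⇑(crd k) ∘ f) = fun z => f z k := by
    ext z; simp
  rw [this] at h2
  rw [h2]; simp

theorem sum_stdv (v : Euc n) : ∑ i, v i • stdv i = v := by
  ext k
  simp [Finset.sum_apply, Pi.single_apply]

theorem map_eq_sum (L : Euc n →L[ℝ] F) (v : Euc n) : L v = ∑ i, v i • L (stdv i) := by
  conv_lhs => rw [← sum_stdv v]
  simp

end Calculus

/-! ### Metrics in coordinates and their Levi-Civita connection -/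

section Form

variable {n : ℕ} [NeZero n]

/-- The bilinear form with matrix `A`. -/
def form (A : Matrix (Fin n) (Fin n) ℝ) : Euc n →L[ℝ] Euc n →L[ℝ] ℝ :=
  ∑ i, ∑ j, A i j • (crd i).smulRight
    (crd j)

theorem form_apply (A : Matrix (Fin n) (Fin n) ℝ) (v w : Euc n) :
    form A v w = ∑ i, ∑ j, A i j * (v i * w j) := by
  simp [form, sum_apply]

theorem form_single (A : Matrix (Fin n) (Fin n) ℝ) (i j : Fin n) :
    form A (stdv i) (stdv j) = A i j := by
  simp [form_apply]

theorem form_symm {A : Matrix (Fin n) (Fin n) ℝ} (hA : ∀ i j, A i j = A j i) (v w : Euc n) :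
    form A v w = form A w v := by
  rw [form_apply, form_apply, Finset.sum_comm]
  refine Finset.sum_congr rfl fun i _ => Finset.sum_congr rfl fun j _ => ?_
  rw [hA j i]; ring

theorem form_nondeg {A : Matrix (Fin n) (Fin n) ℝ} (hA : A.PosDef) {v : Euc n}
    (h : ∀ w, form A v w = 0) : v = 0 := by
  by_contra hv
  have h1 := hA.dotProduct_mulVec_pos (x := v.ofLp) (by simpa using hv)
  have h2 := h v
  rw [form_apply] at h2
  have h3 : star v.ofLp ⬝ᵥ A.mulVec v.ofLp = ∑ i, ∑ j, A i j * (v i * v j) := by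
    simp only [dotProduct, Matrix.mulVec, Finset.mul_sum]
    refine Finset.sum_congr rfl fun i _ => Finset.sum_congr rfl fun j _ => ?_
    simp; ring
  rw [h3, h2] at h1
  exact lt_irrefl _ h1

/-- Identities between vectors are proved below by pairing with an arbitrary vector, which avoids
raising indices. -/
theorem form_ext {A : Matrix (Fin n) (Fin n) ℝ} (hA : A.PosDef) {v v' : Euc n}
    (h : ∀ w, form A v w = form A v' w) : v = v' := by
  refine sub_eq_zero.1 (form_nondeg hA fun w => ?_)
  simp [h w]

/-- Christoffel symbols of a matrix of functions. -/
def chr (G : Euc n → Matrix (Fin n) (Fin n) ℝ) (k i j : Fin n) (y : Euc n) : ℝ :=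
  (1 / 2) * ∑ l, (G y)⁻¹ k l *
    (pderiv i (fun z => G z j l) y + pderiv j (fun z => G z i l) y
      - pderiv l (fun z => G z i j) y)

/-- The Christoffel symbols as a bilinear map. -/
def gam (G : Euc n → Matrix (Fin n) (Fin n) ℝ) (y : Euc n) : Euc n →L[ℝ] Euc n →L[ℝ] Euc n :=
  ∑ k, ∑ i, ∑ j, chr G k i j y •
    (crd i).smulRight
    ((crd j).smulRight (stdv k))

theorem gam_apply (G : Euc n → Matrix (Fin n) (Fin n) ℝ) (y u v : Euc n) (k : Fin n) :
    gam G y u v k = ∑ i, ∑ j, chr G k i j y * (u i * v j) := by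
  simp only [gam, sum_apply, smul_apply,
    ContinuousLinearMap.smulRight_apply, PiLp.proj_apply, 
    WithLp.ofLp_sum, Finset.sum_apply, WithLp.ofLp_smul, Pi.smul_apply, smul_eq_mul]
  rw [Finset.sum_eq_single k]
  · simp
  · intro b _ hb; simp [hb]
  · simp

theorem gam_single (G : Euc n → Matrix (Fin n) (Fin n) ℝ) (y : Euc n) (k i j : Fin n) :
    gam G y (stdv i) (stdv j) k = chr G k i j y := by
  simp [gam_apply]

/-- `G` is a smooth field of positive definite symmetric matrices on the relatively open subset `T`
of the half space. -/
structure IsMetricOn (G : Euc n → Matrix (Fin n) (Fin n) ℝ) (T : Set (Euc n)) : Prop where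
  sub : T ⊆ half n
  nhd : ∀ y ∈ T, T ∈ 𝓝[half n] y
  symm : ∀ z i j, G z i j = G z j i
  smooth : ∀ y ∈ T, ∀ i j, SmoothH (fun z => G z i j) y
  pos : ∀ y ∈ T, (G y).PosDef

variable {G : Euc n → Matrix (Fin n) (Fin n) ℝ} {T : Set (Euc n)}

theorem IsMetricOn.smooth_form (h : IsMetricOn G T) {y : Euc n} (hy : y ∈ T) :
    SmoothH (fun z => form (G z)) y := by
  unfold form
  exact ContDiffWithinAt.sum fun i _ => ContDiffWithinAt.sum fun j _ =>
    smoothH_smul_const (h.smooth y hy i j) _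

theorem smoothH_det {A : Euc n → Matrix (Fin n) (Fin n) ℝ} {y : Euc n}
    (h : ∀ i j, SmoothH (fun z => A z i j) y) : SmoothH (fun z => (A z).det) y := by
  simp only [Matrix.det_apply']
  exact ContDiffWithinAt.sum fun s _ => (contDiffWithinAt_const.mul
    (contDiffWithinAt_prod fun i _ => h _ _))

/-- By Cramer's rule the inverse is a polynomial in the entries divided by the nonvanishing
determinant. -/
theorem IsMetricOn.smooth_inv (h : IsMetricOn G T) {y : Euc n} (hy : y ∈ T) (i j : Fin n) :
    SmoothH (fun z => (G z)⁻¹ i j) y := by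
  have hd : (G y).det ≠ 0 := (h.pos y hy).det_pos.ne'
  have : (fun z => (G z)⁻¹ i j) = fun z => ((G z).det)⁻¹ * (G z).adjugate i j := by
    ext z; simp [Matrix.inv_def]
  rw [this]
  refine (smoothH_det (h.smooth y hy)).inv hd |>.mul ?_
  simp only [Matrix.adjugate_apply]
  refine smoothH_det fun a b => ?_
  simp only [Matrix.updateRow_apply]
  split_ifs
  · exact contDiffWithinAt_const
  · exact h.smooth y hy _ _

theorem smoothH_pderiv {f : Euc n → ℝ} {y : Euc n} (h : SmoothH f y) (hy : y ∈ half n) (i : Fin n) :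
    SmoothH (pderiv i f) y := (h.deriv hy).clm_apply contDiffWithinAt_const

theorem IsMetricOn.smooth_chr (h : IsMetricOn G T) {y : Euc n} (hy : y ∈ T) (k i j : Fin n) :
    SmoothH (chr G k i j) y := by
  unfold chr
  have hh := h.sub hy
  exact contDiffWithinAt_const.mul (ContDiffWithinAt.sum fun l _ => (h.smooth_inv hy k l).mul
    (((smoothH_pderiv (h.smooth y hy _ _) hh i).add (smoothH_pderiv (h.smooth y hy _ _) hh j)).sub
      (smoothH_pderiv (h.smooth y hy _ _) hh l)))

theorem IsMetricOn.smooth_gam (h : IsMetricOn G T) {y : Euc n} (hy : y ∈ T) :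
    SmoothH (gam G) y := by
  unfold gam
  exact ContDiffWithinAt.sum fun k _ => ContDiffWithinAt.sum fun i _ => ContDiffWithinAt.sum
    fun j _ => smoothH_smul_const (h.smooth_chr hy k i j) _

theorem IsMetricOn.dH_form_apply (h : IsMetricOn G T) {y : Euc n} (hy : y ∈ T) (u v w : Euc n) :
    dH (fun z => form (G z)) y u v w
      = ∑ i, ∑ j, ∑ l, (u i * v j * w l) * pderiv i (fun z => G z j l) y := by
  have hB := h.smooth_form hy
  have hh := h.sub hy
  have e : ∀ i j l, dH (fun z => form (G z)) y (stdv i) (stdv j) (stdv l)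
      = pderiv i (fun z => G z j l) y := by
    intro i j l
    rw [← dH_clm_apply hB hh, ← dH_clm_apply (hB.clm_apply contDiffWithinAt_const) hh]
    simp only [form_single]
    rfl
  rw [map_eq_sum (dH (fun z => form (G z)) y) u]
  simp only [sum_apply, smul_apply]
  refine Finset.sum_congr rfl fun i _ => ?_
  rw [map_eq_sum (dH (fun z => form (G z)) y (stdv i)) v]
  simp only [sum_apply, smul_apply, Finset.smul_sum]
  refine Finset.sum_congr rfl fun j _ => ?_
  rw [map_eq_sum (dH (fun z => form (G z)) y (stdv i) (stdv j)) w]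
  simp only [smul_eq_mul, e, Finset.mul_sum]
  exact Finset.sum_congr rfl fun l _ => by ring

/-- Lowering the upper index of the Christoffel symbols cancels the inverse matrix in their
definition. Constant fields commute, so the Koszul formula has no bracket terms. -/
theorem IsMetricOn.koszul (h : IsMetricOn G T) {y : Euc n} (hy : y ∈ T) (u v w : Euc n) :
    form (G y) (gam G y u v) w = (1 / 2) * (dH (fun z => form (G z)) y u v w
      + dH (fun z => form (G z)) y v u w - dH (fun z => form (G z)) y w u v) := by
  have key : ∀ i j l, ∑ k, G y k l * chr G k i j y = (1 / 2) * (pderiv i (fun z => G z j l) y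
      + pderiv j (fun z => G z i l) y - pderiv l (fun z => G z i j) y) := by
    intro i j l
    have hu : IsUnit (G y).det := (h.pos y hy).det_pos.ne'.isUnit
    have h1 : ∀ p, ∑ k, G y k l * (G y)⁻¹ k p = if l = p then 1 else 0 := by
      intro p
      have := congrFun (congrFun (Matrix.mul_nonsing_inv (G y) hu) l) p
      rw [Matrix.mul_apply, Matrix.one_apply] at this
      rw [← this]
      exact Finset.sum_congr rfl fun k _ => by rw [h.symm y k l]
    simp only [chr]
    have : ∀ k, G y k l * (1 / 2 * ∑ p, (G y)⁻¹ k p * (pderiv i (fun z => G z j p) y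
        + pderiv j (fun z => G z i p) y - pderiv p (fun z => G z i j) y))
        = ∑ p, (1 / 2) * ((G y k l * (G y)⁻¹ k p) * (pderiv i (fun z => G z j p) y
        + pderiv j (fun z => G z i p) y - pderiv p (fun z => G z i j) y)) := by
      intro k
      simp only [Finset.mul_sum]
      exact Finset.sum_congr rfl fun p _ => by ring
    simp only [this]
    rw [Finset.sum_comm]
    simp only [← Finset.mul_sum, ← Finset.sum_mul, h1]
    simp
  have hL : form (G y) (gam G y u v) w
      = ∑ i, ∑ j, ∑ l, (u i * v j * w l) * ∑ k, G y k l * chr G k i j y := by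
    simp only [form_apply, gam_apply, Finset.mul_sum, Finset.sum_mul]
    rw [Finset.sum_comm]
    rw [Finset.sum_congr rfl fun l _ => Finset.sum_comm]
    rw [Finset.sum_comm]
    refine Finset.sum_congr rfl fun i _ => ?_
    rw [Finset.sum_congr rfl fun l _ => Finset.sum_comm]
    rw [Finset.sum_comm]
    exact Finset.sum_congr rfl fun j _ => Finset.sum_congr rfl fun l _ =>
      Finset.sum_congr rfl fun k _ => by ring
  rw [hL, h.dH_form_apply hy, h.dH_form_apply hy, h.dH_form_apply hy]
  have h2 : ∑ i, ∑ j, ∑ l, (v i * u j * w l) * pderiv i (fun z => G z j l) y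
      = ∑ i, ∑ j, ∑ l, (u i * v j * w l) * pderiv j (fun z => G z i l) y := by
    rw [Finset.sum_comm]
    exact Finset.sum_congr rfl fun j _ => Finset.sum_congr rfl fun l _ =>
      Finset.sum_congr rfl fun k _ => by ring
  have h3 : ∑ i, ∑ j, ∑ l, (w i * u j * v l) * pderiv i (fun z => G z j l) y
      = ∑ i, ∑ j, ∑ l, (u i * v j * w l) * pderiv l (fun z => G z i j) y := by
    rw [Finset.sum_comm]
    refine Finset.sum_congr rfl fun j _ => ?_
    rw [Finset.sum_comm]
    exact Finset.sum_congr rfl fun l _ => Finset.sum_congr rfl fun k _ => by ring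
  rw [h2, h3]
  simp only [key, ← Finset.sum_add_distrib, ← Finset.sum_sub_distrib, Finset.mul_sum]
  exact Finset.sum_congr rfl fun j _ => Finset.sum_congr rfl fun l _ =>
      Finset.sum_congr rfl fun k _ => by ring

theorem IsMetricOn.dH_form_symm (h : IsMetricOn G T) {y : Euc n} (hy : y ∈ T) (u v w : Euc n) :
    dH (fun z => form (G z)) y u v w = dH (fun z => form (G z)) y u w v := by
  have hB := h.smooth_form hy
  have hh := h.sub hy
  rw [← dH_clm_apply hB hh, ← dH_clm_apply (hB.clm_apply contDiffWithinAt_const) hh,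
    ← dH_clm_apply hB hh, ← dH_clm_apply (hB.clm_apply contDiffWithinAt_const) hh]
  simp only [form_symm (h.symm _) v w]

theorem IsMetricOn.gam_symm (h : IsMetricOn G T) {y : Euc n} (hy : y ∈ T) (u v : Euc n) :
    gam G y u v = gam G y v u := by
  refine form_ext (h.pos y hy) fun w => ?_
  rw [h.koszul hy, h.koszul hy, h.dH_form_symm hy w u v]
  ring

/-- Metric compatibility of the connection: adding two instances of the Koszul formula leaves only
the derivative along `u`. -/
theorem IsMetricOn.dH_form (h : IsMetricOn G T) {y : Euc n} (hy : y ∈ T) (u v w : Euc n) :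
    dH (fun z => form (G z)) y u v w
      = form (G y) (gam G y u v) w + form (G y) v (gam G y u w) := by
  rw [form_symm (h.symm y) v, h.koszul hy, h.koszul hy, h.dH_form_symm hy u w v,
    h.dH_form_symm hy v u w, h.dH_form_symm hy w u v]
  ring

end Form

/-! ### Curvature, Hessian and contraction with a metric -/

section Curvature

variable {n : ℕ} [NeZero n]

/-- The curvature operator of a connection `Γ`. -/
def curv (Γ : Euc n → Euc n →L[ℝ] Euc n →L[ℝ] Euc n) (y u v w : Euc n) : Euc n :=
  dH Γ y u v w - dH Γ y v u w + Γ y u (Γ y v w) - Γ y v (Γ y u w)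

/-- The Ricci tensor of a connection as a bilinear form. -/
def ricForm (Γ : Euc n → Euc n →L[ℝ] Euc n →L[ℝ] Euc n) (y : Euc n) :
    Euc n →ₗ[ℝ] Euc n →ₗ[ℝ] ℝ :=
  LinearMap.mk₂ ℝ (fun v w => ∑ i, curv Γ y (stdv i) v w i)
    (fun v v' w => by
      rw [← Finset.sum_add_distrib]
      exact Finset.sum_congr rfl fun i _ => by simp [curv]; ring)
    (fun c v w => by
      rw [smul_eq_mul, Finset.mul_sum]
      exact Finset.sum_congr rfl fun i _ => by simp [curv]; ring)
    (fun v w w' => by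
      rw [← Finset.sum_add_distrib]
      exact Finset.sum_congr rfl fun i _ => by simp [curv]; ring)
    (fun c v w => by
      rw [smul_eq_mul, Finset.mul_sum]
      exact Finset.sum_congr rfl fun i _ => by simp [curv]; ring)

theorem ricForm_apply (Γ : Euc n → Euc n →L[ℝ] Euc n →L[ℝ] Euc n) (y v w : Euc n) :
    ricForm Γ y v w = ∑ i, curv Γ y (stdv i) v w i := rfl

/-- The Hessian of `f` for the connection `Γ` as a bilinear form. -/
def hess (Γ : Euc n → Euc n →L[ℝ] Euc n →L[ℝ] Euc n) (f : Euc n → ℝ) (y : Euc n) :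
    Euc n →ₗ[ℝ] Euc n →ₗ[ℝ] ℝ :=
  LinearMap.mk₂ ℝ (fun u v => dH (dH f) y u v - dH f y (Γ y u v))
    (fun v v' w => by simp; ring) (fun c v w => by simp; ring)
    (fun v w w' => by simp; ring) (fun c v w => by simp; ring)

theorem hess_apply (Γ : Euc n → Euc n →L[ℝ] Euc n →L[ℝ] Euc n) (f : Euc n → ℝ) (y u v : Euc n) :
    hess Γ f y u v = dH (dH f) y u v - dH f y (Γ y u v) := rfl

/-- The product of two covectors as a bilinear form. -/
def prodForm (a b : Euc n →L[ℝ] ℝ) : Euc n →ₗ[ℝ] Euc n →ₗ[ℝ] ℝ :=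
  LinearMap.mk₂ ℝ (fun u v => a u * b v)
    (fun v v' w => by simp; ring) (fun c v w => by simp; ring)
    (fun v w w' => by simp; ring) (fun c v w => by simp; ring)

theorem prodForm_apply (a b : Euc n →L[ℝ] ℝ) (u v : Euc n) : prodForm a b u v = a u * b v := rfl

/-- The contraction of a bilinear form with the inverse of a matrix. -/
def contr (A : Matrix (Fin n) (Fin n) ℝ) (b : Euc n →ₗ[ℝ] Euc n →ₗ[ℝ] ℝ) : ℝ :=
  ∑ j, ∑ k, A⁻¹ j k * b (stdv j) (stdv k)

theorem contr_add (A : Matrix (Fin n) (Fin n) ℝ) (b c : Euc n →ₗ[ℝ] Euc n →ₗ[ℝ] ℝ) :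
    contr A (b + c) = contr A b + contr A c := by
  simp [contr, mul_add, Finset.sum_add_distrib]

theorem contr_smul (A : Matrix (Fin n) (Fin n) ℝ) (r : ℝ) (b : Euc n →ₗ[ℝ] Euc n →ₗ[ℝ] ℝ) :
    contr A (r • b) = r * contr A b := by
  simp only [contr, Finset.mul_sum, LinearMap.smul_apply, smul_eq_mul]
  exact Finset.sum_congr rfl fun i _ => Finset.sum_congr rfl fun j _ => by ring

theorem contr_eq_trace (A : Matrix (Fin n) (Fin n) ℝ) (b : Euc n →ₗ[ℝ] Euc n →ₗ[ℝ] ℝ) :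
    contr A b = (A⁻¹ * (Matrix.of fun j k => b (stdv j) (stdv k)).transpose).trace := by
  simp [contr, Matrix.trace, Matrix.mul_apply]

/-- The matrix of a linear map. -/
def jac (J : Euc n →L[ℝ] Euc n) : Matrix (Fin n) (Fin n) ℝ := Matrix.of fun a i => J (stdv i) a

theorem jac_eq_toMatrix (J : Euc n →L[ℝ] Euc n) :
    jac J = LinearMap.toMatrix (EuclideanSpace.basisFun (Fin n) ℝ).toBasis
      (EuclideanSpace.basisFun (Fin n) ℝ).toBasis (J : Euc n →ₗ[ℝ] Euc n) := by
  ext a i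
  simp [jac, LinearMap.toMatrix_apply]

theorem det_jac (J : Euc n →L[ℝ] Euc n) : (jac J).det = J.det := by
  rw [jac_eq_toMatrix, LinearMap.det_toMatrix]

theorem isUnit_det_jac {J : Euc n →L[ℝ] Euc n} (hJ : Function.Bijective J) :
    IsUnit (jac J).det := by
  rw [det_jac]
  have := LinearEquiv.isUnit_det' (LinearEquiv.ofBijective (J : Euc n →ₗ[ℝ] Euc n) hJ)
  exact this

theorem bilin_jac (b : Euc n →ₗ[ℝ] Euc n →ₗ[ℝ] ℝ) (J : Euc n →L[ℝ] Euc n) :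
    (Matrix.of fun j k => b (J (stdv j)) (J (stdv k)))
      = (jac J).transpose * (Matrix.of fun j k => b (stdv j) (stdv k)) * jac J := by
  ext j k
  simp only [Matrix.of_apply, Matrix.mul_apply, Matrix.transpose_apply, jac, Finset.sum_mul]
  conv_lhs => rw [← sum_stdv (J (stdv j)), ← sum_stdv (J (stdv k))]
  simp only [map_sum, LinearMap.sum_apply, map_smul, LinearMap.smul_apply, smul_eq_mul,
    Finset.mul_sum]
  exact Finset.sum_congr rfl fun i _ => Finset.sum_congr rfl fun j _ => by ring

/-- A continuous bilinear form as an algebraic one. -/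
def toBilin (B : Euc n →L[ℝ] Euc n →L[ℝ] ℝ) : Euc n →ₗ[ℝ] Euc n →ₗ[ℝ] ℝ :=
  LinearMap.mk₂ ℝ (fun u v => B u v) (fun v v' w => by simp) (fun c v w => by simp)
    (fun v w w' => by simp) (fun c v w => by simp)

theorem toBilin_apply (B : Euc n →L[ℝ] Euc n →L[ℝ] ℝ) (u v : Euc n) : toBilin B u v = B u v := rfl

theorem matrix_pullback {A A' : Matrix (Fin n) (Fin n) ℝ} {s : ℝ} {J : Euc n →L[ℝ] Euc n}
    (h : ∀ u v, form A' u v = s * form A (J u) (J v)) :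
    A' = s • ((jac J).transpose * A * jac J) := by
  have h1 := bilin_jac (toBilin (form A)) J
  simp only [toBilin_apply, form_single] at h1
  have h2 : (Matrix.of fun j k => A j k) = A := rfl
  rw [h2] at h1
  rw [← h1]
  ext i j
  rw [← form_single A', h]
  simp

/-- With P the matrix of `J`, the inverse of s PᵀAP is s⁻¹ P⁻¹A⁻¹P⁻ᵀ, and the factors P cancel under
the trace. This one computation yields both invariance and scaling of scalar curvature, Laplacian
and gradient length. -/
theorem contr_pullback {A A' : Matrix (Fin n) (Fin n) ℝ} {s : ℝ} (hs : s ≠ 0)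
    {J : Euc n →L[ℝ] Euc n} (hJ : Function.Bijective J)
    (h : ∀ u v, form A' u v = s * form A (J u) (J v))
    {b b' : Euc n →ₗ[ℝ] Euc n →ₗ[ℝ] ℝ} (hb : ∀ u v, b' u v = b (J u) (J v)) :
    contr A' b' = s⁻¹ * contr A b := by
  have hP := isUnit_det_jac hJ
  rw [contr_eq_trace, contr_eq_trace, matrix_pullback h]
  simp only [hb]
  rw [bilin_jac b J]
  set P := jac J
  set Q := (Matrix.of fun j k => b (stdv j) (stdv k))
  have hPT : IsUnit P.transpose.det := by rwa [Matrix.det_transpose]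
  have e1 : (s • (P.transpose * A * P))⁻¹ = s⁻¹ • (P⁻¹ * A⁻¹ * P.transpose⁻¹) := by
    have : s • (P.transpose * A * P) = (s • (1 : Matrix (Fin n) (Fin n) ℝ)) * (P.transpose * A * P) := by simp
    rw [this, Matrix.mul_inv_rev, Matrix.mul_inv_rev, Matrix.mul_inv_rev]
    have : (s • (1 : Matrix (Fin n) (Fin n) ℝ))⁻¹ = s⁻¹ • 1 := by
      apply Matrix.inv_eq_right_inv
      simp [smul_smul, hs]
    rw [this]
    simp [Matrix.mul_assoc]
  rw [e1, Matrix.smul_mul, Matrix.trace_smul, smul_eq_mul]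
  congr 1
  rw [Matrix.transpose_mul, Matrix.transpose_mul, Matrix.transpose_transpose]
  have e2 : P⁻¹ * A⁻¹ * P.transpose⁻¹ * (P.transpose * (Q.transpose * P))
      = P⁻¹ * (A⁻¹ * Q.transpose * P) := by
    have : P.transpose⁻¹ * (P.transpose * (Q.transpose * P)) = Q.transpose * P := by
      rw [← Matrix.mul_assoc, Matrix.nonsing_inv_mul _ hPT, Matrix.one_mul]
    rw [Matrix.mul_assoc (P⁻¹ * A⁻¹), this]
    simp only [Matrix.mul_assoc]
  rw [e2, Matrix.trace_mul_comm, Matrix.mul_assoc, Matrix.mul_nonsing_inv _ hP, Matrix.mul_one]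

/-- `J` conjugates `L'` to `L`, and conjugate endomorphisms have the same trace. -/
theorem sum_coord_conj {L L' : Euc n →ₗ[ℝ] Euc n} {J : Euc n →L[ℝ] Euc n}
    (hJ : Function.Bijective J) (h : ∀ u, J (L' u) = L (J u)) :
    ∑ i, L' (stdv i) i = ∑ i, L (stdv i) i := by
  have key : ∀ K : Euc n →ₗ[ℝ] Euc n, ∑ i, K (stdv i) i = LinearMap.trace ℝ (Euc n) K := by
    intro K
    rw [LinearMap.trace_eq_matrix_trace ℝ (EuclideanSpace.basisFun (Fin n) ℝ).toBasis]
    simp [Matrix.trace, LinearMap.toMatrix_apply]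
  rw [key, key]
  let e := LinearEquiv.ofBijective (J : Euc n →ₗ[ℝ] Euc n) hJ
  have he : L = e.conj L' := by
    ext1 u
    obtain ⟨v, rfl⟩ := e.surjective u
    rw [LinearEquiv.conj_apply_apply, e.symm_apply_apply]
    exact (h v).symm
  rw [he, LinearMap.trace_conj']

end Curvature

/-! ### Naturality of the connection and curvature under pullback -/

section Naturality

variable {n : ℕ} [NeZero n] {W : Type*} [NormedAddCommGroup W] [NormedSpace ℝ W]

/-- The metric `G'` on `T'` is `s` times the pullback by `F` of the metric `G` on `T`. -/
structure IsPullback (s : ℝ) (F : Euc n → Euc n) (G' : Euc n → Matrix (Fin n) (Fin n) ℝ)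
    (T' : Set (Euc n)) (G : Euc n → Matrix (Fin n) (Fin n) ℝ) (T : Set (Euc n)) : Prop where
  met' : IsMetricOn G' T'
  met : IsMetricOn G T
  ne : s ≠ 0
  smooth : ∀ y ∈ T', SmoothH F y
  maps : MapsTo F T' T
  bij : ∀ y ∈ T', Function.Bijective (dH F y)
  eq : ∀ y ∈ T', ∀ u v, form (G' y) u v = s * form (G (F y)) (dH F y u) (dH F y v)

variable {s : ℝ} {F : Euc n → Euc n} {G' G : Euc n → Matrix (Fin n) (Fin n) ℝ} {T' T : Set (Euc n)}

theorem IsPullback.tendsto (h : IsPullback s F G' T' G T) {y : Euc n} (hy : y ∈ T') :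
    Tendsto F (𝓝[half n] y) (𝓝[half n] (F y)) := by
  refine tendsto_nhdsWithin_iff.2 ⟨(h.smooth y hy).continuousWithinAt, ?_⟩
  filter_upwards [h.met'.nhd y hy] with z hz using h.met.sub (h.maps hz)

theorem IsPullback.comp_deriv (h : IsPullback s F G' T' G T) {y : Euc n} (hy : y ∈ T')
    {f : Euc n → W} (hf : SmoothH f (F y)) :
    HasFDerivWithinAt (fun z => f (F z)) ((dH f (F y)).comp (dH F y)) (half n) y :=
  hf.hasFDeriv.comp_of_tendsto y (h.smooth y hy).hasFDeriv (h.tendsto hy)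

/-- The pullback identity is differentiated and inserted into the Koszul formula. Of the six terms
with second derivatives of `F`, symmetry cancels four and merges the other two; the constant `s`
divides out. -/
theorem IsPullback.gam_eq (h : IsPullback s F G' T' G T) {y : Euc n} (hy : y ∈ T') (v w : Euc n) :
    dH F y (gam G' y v w) = gam G (F y) (dH F y v) (dH F y w) + dH (dH F) y v w := by
  have hh := h.met'.sub hy
  have hFy := h.maps hy
  have hB := h.comp_deriv hy (h.met.smooth_form hFy)
  have hJ : ∀ v, HasFDerivWithinAt (fun z => dH F z v) ((dH (dH F) y).flip v) (half n) y := by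
    intro v
    have := ((h.smooth y hy).deriv hh).hasFDeriv.clm_apply (hasFDerivWithinAt_const v y (half n))
    simpa using this
  have hD : ∀ u v w, dH (fun z => form (G' z)) y u v w
      = s * (dH (fun z => form (G z)) (F y) (dH F y u) (dH F y v) (dH F y w)
        + form (G (F y)) (dH (dH F) y u v) (dH F y w)
        + form (G (F y)) (dH F y v) (dH (dH F) y u w)) := by
    intro u v w
    have h1 := ((hB.clm_apply (hJ v)).clm_apply (hJ w)).const_mul s
    have h2 := h.met'.smooth_form hy
    rw [← dH_clm_apply h2 hh, ← dH_clm_apply (h2.clm_apply contDiffWithinAt_const) hh]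
    have h3 : (fun z => form (G' z) v w) =ᶠ[𝓝[half n] y]
        fun z => s * form (G (F z)) (dH F z v) (dH F z w) := by
      filter_upwards [h.met'.nhd y hy] with z hz using h.eq z hz v w
    rw [dH_congr h3 hh, dH_eq h1 hh]
    simp
    ring
  refine form_ext (h.met.pos _ hFy) fun w' => ?_
  -- Since the derivative of `F` is onto, it suffices to test against images of vectors.
  obtain ⟨w', rfl⟩ := (h.bij y hy).2 w'
  have hsymm := (h.smooth y hy).dH_symm hh
  have h1 := h.met'.koszul hy v w w'
  rw [h.eq y hy, hD, hD, hD, hsymm w v, hsymm w' v, hsymm w' w,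
    form_symm (h.met.symm (F y)) (dH F y w) (dH (dH F) y v w')] at h1
  rw [map_add, add_apply, h.met.koszul hFy]
  apply mul_left_cancel₀ h.ne
  rw [h1]
  ring

/-- Differentiating the transformation law of the connection brings in second and third derivatives
of `F`. The third derivatives are symmetric in `u`, `v` and disappear on antisymmetrizing; the
remaining second derivatives are absorbed by applying the law again to the quadratic terms. -/
theorem IsPullback.curv_eq (h : IsPullback s F G' T' G T) {y : Euc n} (hy : y ∈ T')
    (u v w : Euc n) :
    dH F y (curv (gam G') y u v w)
      = curv (gam G) (F y) (dH F y u) (dH F y v) (dH F y w) := by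
  have hh := h.met'.sub hy
  have hFy := h.maps hy
  have hG := h.comp_deriv hy (h.met.smooth_gam hFy)
  have hJs := (h.smooth y hy).deriv hh
  have hJ : ∀ v, HasFDerivWithinAt (fun z => dH F z v) ((dH (dH F) y).flip v) (half n) y := by
    intro v
    simpa using hJs.hasFDeriv.clm_apply (hasFDerivWithinAt_const v y (half n))
  have key : ∀ u v, dH (dH F) y u (gam G' y v w)
      + dH F y (dH (gam G') y u v w)
      = dH (gam G) (F y) (dH F y u) (dH F y v) (dH F y w)
        + gam G (F y) (dH (dH F) y u v) (dH F y w)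
        + gam G (F y) (dH F y v) (dH (dH F) y u w)
        + dH (dH (dH F)) y u v w := by
    intro u v
    have h1 : HasFDerivWithinAt (fun z => gam G' z v w)
        (((dH (gam G') y).flip v).flip w) (half n) y := by
      have := ((h.met'.smooth_gam hy).hasFDeriv.clm_apply
        (hasFDerivWithinAt_const v y (half n))).clm_apply (hasFDerivWithinAt_const w y (half n))
      simpa using this
    have h2 : HasFDerivWithinAt (fun z => dH (dH F) z v w)
        (((dH (dH (dH F)) y).flip v).flip w) (half n) y := by
      have := ((hJs.deriv hh).hasFDeriv.clm_apply
        (hasFDerivWithinAt_const v y (half n))).clm_apply (hasFDerivWithinAt_const w y (half n))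
      simpa using this
    have h3 := hJs.hasFDeriv.clm_apply h1
    have h4 := ((hG.clm_apply (hJ v)).clm_apply (hJ w)).add h2
    have h5 : (fun z => dH F z (gam G' z v w)) =ᶠ[𝓝[half n] y]
        fun z => gam G (F z) (dH F z v) (dH F z w) + dH (dH F) z v w := by
      filter_upwards [h.met'.nhd y hy] with z hz using h.gam_eq hz v w
    have h6 := dH_congr h5 hh
    have h7 := dH_eq h4 hh
    rw [dH_eq h3 hh] at h6
    have h8 := congrArg (fun L => L u) (h6.trans h7)
    simp at h8
    rw [add_comm, h8]
    abel
  have hs2 := hJs.dH_symm hh u v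
  have hs1 := (h.smooth y hy).dH_symm hh u v
  have k1 := eq_sub_of_add_eq' (key u v)
  have k2 := eq_sub_of_add_eq' (key v u)
  have g1 := h.gam_eq hy u (gam G' y v w)
  have g2 := h.gam_eq hy v (gam G' y u w)
  have g3 := h.gam_eq hy v w
  have g4 := h.gam_eq hy u w
  simp only [curv, map_add, map_sub]
  rw [k1, k2, g1, g2, g3, g4, hs2, hs1]
  simp only [map_add]
  abel

theorem IsPullback.ricForm_eq (h : IsPullback s F G' T' G T) {y : Euc n} (hy : y ∈ T')
    (v w : Euc n) : ricForm (gam G') y v w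
      = ricForm (gam G) (F y) (dH F y v) (dH F y w) := by
  rw [ricForm_apply, ricForm_apply]
  let L' : Euc n →ₗ[ℝ] Euc n :=
    { toFun := fun u => curv (gam G') y u v w
      map_add' := fun a b => by simp [curv]; abel
      map_smul' := fun c a => by simp [curv, smul_sub, smul_add] }
  let L : Euc n →ₗ[ℝ] Euc n :=
    { toFun := fun u => curv (gam G) (F y) u (dH F y v) (dH F y w)
      map_add' := fun a b => by simp [curv]; abel
      map_smul' := fun c a => by simp [curv, smul_sub, smul_add] }
  exact sum_coord_conj (L := L) (L' := L') (h.bij y hy) fun u => h.curv_eq hy u v w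

theorem IsPullback.dH_comp (h : IsPullback s F G' T' G T) {y : Euc n} (hy : y ∈ T')
    {f : Euc n → W} (hf : SmoothH f (F y)) (u : Euc n) :
    dH (fun z => f (F z)) y u = dH f (F y) (dH F y u) := by
  rw [dH_eq (h.comp_deriv hy hf) (h.met'.sub hy)]; rfl

/-- The second derivative of `F` produced by the chain rule is exactly the inhomogeneous term in the
law for the connection. -/
theorem IsPullback.hess_eq (h : IsPullback s F G' T' G T) {y : Euc n} (hy : y ∈ T')
    {f : Euc n → ℝ} (hf : ∀ z ∈ T, SmoothH f z) (v w : Euc n) :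
    hess (gam G') (fun z => f (F z)) y v w
      = hess (gam G) f (F y) (dH F y v) (dH F y w) := by
  have hh := h.met'.sub hy
  have hFy := h.maps hy
  have h1 : dH (fun z => f (F z)) =ᶠ[𝓝[half n] y] fun z => (dH f (F z)).comp (dH F z) := by
    filter_upwards [h.met'.nhd y hy] with z hz
    exact dH_eq (h.comp_deriv hz (hf _ (h.maps hz))) (h.met'.sub hz)
  have h2 := h.comp_deriv hy ((hf _ hFy).deriv (h.met.sub hFy))
  have h3 := h2.clm_comp ((h.smooth y hy).deriv hh).hasFDeriv
  have h4 := dH_congr h1 hh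
  rw [dH_eq h3 hh] at h4
  rw [hess_apply, hess_apply, h.dH_comp hy (hf _ hFy), h.gam_eq hy, h4]
  simp
  ring

end Naturality

/-! ### Scalar curvature, Laplacian and gradient in coordinates -/

section Operators

variable {n : ℕ} [NeZero n]

/-- The scalar curvature of a matrix of functions. -/
def scal (G : Euc n → Matrix (Fin n) (Fin n) ℝ) (y : Euc n) : ℝ :=
  contr (G y) (ricForm (gam G) y)

/-- The Laplacian of a matrix of functions. -/
def lap (G : Euc n → Matrix (Fin n) (Fin n) ℝ) (f : Euc n → ℝ) (y : Euc n) : ℝ :=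
  contr (G y) (hess (gam G) f y)

/-- The inner product of the gradients of two functions. -/
def gradIn (G : Euc n → Matrix (Fin n) (Fin n) ℝ) (a b : Euc n → ℝ) (y : Euc n) : ℝ :=
  contr (G y) (prodForm (dH a y) (dH b y))

/-- The weighted scalar curvature of a matrix of functions and a weight. -/
def wscal (m : ℝ) (G : Euc n → Matrix (Fin n) (Fin n) ℝ) (φ : Euc n → ℝ) (y : Euc n) : ℝ :=
  scal G y + 2 * lap G φ y - (m + 1) / m * gradIn G φ φ y

/-- The gradient of `f`. -/
def grad (G : Euc n → Matrix (Fin n) (Fin n) ℝ) (f : Euc n → ℝ) (y : Euc n) : Euc n :=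
  WithLp.toLp 2 fun k => ∑ j, (G y)⁻¹ k j * pderiv j f y

variable {s : ℝ} {F : Euc n → Euc n} {G' G : Euc n → Matrix (Fin n) (Fin n) ℝ} {T' T : Set (Euc n)}

theorem dH_add_const (f : Euc n → ℝ) (c : ℝ) : dH (fun z => f z + c) = dH f := by
  ext1 y
  exact fderivWithin_add_const c

/-- Each of the three terms is a contraction of a natural bilinear form, so each scales by `s⁻¹`;
only derivatives of the weight occur, so `c` drops out. With `F` a change of charts this is
independence of coordinates, and with `F` a soliton diffeomorphism it is the scaling of curvature.
-/
theorem IsPullback.wscal_eq (h : IsPullback s F G' T' G T) {y : Euc n} (hy : y ∈ T') (m : ℝ)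
    {φ φ' : Euc n → ℝ} (hφ : ∀ z ∈ T, SmoothH φ z) {c : ℝ}
    (hφ' : ∀ z ∈ T', φ' z = φ (F z) + c) :
    wscal m G' φ' y = s⁻¹ * wscal m G φ (F y) := by
  have hh := h.met'.sub hy
  have e1 : ∀ z ∈ T', dH φ' z = dH (fun z => φ (F z)) z := by
    intro z hz
    rw [← dH_add_const (fun z => φ (F z)) c]
    refine dH_congr ?_ (h.met'.sub hz)
    filter_upwards [h.met'.nhd z hz] with x hx using hφ' x hx
  have e2 : dH (dH φ') y = dH (dH (fun z => φ (F z))) y := by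
    refine dH_congr ?_ hh
    filter_upwards [h.met'.nhd y hy] with x hx using e1 x hx
  have h1 : scal G' y = s⁻¹ * scal G (F y) :=
    contr_pullback h.ne (h.bij y hy) (h.eq y hy) (h.ricForm_eq hy)
  have h2 : lap G' φ' y = s⁻¹ * lap G φ (F y) := by
    refine contr_pullback h.ne (h.bij y hy) (h.eq y hy) fun u v => ?_
    rw [← h.hess_eq hy hφ, hess_apply, hess_apply, e2, e1 y hy]
  have h3 : gradIn G' φ' φ' y = s⁻¹ * gradIn G φ φ (F y) := by
    refine contr_pullback h.ne (h.bij y hy) (h.eq y hy) fun u v => ?_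
    rw [prodForm_apply, prodForm_apply, e1 y hy, h.dH_comp hy (hφ _ (h.maps hy)),
      h.dH_comp hy (hφ _ (h.maps hy))]
  rw [wscal, wscal, h1, h2, h3]
  ring

variable {f φ : Euc n → ℝ}

theorem pderiv_eq (i : Fin n) (f : Euc n → ℝ) (y : Euc n) : pderiv i f y = dH f y (stdv i) := rfl

theorem IsMetricOn.sum_inv (h : IsMetricOn G T) {y : Euc n} (hy : y ∈ T) (l p : Fin n) :
    ∑ k, G y k l * (G y)⁻¹ k p = if l = p then 1 else 0 := by
  have hu : IsUnit (G y).det := (h.pos y hy).det_pos.ne'.isUnit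
  have := congrFun (congrFun (Matrix.mul_nonsing_inv (G y) hu) l) p
  rw [Matrix.mul_apply, Matrix.one_apply] at this
  rw [← this]
  exact Finset.sum_congr rfl fun k _ => by rw [h.symm y k l]

theorem IsMetricOn.form_grad (h : IsMetricOn G T) {y : Euc n} (hy : y ∈ T) (f : Euc n → ℝ)
    (w : Euc n) : form (G y) (grad G f y) w = dH f y w := by
  rw [form_apply, map_eq_sum (dH f y) w, Finset.sum_comm]
  refine Finset.sum_congr rfl fun l _ => ?_
  simp only [grad, Finset.mul_sum, Finset.sum_mul]
  rw [Finset.sum_comm]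
  have : ∀ j, ∑ k, G y k l * ((G y)⁻¹ k j * pderiv j f y * w l)
      = (if l = j then 1 else 0) * (pderiv j f y * w l) := by
    intro j
    rw [← h.sum_inv hy l j, Finset.sum_mul]
    exact Finset.sum_congr rfl fun k _ => by ring
  simp only [this]
  simp [pderiv_eq, mul_comm]

theorem IsMetricOn.smooth_grad (h : IsMetricOn G T) {y : Euc n} (hy : y ∈ T)
    (hf : SmoothH f y) : SmoothH (grad G f) y := by
  refine contDiffWithinAt_euclidean.2 fun k => ?_
  change ContDiffWithinAt ℝ ∞ (fun x => ∑ j, (G x)⁻¹ k j * pderiv j f x) (half n) y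
  exact ContDiffWithinAt.sum fun j _ => (h.smooth_inv hy k j).mul
    (smoothH_pderiv hf (h.sub hy) j)

/-- The contraction of `A (K u) w` is the trace of `K`. -/
theorem IsMetricOn.contr_form_comp (h : IsMetricOn G T) {y : Euc n} (hy : y ∈ T)
    {b : Euc n →ₗ[ℝ] Euc n →ₗ[ℝ] ℝ} {K : Euc n → Euc n}
    (hb : ∀ u w, b u w = form (G y) (K u) w) : contr (G y) b = ∑ i, K (stdv i) i := by
  simp only [contr, hb]
  refine Finset.sum_congr rfl fun j _ => ?_
  have h1 : ∀ k, form (G y) (K (stdv j)) (stdv k) = ∑ i, G y i k * K (stdv j) i := by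
    intro k
    simp [form_apply]
  have hs : ∀ a b, (G y)⁻¹ a b = (G y)⁻¹ b a := by
    intro a b
    have : (G y).IsSymm := Matrix.ext fun a b => h.symm y b a
    have := this.inv
    exact (this.apply a b).symm
  simp only [h1, Finset.mul_sum]
  rw [Finset.sum_comm]
  have h2 : ∀ i, ∑ k, (G y)⁻¹ j k * (G y i k * K (stdv j) i)
      = (if i = j then 1 else 0) * K (stdv j) i := by
    intro i
    rw [← h.sum_inv hy i j, Finset.sum_mul]
    refine Finset.sum_congr rfl fun k _ => by rw [hs j k, h.symm y i k]; ring
  simp [h2]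

theorem IsMetricOn.contr_form (h : IsMetricOn G T) {y : Euc n} (hy : y ∈ T) :
    contr (G y) (toBilin (form (G y))) = n := by
  rw [h.contr_form_comp hy (K := id) fun u w => rfl]
  simp

theorem sum_mul_coord (a : Euc n →L[ℝ] ℝ) (Z : Euc n) : ∑ i, a (stdv i) * Z i = a Z := by
  rw [map_eq_sum a Z]
  exact Finset.sum_congr rfl fun i _ => by simp [mul_comm]

theorem IsMetricOn.gradIn_eq (h : IsMetricOn G T) {y : Euc n} (hy : y ∈ T) (a b : Euc n → ℝ) :
    gradIn G a b y = dH a y (grad G b y) := by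
  rw [gradIn, h.contr_form_comp hy (K := fun u => dH a y u • grad G b y) fun u w => by
    simp [prodForm_apply, h.form_grad hy]]
  simp [sum_mul_coord]

theorem IsMetricOn.gradIn_comm (h : IsMetricOn G T) {y : Euc n} (hy : y ∈ T) (a b : Euc n → ℝ) :
    gradIn G a b y = gradIn G b a y := by
  rw [h.gradIn_eq hy, h.gradIn_eq hy, ← h.form_grad hy a, ← h.form_grad hy b,
    form_symm (h.symm y)]

/-- The covariant derivative of the gradient. -/
theorem IsMetricOn.hess_eq_form (h : IsMetricOn G T) {y : Euc n} (hy : y ∈ T)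
    (hf : ∀ z ∈ T, SmoothH f z) (u w : Euc n) :
    hess (gam G) f y u w
      = form (G y) (dH (grad G f) y u + gam G y u (grad G f y)) w := by
  have hh := h.sub hy
  have h1 := ((h.smooth_form hy).hasFDeriv.clm_apply
    (h.smooth_grad hy (hf y hy)).hasFDeriv).clm_apply (hasFDerivWithinAt_const w y (half n))
  have h2 : (fun z => form (G z) (grad G f z) w) =ᶠ[𝓝[half n] y] fun z => dH f z w := by
    filter_upwards [h.nhd y hy] with z hz using h.form_grad hz f w
  have h3 := congrArg (fun L => L u) ((dH_eq h1 hh).symm.trans (dH_congr h2 hh))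
  rw [dH_clm_apply ((hf y hy).deriv hh) hh] at h3
  simp at h3
  rw [hess_apply, ← h3, h.dH_form hy, h.form_grad hy, map_add, add_apply]
  ring

/-- The Hessian is the covariant derivative of the gradient paired with the metric, so its
contraction is the divergence of the gradient. -/
theorem IsMetricOn.lap_eq (h : IsMetricOn G T) {y : Euc n} (hy : y ∈ T)
    (hf : ∀ z ∈ T, SmoothH f z) :
    lap G f y = ∑ i, (dH (grad G f) y (stdv i) i + gam G y (stdv i) (grad G f y) i) := by
  rw [lap, h.contr_form_comp hy (h.hess_eq_form hy hf)]
  rfl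

theorem contr_const_smul (A : Matrix (Fin n) (Fin n) ℝ) {c : ℝ} (hc : c ≠ 0)
    (b : Euc n →ₗ[ℝ] Euc n →ₗ[ℝ] ℝ) : contr (c • A) b = c⁻¹ * contr A b := by
  refine contr_pullback hc (J := ContinuousLinearMap.id ℝ (Euc n)) Function.bijective_id
    (fun u v => ?_) (fun u v => rfl)
  simp only [form_apply, Finset.mul_sum, Matrix.smul_apply, smul_eq_mul]
  exact Finset.sum_congr rfl fun i _ => Finset.sum_congr rfl fun j _ => by simp; ring

theorem form_const_smul (A : Matrix (Fin n) (Fin n) ℝ) (c : ℝ) :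
    form (c • A) = c • form A := by
  ext u v
  simp only [form_apply, Finset.mul_sum, Matrix.smul_apply, smul_eq_mul, smul_apply]
  exact Finset.sum_congr rfl fun i _ => Finset.sum_congr rfl fun j _ => by ring

end Operators

/-! ### Conformal change of the weighted scalar curvature -/

section Conformal

variable {n : ℕ} [NeZero n] {G' G : Euc n → Matrix (Fin n) (Fin n) ℝ} {T : Set (Euc n)}
  {f φ : Euc n → ℝ}

/-- `G' = e^{2f} G` on `T`. -/
structure IsConformal (f : Euc n → ℝ) (G' G : Euc n → Matrix (Fin n) (Fin n) ℝ)
    (T : Set (Euc n)) : Prop where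
  met' : IsMetricOn G' T
  met : IsMetricOn G T
  smooth : ∀ y ∈ T, SmoothH f y
  eq : ∀ y ∈ T, G' y = Real.exp (2 * f y) • G y

/-- In the Koszul formula the derivative of e^{2f} contributes three terms, one for each way of
putting df on one of the three vectors; nondegeneracy of the metric turns them into vectors. -/
theorem IsConformal.gam_eq (h : IsConformal f G' G T) {y : Euc n} (hy : y ∈ T) (v w : Euc n) :
    gam G' y v w = gam G y v w + dH f y v • w + dH f y w • v
      - form (G y) v w • grad G f y := by
  have hh := h.met.sub hy
  have hD : ∀ u v w, dH (fun z => form (G' z)) y u v w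
      = Real.exp (2 * f y) * (2 * dH f y u * form (G y) v w
        + dH (fun z => form (G z)) y u v w) := by
    intro u v w
    have h0 := ((h.smooth y hy).hasFDeriv.const_mul 2).exp
    have h1 := h0.mul (((h.met.smooth_form hy).hasFDeriv.clm_apply
      (hasFDerivWithinAt_const v y (half n))).clm_apply (hasFDerivWithinAt_const w y (half n)))
    have h2 := h.met'.smooth_form hy
    rw [← dH_clm_apply h2 hh, ← dH_clm_apply (h2.clm_apply contDiffWithinAt_const) hh]
    have h3 : (fun z => form (G' z) v w) =ᶠ[𝓝[half n] y]
        fun z => Real.exp (2 * f z) * form (G z) v w := by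
      filter_upwards [h.met.nhd y hy] with z hz
      rw [h.eq z hz, form_const_smul]; simp
    have h4 := dH_eq h1 hh
    rw [dH_congr h3 hh]
    refine (congrArg (fun L => L u) h4).trans ?_
    simp
    ring
  refine form_ext (h.met'.pos y hy) fun x => ?_
  rw [h.met'.koszul hy, hD, hD, hD, h.eq y hy, form_const_smul]
  simp only [smul_apply, map_add, map_sub, add_apply, sub_apply, map_smul, smul_eq_mul,
    h.met.form_grad hy, h.met.koszul hy]
  rw [form_symm (h.met.symm y) w x, form_symm (h.met.symm y) v x]
  rw [form_symm (h.met.symm y) x w, form_symm (h.met.symm y) x v]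
  ring

/-- The conformal law of the connection is differentiated once and substituted into the curvature.
Metric compatibility turns derivatives of the metric into connection terms, which complete the
second derivatives of `f` to Hessians. -/
theorem IsConformal.curv_eq (h : IsConformal f G' G T) {y : Euc n} (hy : y ∈ T)
    (u v w : Euc n) :
    curv (gam G') y u v w = curv (gam G) y u v w
      + hess (gam G) f y u w • v - hess (gam G) f y v w • u
      - form (G y) v w • (dH (grad G f) y u + gam G y u (grad G f y))
      + form (G y) u w • (dH (grad G f) y v + gam G y v (grad G f y))
      + (dH f y v * dH f y w) • u - (dH f y u * dH f y w) • v
      - gradIn G f f y • (form (G y) v w • u - form (G y) u w • v)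
      + (dH f y u * form (G y) v w - dH f y v * form (G y) u w) • grad G f y := by
  have hh := h.met.sub hy
  have hf := h.smooth y hy
  have key : ∀ u v, dH (gam G') y u v w = dH (gam G) y u v w + dH (dH f) y u v • w
      + dH (dH f) y u w • v - dH (fun z => form (G z)) y u v w • grad G f y
      - form (G y) v w • dH (grad G f) y u := by
    intro u v
    have h2 := h.met'.smooth_gam hy
    have h1 : ∀ x, HasFDerivWithinAt (fun z => dH f z x) ((dH (dH f) y).flip x) (half n) y := by
      intro x
      simpa using (hf.deriv hh).hasFDeriv.clm_apply (hasFDerivWithinAt_const x y (half n))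
    have h5 : HasFDerivWithinAt (fun z => form (G z) v w)
        (((dH (fun z => form (G z)) y).flip v).flip w) (half n) y := by
      simpa using (((h.met.smooth_form hy).hasFDeriv.clm_apply
      (hasFDerivWithinAt_const v y (half n))).clm_apply (hasFDerivWithinAt_const w y (half n)))
    have h6 : HasFDerivWithinAt (fun z => gam G z v w)
        (((dH (gam G) y).flip v).flip w) (half n) y := by
      simpa using (((h.met.smooth_gam hy).hasFDeriv.clm_apply
      (hasFDerivWithinAt_const v y (half n))).clm_apply (hasFDerivWithinAt_const w y (half n)))
    have h4 := ((h6.add ((h1 v).smul_const w)).add ((h1 w).smul_const v)).sub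
      (h5.smul (h.met.smooth_grad hy hf).hasFDeriv)
    have h3 : (fun z => gam G' z v w) =ᶠ[𝓝[half n] y] fun z => gam G z v w + dH f z v • w
      + dH f z w • v - form (G z) v w • grad G f z := by
      filter_upwards [h.met.nhd y hy] with z hz using h.gam_eq hz v w
    rw [← dH_clm_apply h2 hh, ← dH_clm_apply (h2.clm_apply contDiffWithinAt_const) hh,
      dH_congr h3 hh]
    refine (congrArg (fun L => L u) (dH_eq h4 hh)).trans ?_
    simp
    abel
  have hB : ∀ a b, form (G y) a b = form (G y) b a := form_symm (h.met.symm y)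
  have hZ : ∀ a, form (G y) (grad G f y) a = dH f y a := h.met.form_grad hy f
  have hZ' : ∀ a, form (G y) a (grad G f y) = dH f y a := fun a => by rw [hB, hZ]
  simp only [curv, key, h.gam_eq hy, h.met.dH_form hy, hess_apply, h.met.gradIn_eq hy,
    map_add, map_sub, map_smul, smul_eq_mul, hZ']
  rw [hf.dH_symm hh v u, h.met.gam_symm hy v u, hB v u]
  module

/-- Trace of the curvature law over its first slot: the summands proportional to `u` contribute
factors n, those of the form (covector in u) times a vector contribute the covector evaluated at
that vector. -/
theorem IsConformal.ricForm_eq (h : IsConformal f G' G T) {y : Euc n} (hy : y ∈ T) :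
    ricForm (gam G') y = ricForm (gam G) y + (-((n : ℝ) - 2)) • hess (gam G) f y
      + ((n : ℝ) - 2) • prodForm (dH f y) (dH f y)
      + (-(lap G f y) - ((n : ℝ) - 2) * gradIn G f f y) • toBilin (form (G y)) := by
  ext v w
  have hx : ∀ x : Euc n, ∀ i : Fin n, x i = crd i x := fun x i => by simp
  have s1 : ∀ L : Euc n →L[ℝ] ℝ, ∀ x : Euc n, ∑ i, L (stdv i) * x i = L x := sum_mul_coord
  have hB : ∀ a b, form (G y) a b = form (G y) b a := form_symm (h.met.symm y)
  have e1 : ∑ i, hess (gam G) f y (stdv i) w * v i = hess (gam G) f y v w := by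
    conv_rhs => rw [← sum_stdv v]
    simp only [map_sum, LinearMap.sum_apply, map_smul, LinearMap.smul_apply, smul_eq_mul]
    exact Finset.sum_congr rfl fun i _ => by ring
  have e2 : ∀ x : Euc n, ∑ i, form (G y) (stdv i) w * x i = form (G y) x w := by
    intro x
    have := s1 (form (G y) w) x
    rw [hB x w, ← this]
    exact Finset.sum_congr rfl fun i _ => by rw [hB]
  have e3 : ∑ i : Fin n, (stdv i : Euc n) i = n := by simp
  have e4 := h.met.hess_eq_form hy h.smooth v w
  have e5 := h.met.lap_eq hy h.smooth
  have e6 := h.met.gradIn_eq hy f f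
  have e7 := h.met.form_grad hy f w
  simp only [LinearMap.add_apply, LinearMap.smul_apply, smul_eq_mul, toBilin_apply,
    prodForm_apply, ricForm_apply, h.curv_eq hy]
  simp only [PiLp.add_apply, PiLp.sub_apply, PiLp.smul_apply, smul_eq_mul,
    Finset.sum_add_distrib, Finset.sum_sub_distrib, ← Finset.mul_sum, mul_sub, sub_mul]
  have r1 : ∀ c : ℝ, ∑ i, dH f y (stdv i) * c * v i = c * dH f y v := by
    intro c
    rw [← s1 (dH f y) v, Finset.mul_sum]
    exact Finset.sum_congr rfl fun i _ => by ring
  have r2 : ∀ c : ℝ, ∑ i, dH f y (stdv i) * c * grad G f y i = c * gradIn G f f y := by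
    intro c
    rw [e6, ← s1 (dH f y) _, Finset.mul_sum]
    exact Finset.sum_congr rfl fun i _ => by ring
  have r3 : ∀ (c : ℝ) (x : Euc n), ∑ i, c * form (G y) (stdv i) w * x i = c * form (G y) x w := by
    intro c x
    rw [← e2, Finset.mul_sum]
    exact Finset.sum_congr rfl fun i _ => by ring
  rw [Finset.sum_add_distrib] at e5
  simp only [r1, r2, r3, e1, e2, e3, e7, mul_add, Finset.sum_add_distrib]
  rw [map_add, add_apply] at e4
  rw [e5]
  linear_combination -e4

theorem IsConformal.scal_eq (h : IsConformal f G' G T) {y : Euc n} (hy : y ∈ T) :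
    scal G' y = (Real.exp (2 * f y))⁻¹ * (scal G y - 2 * ((n : ℝ) - 1) * lap G f y
      - ((n : ℝ) - 1) * ((n : ℝ) - 2) * gradIn G f f y) := by
  rw [scal, h.eq y hy, contr_const_smul _ (Real.exp_ne_zero _), h.ricForm_eq hy]
  congr 1
  simp only [contr_add, contr_smul, h.met.contr_form hy]
  change scal G y + _ * lap G f y + _ * gradIn G f f y + _ = _
  ring

theorem IsConformal.lap_eq (h : IsConformal f G' G T) {y : Euc n} (hy : y ∈ T) (φ : Euc n → ℝ) :
    lap G' φ y = (Real.exp (2 * f y))⁻¹ * (lap G φ y + ((n : ℝ) - 2) * gradIn G f φ y) := by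
  have e : hess (gam G') φ y = hess (gam G) φ y + (-1 : ℝ) • prodForm (dH f y) (dH φ y)
      + (-1 : ℝ) • prodForm (dH φ y) (dH f y) + gradIn G φ f y • toBilin (form (G y)) := by
    ext u v
    simp only [LinearMap.add_apply, LinearMap.smul_apply, smul_eq_mul, toBilin_apply,
      prodForm_apply, hess_apply, h.gam_eq hy, map_add, map_sub, map_smul, h.met.gradIn_eq hy]
    ring
  rw [lap, h.eq y hy, contr_const_smul _ (Real.exp_ne_zero _), e]
  congr 1
  simp only [contr_add, contr_smul, h.met.contr_form hy]
  change lap G φ y + _ * gradIn G f φ y + _ * gradIn G φ f y + _ = _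
  rw [h.met.gradIn_comm hy φ f]
  ring

theorem IsConformal.gradIn_eq (h : IsConformal f G' G T) {y : Euc n} (hy : y ∈ T)
    (a b : Euc n → ℝ) : gradIn G' a b y = (Real.exp (2 * f y))⁻¹ * gradIn G a b y := by
  rw [gradIn, h.eq y hy, contr_const_smul _ (Real.exp_ne_zero _)]
  rfl

theorem IsMetricOn.lap_add_smul (h : IsMetricOn G T) {y : Euc n} (hy : y ∈ T)
    (hf : ∀ z ∈ T, SmoothH f z) (hφ : ∀ z ∈ T, SmoothH φ z) (c : ℝ) :
    lap G (fun z => φ z + c * f z) y = lap G φ y + c * lap G f y := by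
  have e1 : ∀ z ∈ T, dH (fun z => φ z + c * f z) z = dH φ z + c • dH f z := fun z hz =>
    dH_eq ((hφ z hz).hasFDeriv.add ((hf z hz).hasFDeriv.const_mul c)) (h.sub hz)
  have e2 : dH (dH (fun z => φ z + c * f z)) y = dH (dH φ) y + c • dH (dH f) y := by
    have : dH (fun z => φ z + c * f z) =ᶠ[𝓝[half n] y] fun z => dH φ z + c • dH f z := by
      filter_upwards [h.nhd y hy] with z hz using e1 z hz
    rw [dH_congr this (h.sub hy)]
    exact dH_eq (((hφ y hy).deriv (h.sub hy)).hasFDeriv.add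
      (((hf y hy).deriv (h.sub hy)).hasFDeriv.const_smul c)) (h.sub hy)
  have e3 : hess (gam G) (fun z => φ z + c * f z) y = hess (gam G) φ y + c • hess (gam G) f y := by
    ext u v
    simp only [LinearMap.add_apply, LinearMap.smul_apply, smul_eq_mul, hess_apply, e2, e1 y hy,
      add_apply, smul_apply]
    ring
  rw [lap, e3, contr_add, contr_smul]
  rfl

/-- The classical law with n replaced by n + m and the Laplacian by the weighted one: changing the
weight by -m f adds exactly the missing multiples of m. -/
theorem IsConformal.wscal_eq (h : IsConformal f G' G T) {y : Euc n} (hy : y ∈ T) {m : ℝ}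
    (hφ : ∀ z ∈ T, SmoothH φ z) (hm : m = 0 → ∀ z, φ z = 0) {φ' : Euc n → ℝ}
    (hφ' : ∀ z, φ' z = φ z - m * f z) :
    Real.exp (2 * f y) * wscal m G' φ' y = wscal m G φ y
      - 2 * ((n : ℝ) + m - 1) * (lap G f y - gradIn G φ f y)
      - ((n : ℝ) + m - 1) * ((n : ℝ) + m - 2) * gradIn G f f y := by
  have hφ'' : φ' = fun z => φ z + (-m) * f z := by ext z; rw [hφ' z]; ring
  have e1 : ∀ z ∈ T, dH φ' z = dH φ z + (-m) • dH f z := fun z hz => by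
    rw [hφ'']
    exact dH_eq ((hφ z hz).hasFDeriv.add ((h.smooth z hz).hasFDeriv.const_mul (-m))) (h.met.sub hz)
  have e2 : ∀ b, gradIn G φ' b y = gradIn G φ b y - m * gradIn G f b y := by
    intro b
    rw [h.met.gradIn_eq hy, h.met.gradIn_eq hy, h.met.gradIn_eq hy, e1 y hy]
    simp; ring
  have e3 : gradIn G φ' φ' y = gradIn G φ φ y - 2 * m * gradIn G φ f y
      + m ^ 2 * gradIn G f f y := by
    rw [e2, h.met.gradIn_comm hy φ, h.met.gradIn_comm hy f, e2, e2, h.met.gradIn_comm hy f φ]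
    ring
  have e4 : gradIn G f φ' y = gradIn G φ f y - m * gradIn G f f y := by
    rw [h.met.gradIn_comm hy f, e2]
  rw [wscal, wscal, h.scal_eq hy, h.lap_eq hy, h.gradIn_eq hy, e4, e3]
  rw [hφ'', h.met.lap_add_smul hy h.smooth hφ]
  have hne := Real.exp_ne_zero (2 * f y)
  set E := Real.exp (2 * f y)
  have e5 : ∀ X Y Z : ℝ, E * (E⁻¹ * X + 2 * (E⁻¹ * Y) - (m + 1) / m * (E⁻¹ * Z))
      = X + 2 * Y - (m + 1) / m * Z := by
    intro X Y Z
    field_simp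
  rw [e5]
  -- For `m = 0` the quotient `(m + 1) / m` is `0` by convention, and the gradient terms of the
  -- weight vanish because the weight does.
  by_cases hm0 : m = 0
  · have hz : φ = fun _ => 0 := funext (hm hm0)
    have e6 : ∀ b, gradIn G φ b y = 0 := by
      intro b
      rw [h.met.gradIn_eq hy, hz]
      simp [dH]
    rw [e6 f, e6 φ, hm0]
    simp
    ring
  · field_simp
    ring

end Conformal

/-! ### Conformal change of the mean curvature -/

section Boundary

variable {n : ℕ} [NeZero n] {G' G : Euc n → Matrix (Fin n) (Fin n) ℝ} {T : Set (Euc n)}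
  {f : Euc n → ℝ}

/-- The outward unit normal to the boundary of the half space. -/
def nrm (G : Euc n → Matrix (Fin n) (Fin n) ℝ) (y : Euc n) : Euc n :=
  WithLp.toLp 2 fun k => -(G y)⁻¹ k 0 / √((G y)⁻¹ 0 0)

/-- The mean curvature of the boundary of the half space. -/
def meanC (G : Euc n → Matrix (Fin n) (Fin n) ℝ) (y : Euc n) : ℝ :=
  -∑ i, ∑ j, ((G y)⁻¹ i j - nrm G y i * nrm G y j) *
    ∑ k, ∑ l, chr G k i j y * G y k l * nrm G y l

theorem IsMetricOn.inv_pos (h : IsMetricOn G T) {y : Euc n} (hy : y ∈ T) : 0 < (G y)⁻¹ 0 0 :=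
  (h.pos y hy).inv.diag_pos

theorem IsMetricOn.form_nrm (h : IsMetricOn G T) {y : Euc n} (hy : y ∈ T) (w : Euc n) :
    form (G y) (nrm G y) w = -w 0 / √((G y)⁻¹ 0 0) := by
  rw [form_apply, Finset.sum_comm]
  have : ∀ l, ∑ k, G y k l * (nrm G y k * w l)
      = (if l = 0 then 1 else 0) * (-w l / √((G y)⁻¹ 0 0)) := by
    intro l
    rw [← h.sum_inv hy l 0, Finset.sum_mul]
    exact Finset.sum_congr rfl fun k _ => by simp only [nrm]; ring
  simp only [this]
  simp

theorem IsMetricOn.form_nrm_self (h : IsMetricOn G T) {y : Euc n} (hy : y ∈ T) :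
    form (G y) (nrm G y) (nrm G y) = 1 := by
  rw [h.form_nrm hy]
  have h0 := h.inv_pos hy
  simp only [nrm]
  have := Real.sqrt_ne_zero'.2 h0
  field_simp
  rw [Real.sq_sqrt h0.le]

/-- The normal component of a gradient vanishes when its coordinate `0` does. -/
theorem IsMetricOn.dH_nrm (h : IsMetricOn G T) {y : Euc n} (hy : y ∈ T) (f : Euc n → ℝ) :
    dH f y (nrm G y) = -grad G f y 0 / √((G y)⁻¹ 0 0) := by
  rw [← h.form_grad hy, form_symm (h.symm y), h.form_nrm hy]

/-- The second fundamental form contracted over all of the tangent space. -/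
def sndForm (G : Euc n → Matrix (Fin n) (Fin n) ℝ) (y : Euc n) : Euc n →ₗ[ℝ] Euc n →ₗ[ℝ] ℝ :=
  LinearMap.mk₂ ℝ (fun u v => form (G y) (gam G y u v) (nrm G y))
    (fun v v' w => by simp) (fun c v w => by simp)
    (fun v w w' => by simp) (fun c v w => by simp)

theorem sndForm_apply (G : Euc n → Matrix (Fin n) (Fin n) ℝ) (y u v : Euc n) :
    sndForm G y u v = form (G y) (gam G y u v) (nrm G y) := rfl

theorem bilin_eq_sum (b : Euc n →ₗ[ℝ] Euc n →ₗ[ℝ] ℝ) (u v : Euc n) :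
    b u v = ∑ i, ∑ j, u i * v j * b (stdv i) (stdv j) := by
  conv_lhs => rw [← sum_stdv u, ← sum_stdv v]
  simp only [map_sum, LinearMap.sum_apply, map_smul, LinearMap.smul_apply, smul_eq_mul,
    Finset.mul_sum]
  rw [Finset.sum_comm]
  exact Finset.sum_congr rfl fun i _ => Finset.sum_congr rfl fun j _ => by ring

/-- The trace over the boundary directions is the full trace minus the normal-normal entry. -/
theorem meanC_eq (G : Euc n → Matrix (Fin n) (Fin n) ℝ) (y : Euc n) :
    meanC G y = -(contr (G y) (sndForm G y) - sndForm G y (nrm G y) (nrm G y)) := by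
  rw [meanC, bilin_eq_sum (sndForm G y), contr, ← Finset.sum_sub_distrib]
  congr 1
  refine Finset.sum_congr rfl fun i _ => ?_
  rw [← Finset.sum_sub_distrib]
  refine Finset.sum_congr rfl fun j _ => ?_
  rw [← sub_mul, sndForm_apply, form_apply]
  congr 1
  refine Finset.sum_congr rfl fun k _ => Finset.sum_congr rfl fun l _ => ?_
  rw [gam_single]; ring

theorem inv_const_smul (A : Matrix (Fin n) (Fin n) ℝ) {c : ℝ} (hc : c ≠ 0) :
    (c • A)⁻¹ = c⁻¹ • A⁻¹ := by
  have : c • A = (c • (1 : Matrix (Fin n) (Fin n) ℝ)) * A := by simp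
  rw [this, Matrix.mul_inv_rev]
  have : (c • (1 : Matrix (Fin n) (Fin n) ℝ))⁻¹ = c⁻¹ • 1 := by
    apply Matrix.inv_eq_right_inv
    simp [smul_smul, hc]
  rw [this]
  simp

theorem IsConformal.nrm_eq (h : IsConformal f G' G T) {y : Euc n} (hy : y ∈ T) :
    nrm G' y = Real.exp (-f y) • nrm G y := by
  ext k
  simp only [nrm, h.eq y hy, inv_const_smul _ (Real.exp_ne_zero _), Matrix.smul_apply, smul_eq_mul,
    PiLp.smul_apply]
  have h0 := Real.sqrt_ne_zero'.2 (h.met.inv_pos hy)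
  have e : (Real.exp (2 * f y))⁻¹ = Real.exp (-f y) ^ 2 := by
    rw [← Real.exp_neg, ← Real.exp_nat_mul]; congr 1; push_cast; ring
  rw [e, Real.sqrt_mul (by positivity), Real.sqrt_sq (Real.exp_pos _).le]
  have := Real.exp_ne_zero (-f y)
  field_simp

/-- The second fundamental form acquires df⊗ν♭ + ν♭⊗df - (∂f/∂ν) g. Its full trace is (2 - n) ∂f/∂ν
and its normal-normal entry is ∂f/∂ν, which leaves (1 - n) ∂f/∂ν along the boundary. -/
theorem IsConformal.meanC_eq (h : IsConformal f G' G T) {y : Euc n} (hy : y ∈ T) :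
    meanC G' y = Real.exp (-f y) * (meanC G y + ((n : ℝ) - 1) * dH f y (nrm G y)) := by
  have e1 : sndForm G' y = Real.exp (f y) • (sndForm G y
      + prodForm (dH f y) (form (G y) (nrm G y)) + prodForm (form (G y) (nrm G y)) (dH f y)
      + (-(dH f y (nrm G y))) • toBilin (form (G y))) := by
    ext u v
    have hB : ∀ a, form (G y) a (nrm G y) = form (G y) (nrm G y) a :=
      fun a => form_symm (h.met.symm y) _ _
    simp only [sndForm_apply, h.gam_eq hy, h.nrm_eq hy, h.eq y hy, form_const_smul,
      LinearMap.add_apply, LinearMap.smul_apply, smul_apply, map_smul, map_add, map_sub,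
      add_apply, sub_apply, smul_eq_mul, toBilin_apply, prodForm_apply, h.met.form_grad hy, hB]
    have : Real.exp (2 * f y) * Real.exp (-f y) = Real.exp (f y) := by
      rw [← Real.exp_add]; congr 1; ring
    rw [← this]
    ring
  have e2 : Real.exp (-f y) = Real.exp (-f y) ^ 2 * Real.exp (f y) := by
    rw [← Real.exp_nat_mul, ← Real.exp_add]; congr 1; push_cast; ring
  have e3 : (Real.exp (2 * f y))⁻¹ = Real.exp (-f y) ^ 2 := by
    rw [← Real.exp_neg, ← Real.exp_nat_mul]; congr 1; push_cast; ring
  have c1 : contr (G y) (prodForm (dH f y) (form (G y) (nrm G y))) = dH f y (nrm G y) := by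
    rw [h.met.contr_form_comp hy (K := fun u => dH f y u • nrm G y) fun u w => by
      simp [prodForm_apply]]
    simp only [PiLp.smul_apply, smul_eq_mul, sum_mul_coord]
  have c2 : contr (G y) (prodForm (form (G y) (nrm G y)) (dH f y)) = dH f y (nrm G y) := by
    rw [h.met.contr_form_comp hy (K := fun u => form (G y) (nrm G y) u • grad G f y) fun u w => by
      simp [prodForm_apply, h.met.form_grad hy]]
    simp only [PiLp.smul_apply, smul_eq_mul, sum_mul_coord]
    rw [form_symm (h.met.symm y), h.met.form_grad hy]
  rw [WeightedYamabe.meanC_eq, WeightedYamabe.meanC_eq, h.eq y hy,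
    contr_const_smul _ (Real.exp_ne_zero _), e1, h.nrm_eq hy]
  simp only [contr_add, contr_smul, c1, c2, h.met.contr_form hy, LinearMap.add_apply,
    LinearMap.smul_apply, map_smul, smul_eq_mul, prodForm_apply, toBilin_apply,
    h.met.form_nrm_self hy]
  rw [e3]
  generalize dH f y (nrm G y) = a
  generalize sndForm G y (nrm G y) (nrm G y) = b
  generalize contr (G y) (sndForm G y) = c
  rw [show Real.exp (-f y) * (-(c - b) + (n - 1) * a)
    = (Real.exp (-f y) ^ 2 * Real.exp (f y)) * (-(c - b) + (n - 1) * a) by rw [← e2]]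
  ring

end Boundary

/-! ### Jacobi's formula and the weighted divergence in coordinates -/

section Divergence

variable {n : ℕ} [NeZero n] {G : Euc n → Matrix (Fin n) (Fin n) ℝ} {T : Set (Euc n)}
  {f φ q : Euc n → ℝ}

/-- The trace is the linear coefficient of the polynomial det(1 + X M). -/
theorem hasDerivAt_det_one_add (M : Matrix (Fin n) (Fin n) ℝ) :
    HasDerivAt (fun t : ℝ => (1 + t • M).det) M.trace 0 := by
  have h := Matrix.derivative_det_one_add_X_smul M
  have h2 := (Matrix.det (1 + (Polynomial.X : Polynomial ℝ) • M.map Polynomial.C)).hasDerivAt 0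
  rw [h] at h2
  convert! h2 using 1
  ext t
  rw [← Polynomial.coe_evalRingHom, RingHom.map_det]
  congr 1
  ext i j
  simp [Matrix.one_apply]
  split_ifs <;> simp [mul_comm]

theorem contDiff_det : ContDiff ℝ ∞ fun A : Fin n → Fin n → ℝ => (Matrix.of A).det := by
  simp only [Matrix.det_apply', Matrix.of_apply]
  exact ContDiff.sum fun s _ => contDiff_const.mul (contDiff_prod fun i _ => by fun_prop)

/-- Jacobi's formula. -/
theorem fderiv_det {A : Fin n → Fin n → ℝ} (hA : IsUnit (Matrix.of A).det)
    (M : Fin n → Fin n → ℝ) :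
    fderiv ℝ (fun A : Fin n → Fin n → ℝ => (Matrix.of A).det) A M
      = (Matrix.of A).det * ((Matrix.of A)⁻¹ * Matrix.of M).trace := by
  have h1 : HasFDerivAt (fun A : Fin n → Fin n → ℝ => (Matrix.of A).det) _ (A + (0 : ℝ) • M) :=
    (contDiff_det.differentiable (by simp) _).hasFDerivAt
  have h2 : HasDerivAt (fun t : ℝ => A + t • M) M 0 := by
    simpa using ((hasDerivAt_id (0 : ℝ)).smul_const M).const_add A
  have h3 := HasFDerivAt.comp_hasDerivAt (0 : ℝ) h1 h2
  rw [zero_smul, add_zero] at h3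
  -- Along the line A + tM the determinant factors as det A · det(1 + t A⁻¹M).
  have h4 := (hasDerivAt_det_one_add ((Matrix.of A)⁻¹ * Matrix.of M)).const_mul (Matrix.of A).det
  refine h3.unique (h4.congr_of_eventuallyEq (Eventually.of_forall fun t => ?_))
  simp only [Function.comp]
  rw [← Matrix.det_mul, Matrix.mul_add, Matrix.mul_one, Matrix.mul_smul, ← Matrix.mul_assoc,
    Matrix.mul_nonsing_inv _ hA, Matrix.one_mul]
  rfl

/-- By Jacobi's formula this is the trace of G⁻¹ dG. Metric compatibility splits dG into a bilinear
form plus its transpose, which have equal contractions; hence the factor 2, which the square root in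
the density later removes. -/
theorem IsMetricOn.hasFDeriv_det (h : IsMetricOn G T) {y : Euc n} (hy : y ∈ T) (u : Euc n) :
    dH (fun z => (G z).det) y u = 2 * (G y).det * ∑ i, gam G y u (stdv i) i := by
  have hh := h.sub hy
  have hu : IsUnit (G y).det := (h.pos y hy).det_pos.ne'.isUnit
  have h1 : HasFDerivWithinAt (fun z => (fun i j => G z i j : Fin n → Fin n → ℝ))
      (ContinuousLinearMap.pi fun i => ContinuousLinearMap.pi fun j => dH (fun z => G z i j) y)
      (half n) y :=
    hasFDerivWithinAt_pi.2 fun i => hasFDerivWithinAt_pi.2 fun j => (h.smooth y hy i j).hasFDeriv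
  have h2 : HasFDerivAt (fun A : Fin n → Fin n → ℝ => (Matrix.of A).det) _ (G y) :=
    (contDiff_det.differentiable (by simp) (G y : Fin n → Fin n → ℝ)).hasFDerivAt
  have h3 := h2.comp_hasFDerivWithinAt y h1
  refine (congrArg (fun L => L u) (dH_eq h3 hh)).trans ?_
  refine (fderiv_det (A := G y) hu fun i j => dH (fun z => G z i j) y u).trans ?_
  have h5 : ∀ i j, dH (fun z => G z i j) y u
      = form (G y) (gam G y u (stdv i)) (stdv j) + form (G y) (gam G y u (stdv j)) (stdv i) := by
    intro i j
    have hB := h.smooth_form hy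
    have : (fun z => G z i j) = fun z => form (G z) (stdv i) (stdv j) := by
      ext z; rw [form_single]
    rw [this, dH_clm_apply (hB.clm_apply contDiffWithinAt_const) hh, dH_clm_apply hB hh,
      h.dH_form hy, form_symm (h.symm y) (stdv i)]
  let b : Euc n →ₗ[ℝ] Euc n →ₗ[ℝ] ℝ := LinearMap.mk₂ ℝ (fun v w => form (G y) (gam G y u v) w)
    (fun v v' w => by simp) (fun c v w => by simp) (fun v w w' => by simp) (fun c v w => by simp)
  have h6 : ((G y)⁻¹ * (Matrix.of fun i j => dH (fun z => G z i j) y u)).trace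
      = contr (G y) (b + b.flip) := by
    rw [contr_eq_trace]
    congr 2
    ext i j
    simp only [Matrix.of_apply, Matrix.transpose_apply, h5, LinearMap.add_apply,
      LinearMap.flip_apply, b, LinearMap.mk₂_apply]
    ring
  have hinv : ∀ a b, (G y)⁻¹ a b = (G y)⁻¹ b a := by
    intro a b
    have : (G y).IsSymm := Matrix.ext fun a b => h.symm y b a
    exact (this.inv.apply a b).symm
  have h7 : contr (G y) b.flip = contr (G y) b := by
    rw [contr, contr, Finset.sum_comm]
    exact Finset.sum_congr rfl fun i _ => Finset.sum_congr rfl fun j _ => by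
      rw [hinv, LinearMap.flip_apply]
  change (G y).det * ((G y)⁻¹ * (Matrix.of fun i j => dH (fun z => G z i j) y u)).trace = _
  rw [h6, contr_add, h7, h.contr_form_comp hy (b := b) (K := fun v => gam G y u v) fun v w => rfl]
  ring

/-- The weighted density of a matrix of functions. -/
def densM (G : Euc n → Matrix (Fin n) (Fin n) ℝ) (φ : Euc n → ℝ) (y : Euc n) : ℝ :=
  √(G y).det * Real.exp (-φ y)

theorem IsMetricOn.smooth_dens (h : IsMetricOn G T) {y : Euc n} (hy : y ∈ T) (hφ : SmoothH φ y) :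
    SmoothH (densM G φ) y :=
  ((smoothH_det (h.smooth y hy)).sqrt (h.pos y hy).det_pos.ne').mul hφ.neg.exp

theorem IsMetricOn.dH_dens (h : IsMetricOn G T) {y : Euc n} (hy : y ∈ T) (hφ : SmoothH φ y)
    (u : Euc n) : dH (densM G φ) y u
      = densM G φ y * (∑ i, gam G y u (stdv i) i - dH φ y u) := by
  have hd := (h.pos y hy).det_pos
  have h1 := ((smoothH_det (h.smooth y hy)).hasFDeriv.sqrt hd.ne').mul hφ.hasFDeriv.neg.exp
  refine (congrArg (fun L => L u) (dH_eq h1 (h.sub hy))).trans ?_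
  simp only [add_apply, smul_apply, smul_eq_mul, h.hasFDeriv_det hy, densM, neg_apply]
  have hs := Real.sq_sqrt hd.le
  have hs0 := Real.sqrt_ne_zero'.2 hd
  set r := √(G y).det
  rw [← hs, Pi.neg_apply]
  field_simp
  ring

/-- The logarithmic derivative of the density is the trace of the connection minus dφ. The first
part completes the coordinate divergence of the gradient to the Laplacian, the second gives the
drift term. -/
theorem IsMetricOn.divergence_eq (h : IsMetricOn G T) {y : Euc n} (hy : y ∈ T)
    (hφ : SmoothH φ y) (hq : SmoothH q y) (hf : ∀ z ∈ T, SmoothH f z) :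
    ∑ i, pderiv i (fun z => densM G φ z * q z * grad G f z i) y
      = densM G φ y * (q y * (lap G f y - gradIn G φ f y) + gradIn G q f y) := by
  have hZ := h.smooth_grad hy (hf y hy)
  have hD := h.smooth_dens hy hφ
  have h1 : ∀ i, pderiv i (fun z => densM G φ z * q z * grad G f z i) y
      = densM G φ y * q y * dH (grad G f) y (stdv i) i
        + (densM G φ y * dH q y (stdv i)
          + q y * dH (densM G φ) y (stdv i)) * grad G f y i := by
    intro i
    have e1 := hZ.hasFDeriv
    have e2 := (crd i).hasFDerivAt.comp_hasFDerivWithinAt y e1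
    have e3 := (hD.hasFDeriv.mul hq.hasFDeriv).mul e2
    refine (congrArg (fun L => L (stdv i)) (dH_eq e3 (h.sub hy))).trans ?_
    simp
    ring
  simp only [h1, h.dH_dens hy hφ]
  rw [h.lap_eq hy hf, h.gradIn_eq hy, h.gradIn_eq hy, ← sum_mul_coord (dH φ y),
    ← sum_mul_coord (dH q y)]
  have h3 : ∑ i, (gam G y (stdv i) (grad G f y)) i
      = ∑ i, (∑ j, gam G y (stdv i) (stdv j) j) * grad G f y i := by
    have e : ∀ i, (gam G y (stdv i) (grad G f y)) i
        = ∑ j, grad G f y j * gam G y (stdv j) (stdv i) i := by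
      intro i
      rw [h.gam_symm hy]
      conv_lhs => rw [← sum_stdv (grad G f y)]
      simp
    simp only [e, Finset.sum_mul]
    rw [Finset.sum_comm]
    exact Finset.sum_congr rfl fun i _ => Finset.sum_congr rfl fun j _ => by ring
  rw [Finset.sum_add_distrib (g := fun i => (gam G y (stdv i) (grad G f y)) i), h3,
    ← Finset.sum_add_distrib, ← Finset.sum_sub_distrib,
    Finset.mul_sum, ← Finset.sum_add_distrib, Finset.mul_sum]
  exact Finset.sum_congr rfl fun i _ => by ring

end Divergence

/-! ### Maps of the manifold read in charts -/

section Charts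

variable {n : ℕ} [NeZero n] {M : Type*} [TopologicalSpace M]
  [ChartedSpace (EuclideanHalfSpace n) M]

/-- The image of the chart at `x`. -/
abbrev tgt (x : M) : Set (Euc n) := (extChartAt (𝓡∂ n) x).target

/-- The domain of the chart at `x`. -/
abbrev src (x : M) : Set M := (extChartAt (𝓡∂ n) x).source

/-- The derivative of the inverse of the chart at `x`. -/
abbrev dchart (x : M) (y : Euc n) : Euc n →L[ℝ] TangentSpace (𝓡∂ n) (chartInv x y) :=
  mfderivWithin 𝓘(ℝ, Euc n) (𝓡∂ n) (chartInv x) (range (𝓡∂ n)) y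

/-- The map `Φ` in the charts at `x` and `z`. -/
def transMap (x z : M) (Φ : M → M) (y : Euc n) : Euc n := extChartAt (𝓡∂ n) z (Φ (chartInv x y))

/-- The part of the chart at `x` that `Φ` maps into the chart at `z`. -/
def transDom (x z : M) (Φ : M → M) : Set (Euc n) := tgt x ∩ chartInv x ⁻¹' (Φ ⁻¹' src (n := n) z)

theorem chartInv_mem_src {x : M} {y : Euc n} (hy : y ∈ tgt x) : chartInv x y ∈ src (n := n) x :=
  (extChartAt (𝓡∂ n) x).map_target hy

theorem chartInv_transMap {x z : M} {Φ : M → M} {y : Euc n} (hy : y ∈ transDom x z Φ) :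
    chartInv z (transMap x z Φ y) = Φ (chartInv x y) :=
  (extChartAt (𝓡∂ n) z).left_inv hy.2

theorem transMap_mem {x z : M} {Φ : M → M} {y : Euc n} (hy : y ∈ transDom x z Φ) :
    transMap x z Φ y ∈ tgt z :=
  (extChartAt (𝓡∂ n) z).map_source hy.2

theorem tgt_nhd {x : M} {y : Euc n} (hy : y ∈ tgt x) : tgt x ∈ 𝓝[half n] y :=
  extChartAt_target_mem_nhdsWithin_of_mem hy

theorem continuousOn_chartInv (x : M) : ContinuousOn (chartInv (n := n) x) (tgt x) :=
  continuousOn_extChartAt_symm x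

theorem isOpen_src (x : M) : IsOpen (src (n := n) x) := isOpen_extChartAt_source x

theorem continuousWithinAt_chartInv {x : M} {y : Euc n} (hy : y ∈ tgt x) :
    ContinuousWithinAt (chartInv (n := n) x) (half n) y :=
  (continuousOn_chartInv x y hy).mono_of_mem_nhdsWithin (tgt_nhd hy)

theorem transDom_nhd {x z : M} {Φ : M → M} (hΦ : Continuous Φ) {y : Euc n}
    (hy : y ∈ transDom x z Φ) : transDom x z Φ ∈ 𝓝[half n] y :=
  inter_mem (tgt_nhd hy.1) ((continuousWithinAt_chartInv hy.1).preimage_mem_nhdsWithin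
    (((isOpen_src z).preimage hΦ).mem_nhds hy.2))

variable [IsManifold (𝓡∂ n) ∞ M]

theorem contMDiffWithinAt_chartInv {x : M} {y : Euc n} (hy : y ∈ tgt x) :
    ContMDiffWithinAt 𝓘(ℝ, Euc n) (𝓡∂ n) ∞ (chartInv x) (half n) y :=
  contMDiffWithinAt_extChartAt_symm_range x hy

theorem smoothH_comp_chartInv {W : Type*} [NormedAddCommGroup W] [NormedSpace ℝ W] {f : M → W}
    (hf : ContMDiff (𝓡∂ n) 𝓘(ℝ, W) ∞ f) {x : M} {y : Euc n} (hy : y ∈ tgt x) :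
    SmoothH (f ∘ chartInv x) y :=
  contMDiffWithinAt_iff_contDiffWithinAt.1
    ((hf _).comp_contMDiffWithinAt y (contMDiffWithinAt_chartInv hy))

theorem smoothH_transMap {x z : M} {Φ : M → M} (hΦ : ContMDiff (𝓡∂ n) (𝓡∂ n) ∞ Φ) {y : Euc n}
    (hy : y ∈ transDom x z Φ) : SmoothH (transMap x z Φ) y := by
  refine contMDiffWithinAt_iff_contDiffWithinAt.1 ?_
  have h1 := (hΦ _).comp_contMDiffWithinAt y (contMDiffWithinAt_chartInv hy.1)
  have h2 : ContMDiffAt (𝓡∂ n) 𝓘(ℝ, Euc n) ∞ (extChartAt (𝓡∂ n) z) (Φ (chartInv x y)) :=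
    contMDiffAt_extChartAt' (by rw [← extChartAt_source (𝓡∂ n)]; exact hy.2)
  exact h2.comp_contMDiffWithinAt y h1

theorem bijective_dchart {x : M} {y : Euc n} (hy : y ∈ tgt x) :
    Function.Bijective (dchart x y) :=
  have : IsManifold (𝓡∂ n) 1 M := .of_le (m := 1) (n := ∞) (by simp)
  (isInvertible_mfderivWithin_extChartAt_symm hy).bijective

/-- Chain rule for the two sides of z⁻¹ ∘ (map in charts) = Φ ∘ x⁻¹, which agree near `y` in the
half space; derivatives within the half space are unique. -/
theorem dchart_transMap {x z : M} {Φ : M → M} (hΦ : ContMDiff (𝓡∂ n) (𝓡∂ n) ∞ Φ) {y : Euc n}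
    (hy : y ∈ transDom x z Φ) (v : Euc n) :
    (dchart z (transMap x z Φ y) (dH (transMap x z Φ) y v) : Euc n)
      = mfderiv (𝓡∂ n) (𝓡∂ n) Φ (chartInv x y) (dchart x y v) := by
  have hy' : y ∈ half n := extChartAt_target_subset_range x hy.1
  have hF := transMap_mem hy
  have h1 : HasMFDerivWithinAt 𝓘(ℝ, Euc n) 𝓘(ℝ, Euc n) (transMap x z Φ) (half n) y
      (dH (transMap x z Φ) y) := (smoothH_transMap hΦ hy).hasFDeriv.hasMFDerivWithinAt
  have h2 : HasMFDerivWithinAt 𝓘(ℝ, Euc n) (𝓡∂ n) (chartInv z) (half n) (transMap x z Φ y)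
      (dchart z (transMap x z Φ y)) :=
    ((contMDiffWithinAt_chartInv hF).mdifferentiableWithinAt (by simp)).hasMFDerivWithinAt
  have hT := transDom_nhd hΦ.continuous hy
  have hsub : transDom x z Φ ⊆ half n := fun w hw => extChartAt_target_subset_range x hw.1
  have h3 := (HasMFDerivWithinAt.comp y h2 (h1.mono hsub) fun w hw =>
    extChartAt_target_subset_range z (transMap_mem hw)).mono_of_mem_nhdsWithin hT
  have h4 : HasMFDerivWithinAt 𝓘(ℝ, Euc n) (𝓡∂ n) (chartInv x) (half n) y (dchart x y) :=
    ((contMDiffWithinAt_chartInv hy.1).mdifferentiableWithinAt (by simp)).hasMFDerivWithinAt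
  have h5 : HasMFDerivAt (𝓡∂ n) (𝓡∂ n) Φ (chartInv x y) _ :=
    ((hΦ _).mdifferentiableAt (by simp)).hasMFDerivAt
  have h6 := h5.comp_hasMFDerivWithinAt y h4
  have h7 : (chartInv z ∘ transMap x z Φ) =ᶠ[𝓝[half n] y] Φ ∘ chartInv x := by
    filter_upwards [transDom_nhd hΦ.continuous hy] with w hw using chartInv_transMap hw
  have h8 := h6.congr_of_eventuallyEq h7 (chartInv_transMap hy)
  have hu : UniqueMDiffWithinAt 𝓘(ℝ, Euc n) (half n) y :=
    (uniqueDiffOn_half y hy').uniqueMDiffWithinAt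
  have h9 := h3.mfderivWithin hu
  have h10 := h8.mfderivWithin hu
  have h11 := congrArg (fun L : Euc n →L[ℝ] Euc n => L v) (h9.symm.trans h10)
  exact h11

theorem bijective_dH_transMap {x z : M} (Φ : M ≃ₘ^∞⟮𝓡∂ n, 𝓡∂ n⟯ M) {y : Euc n}
    (hy : y ∈ transDom x z Φ) : Function.Bijective (dH (transMap x z Φ) y) := by
  have h1 := bijective_dchart (transMap_mem hy)
  have h2 := bijective_dchart hy.1
  have h3 : Function.Bijective (mfderiv (𝓡∂ n) (𝓡∂ n) Φ (chartInv x y)) := by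
    rw [← Φ.mfderivToContinuousLinearEquiv_coe (by simp)]
    exact (Φ.mfderivToContinuousLinearEquiv (by simp) _).bijective
  have h4 : ⇑(dchart z (transMap x z Φ y)) ∘ (dH (transMap x z Φ) y)
      = ⇑(mfderiv (𝓡∂ n) (𝓡∂ n) Φ (chartInv x y)) ∘ ⇑(dchart x y) :=
    funext fun v => dchart_transMap Φ.contMDiff hy v
  have h5 : Function.Bijective (⇑(dchart z (transMap x z Φ y)) ∘ (dH (transMap x z Φ) y)) := by
    rw [h4]; exact h3.comp h2
  exact (Function.Bijective.of_comp_iff' h1 _).1 h5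

end Charts

/-! ### The Gram matrix of a Riemannian metric in a chart -/

section Gram

variable {n : ℕ} [NeZero n] {M : Type*} [TopologicalSpace M]
  [ChartedSpace (EuclideanHalfSpace n) M] [IsManifold (𝓡∂ n) ∞ M]

theorem form_gram (g : Metric n M) (x : M) (y v w : Euc n) :
    form (gram g x y) v w = g.inner (chartInv x y) (dchart x y v) (dchart x y w) := by
  rw [form_apply]
  conv_rhs => rw [← sum_stdv v, ← sum_stdv w]
  have e : ∀ (a : Euc n), dchart x y (∑ i, a i • stdv i) = ∑ i, a i • coordVec x i y := by
    intro a
    simp only [map_sum, map_smul]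
    rfl
  rw [e v, e w]
  simp only [map_sum, map_smul, sum_apply, smul_apply, smul_eq_mul, Finset.mul_sum]
  rw [Finset.sum_comm]
  refine Finset.sum_congr rfl fun i _ => Finset.sum_congr rfl fun j _ => ?_
  simp only [gram, Matrix.of_apply]
  ring

theorem posDef_of_form {A : Matrix (Fin n) (Fin n) ℝ} (hs : ∀ i j, A i j = A j i)
    (h : ∀ v, v ≠ 0 → 0 < form A v v) : A.PosDef := by
  refine Matrix.PosDef.of_dotProduct_mulVec_pos (Matrix.ext fun i j => ?_) fun x hx => ?_
  · simp [hs i j]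
  · have h3 : star x ⬝ᵥ A.mulVec x = form A (WithLp.toLp 2 x) (WithLp.toLp 2 x) := by
      simp only [dotProduct, Matrix.mulVec, Finset.mul_sum, form_apply]
      refine Finset.sum_congr rfl fun i _ => Finset.sum_congr rfl fun j _ => ?_
      simp; ring
    rw [h3]
    exact h _ (by simpa using hx)

/-- The coordinate field is the tangent map of the inverse chart applied to a constant section, and
the tangent map of a smooth map is smooth. -/
theorem contMDiffWithinAt_coordVec (x : M) (i : Fin n) {y : Euc n} (hy : y ∈ tgt x) :
    ContMDiffWithinAt 𝓘(ℝ, Euc n) (𝓡∂ n).tangent ∞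
      (fun z => (⟨chartInv x z, coordVec x i z⟩ : TangentBundle (𝓡∂ n) M)) (half n) y := by
  have : IsManifold (𝓡∂ n) 1 M := .of_le (m := 1) (n := ∞) (by simp)
  have hu : UniqueMDiffOn 𝓘(ℝ, Euc n) (tgt x) :=
    (uniqueDiffOn_extChartAt_target x).uniqueMDiffOn
  have h1 := (contMDiffOn_extChartAt_symm (I := 𝓡∂ n) (n := ∞) x).contMDiffOn_tangentMapWithin
    (m := ∞) (by simp) hu
  have h2 : ContMDiffWithinAt 𝓘(ℝ, Euc n) 𝓘(ℝ, Euc n).tangent ∞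
      (fun z => (⟨z, stdv i⟩ : TangentBundle 𝓘(ℝ, Euc n) (Euc n))) (tgt x) y :=
    contMDiffWithinAt_vectorSpace_iff_contDiffWithinAt.2 contDiffWithinAt_const
  have h3 := (h1 ⟨y, stdv i⟩ hy).comp y h2 (fun z hz => hz)
  have h4 := h3.mono_of_mem_nhdsWithin (tgt_nhd hy)
  refine h4.congr_of_eventuallyEq_of_mem ?_ (extChartAt_target_subset_range x hy)
  filter_upwards [tgt_nhd hy] with z hz
  simp only [Function.comp, tangentMapWithin]
  congr 1
  simp only [coordVec]
  have : mfderivWithin 𝓘(ℝ, Euc n) (𝓡∂ n) (chartInv x) (range (𝓡∂ n)) z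
      = mfderivWithin 𝓘(ℝ, Euc n) (𝓡∂ n) (chartInv x) (tgt x) z := by
    refine mfderivWithin_congr_set ?_
    have h5 := tgt_nhd hz
    rw [mem_nhdsWithin_iff_eventually] at h5
    filter_upwards [h5] with w hw
    exact propext ⟨fun h => hw h, fun h => extChartAt_target_subset_range x h⟩
  rw [this]
  rfl

theorem smoothH_gram (g : Metric n M) (x : M) {y : Euc n} (hy : y ∈ tgt x) (i j : Fin n) :
    SmoothH (fun z => gram g x z i j) y := by
  have h1 := (g.contMDiff (chartInv x y)).comp_contMDiffWithinAt y (contMDiffWithinAt_chartInv hy)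
  have h2 := ContMDiffWithinAt.clm_bundle_apply₂ (F₁ := Euc n) (F₂ := Euc n) (F₃ := ℝ)
    (E₁ := fun p : M => TangentSpace (𝓡∂ n) p) (E₂ := fun p : M => TangentSpace (𝓡∂ n) p)
    (E₃ := fun _ : M => ℝ) (b := chartInv x)
    (ψ := fun z => g.inner (chartInv x z)) h1 (contMDiffWithinAt_coordVec x i hy)
    (contMDiffWithinAt_coordVec x j hy)
  have h3 := (Bundle.contMDiffWithinAt_totalSpace.1 h2).2
  exact contMDiffWithinAt_iff_contDiffWithinAt.1 h3

theorem gram_symm (g : Metric n M) (x : M) (z : Euc n) (i j : Fin n) :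
    gram g x z i j = gram g x z j i := g.symm _ _ _

theorem isMetricOn_gram (g : Metric n M) (x : M) : IsMetricOn (gram g x) (tgt x) where
  sub := extChartAt_target_subset_range x
  nhd := fun _ hy => tgt_nhd hy
  symm := gram_symm g x
  smooth := fun _ hy i j => smoothH_gram g x hy i j
  pos := fun y hy => posDef_of_form (gram_symm g x y) fun v hv => by
    rw [form_gram]
    refine g.pos _ _ fun h => hv ?_
    exact (bijective_dchart hy).1 (h.trans (map_zero _).symm)

theorem IsMetricOn.mono {G : Euc n → Matrix (Fin n) (Fin n) ℝ} {T T' : Set (Euc n)}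
    (h : IsMetricOn G T) (hT : T' ⊆ T) (hn : ∀ y ∈ T', T' ∈ 𝓝[half n] y) : IsMetricOn G T' where
  sub := hT.trans h.sub
  nhd := hn
  symm := h.symm
  smooth := fun y hy => h.smooth y (hT hy)
  pos := fun y hy => h.pos y (hT hy)

/-- The bridge from the manifold to the half space. It is used both with the identity, to compare
two charts, and with the soliton diffeomorphisms. -/
theorem isPullback_gram {g' g : Metric n M} {s : ℝ} (hs : s ≠ 0) (Φ : M ≃ₘ^∞⟮𝓡∂ n, 𝓡∂ n⟯ M)
    (h : ∀ (p : M) (v w : TangentSpace (𝓡∂ n) p), g'.inner p v w = s *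
      g.inner (Φ p) (mfderiv (𝓡∂ n) (𝓡∂ n) Φ p v) (mfderiv (𝓡∂ n) (𝓡∂ n) Φ p w)) (x z : M) :
    IsPullback s (transMap x z Φ) (gram g' x) (transDom x z Φ) (gram g z) (tgt z) where
  met' := (isMetricOn_gram g' x).mono inter_subset_left
    fun _ hy => transDom_nhd Φ.continuous hy
  met := isMetricOn_gram g z
  ne := hs
  smooth := fun _ hy => smoothH_transMap Φ.contMDiff hy
  maps := fun _ hy => transMap_mem hy
  bij := fun _ hy => bijective_dH_transMap Φ hy
  eq := fun y hy u v => by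
    have e : ∀ (p q : M) (hpq : p = q) (a b a' b' : Euc n), a = a' → b = b' →
        g.inner p a b = g.inner q a' b' := by
      rintro p q rfl a b a' b' rfl rfl; rfl
    rw [form_gram, form_gram, h]
    congr 1
    exact e _ _ (chartInv_transMap hy).symm _ _ _ _ (dchart_transMap Φ.contMDiff hy u).symm
      (dchart_transMap Φ.contMDiff hy v).symm

end Gram

/-! ### Smoothness of the weighted scalar curvature -/

section Smooth

variable {n : ℕ} [NeZero n] {G : Euc n → Matrix (Fin n) (Fin n) ℝ} {T : Set (Euc n)}
  {f φ : Euc n → ℝ}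

theorem IsMetricOn.smooth_contr (h : IsMetricOn G T) {y : Euc n} (hy : y ∈ T)
    {b : Euc n → Euc n →ₗ[ℝ] Euc n →ₗ[ℝ] ℝ}
    (hb : ∀ j k : Fin n, SmoothH (fun z => b z (stdv j) (stdv k)) y) :
    SmoothH (fun z => contr (G z) (b z)) y :=
  ContDiffWithinAt.sum fun j _ => ContDiffWithinAt.sum fun k _ => (h.smooth_inv hy j k).mul (hb j k)

theorem smoothH_curv {Γ : Euc n → Euc n →L[ℝ] Euc n →L[ℝ] Euc n} {y : Euc n} (hy : y ∈ half n)
    (h : SmoothH Γ y) (u v w : Euc n) : SmoothH (fun z => curv Γ z u v w) y := by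
  have c : ∀ x : Euc n, SmoothH (fun _ : Euc n => x) y := fun x => contDiffWithinAt_const
  have hd := h.deriv hy
  exact (((((hd.clm_apply (c u)).clm_apply (c v)).clm_apply (c w)).sub
    (((hd.clm_apply (c v)).clm_apply (c u)).clm_apply (c w))).add
    ((h.clm_apply (c u)).clm_apply ((h.clm_apply (c v)).clm_apply (c w)))).sub
    ((h.clm_apply (c v)).clm_apply ((h.clm_apply (c u)).clm_apply (c w)))

theorem IsMetricOn.smooth_lap (h : IsMetricOn G T) {y : Euc n} (hy : y ∈ T) (hf : SmoothH f y) :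
    SmoothH (lap G f) y := by
  have c : ∀ x : Euc n, SmoothH (fun _ : Euc n => x) y := fun x => contDiffWithinAt_const
  have hd := hf.deriv (h.sub hy)
  exact h.smooth_contr hy fun j k => (((hd.deriv (h.sub hy)).clm_apply (c _)).clm_apply (c _)).sub
    (hd.clm_apply (((h.smooth_gam hy).clm_apply (c _)).clm_apply (c _)))

theorem IsMetricOn.smooth_gradIn (h : IsMetricOn G T) {y : Euc n} (hy : y ∈ T) (hf : SmoothH f y)
    (hφ : SmoothH φ y) : SmoothH (gradIn G f φ) y :=
  h.smooth_contr hy fun _ _ => ((hf.deriv (h.sub hy)).clm_apply contDiffWithinAt_const).mul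
    ((hφ.deriv (h.sub hy)).clm_apply contDiffWithinAt_const)

theorem IsMetricOn.smooth_wscal (h : IsMetricOn G T) {y : Euc n} (hy : y ∈ T)
    (hφ : SmoothH φ y) (m : ℝ) : SmoothH (wscal m G φ) y := by
  have h1 : SmoothH (scal G) y := h.smooth_contr hy fun j k => by
    simp only [ricForm_apply]
    exact ContDiffWithinAt.sum fun i _ => contDiffWithinAt_euclidean.1 (smoothH_curv (h.sub hy) (h.smooth_gam hy) _ _ _) i
  exact (h1.add (contDiffWithinAt_const.mul (h.smooth_lap hy hφ))).sub
    (contDiffWithinAt_const.mul (h.smooth_gradIn hy hφ hφ))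

end Smooth

/-! ### Coordinate operators and the quantities defined on the manifold -/

section Link

variable {n : ℕ} [NeZero n] {M : Type*} [TopologicalSpace M]
  [ChartedSpace (EuclideanHalfSpace n) M] [IsManifold (𝓡∂ n) ∞ M] {m : ℝ}

theorem SMMS.smoothH_φ (S : SMMS n M m) {x : M} {y : Euc n} (hy : y ∈ tgt x) :
    SmoothH (S.φ ∘ chartInv x) y := smoothH_comp_chartInv S.smooth_φ hy

theorem ricci_eq (g : Metric n M) {x : M} {y : Euc n} (hy : y ∈ tgt x) (j k : Fin n) :
    ricci g x j k y = ricForm (gam (gram g x)) y (stdv j) (stdv k) := by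
  have h := isMetricOn_gram g x
  have hh := h.sub hy
  rw [ricci, ricForm_apply]
  refine Finset.sum_congr rfl fun i _ => ?_
  have e1 : ∀ a l b c : Fin n, pderiv a (christoffel g x l b c) y
      = dH (gam (gram g x)) y (stdv a) (stdv b) (stdv c) l := by
    intro a l b c
    have hs := h.smooth_gam hy
    have cc : ∀ x : Euc n, SmoothH (fun _ : Euc n => x) y := fun x => contDiffWithinAt_const
    rw [← dH_clm_apply hs hh, ← dH_clm_apply (hs.clm_apply (cc _)) hh,
      ← dH_coord ((hs.clm_apply (cc _)).clm_apply (cc _)) hh]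
    simp only [gam_single]
    rfl
  have e2 : ∀ l a b c : Fin n, ∀ v : Euc n, (gam (gram g x) y (stdv a) v) l
      = ∑ p, christoffel g x l a p y * v p := by
    intro l a b c v
    rw [gam_apply, Finset.sum_eq_single a]
    · simp; rfl
    · intro b _ hb; simp [hb]
    · simp
  have e3 : ∀ a b p : Fin n, (gam (gram g x) y (stdv a) (stdv b)) p = christoffel g x p a b y :=
    fun a b p => gam_single _ _ _ _ _
  simp only [curv, PiLp.sub_apply, PiLp.add_apply, e1, e2 i i i i, e2 i j i i, e3,
    Finset.sum_sub_distrib]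
  ring

theorem SMMS.weightedScalarCurvature_eq (S : SMMS n M m) (p : M) :
    S.weightedScalarCurvature p
      = wscal m (gram S.g p) (S.φ ∘ chartInv p) (extChartAt (𝓡∂ n) p p) := by
  have hy : extChartAt (𝓡∂ n) p p ∈ tgt p := mem_extChartAt_target p
  have hh := (isMetricOn_gram S.g p).sub hy
  rw [SMMS.weightedScalarCurvature, wscal]
  congr 1
  · congr 1
    · rw [scalarCurvature, scal, contr]
      simp only [ricci_eq S.g hy]
    · congr 1
      rw [laplacian, lap, contr]
      refine Finset.sum_congr rfl fun i _ => Finset.sum_congr rfl fun j _ => ?_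
      congr 1
      rw [hess_apply]
      congr 1
      · exact dH_clm_apply ((S.smoothH_φ hy).deriv hh) hh _ _
      · rw [map_eq_sum]
        refine Finset.sum_congr rfl fun k _ => ?_
        rw [gam_single]
        rfl
  · congr 1
    rw [gradNormSq, gradIn, contr]
    refine Finset.sum_congr rfl fun i _ => Finset.sum_congr rfl fun j _ => ?_
    rw [mul_assoc]
    rfl

theorem SMMS.weightedMeanCurvature_eq (ε : ℝ) (S : SMMS n M m) (p : M) :
    S.weightedMeanCurvature ε p = meanC (gram S.g p) (extChartAt (𝓡∂ n) p p)
      + ε * dH (S.φ ∘ chartInv p) (extChartAt (𝓡∂ n) p p)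
        (nrm (gram S.g p) (extChartAt (𝓡∂ n) p p)) := by
  rw [SMMS.weightedMeanCurvature]
  congr 2
  rw [normalDeriv, map_eq_sum]
  rfl

theorem SMMS.weightedScalarCurvature_pullback {S' S : SMMS n M m} {s c : ℝ} (hs : s ≠ 0)
    (Φ : M ≃ₘ^∞⟮𝓡∂ n, 𝓡∂ n⟯ M)
    (h : ∀ (p : M) (v w : TangentSpace (𝓡∂ n) p), S'.g.inner p v w = s *
      S.g.inner (Φ p) (mfderiv (𝓡∂ n) (𝓡∂ n) Φ p v) (mfderiv (𝓡∂ n) (𝓡∂ n) Φ p w))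
    (hφ : ∀ p, S'.φ p = S.φ (Φ p) + c) {x z p : M} (hp : p ∈ src (n := n) x)
    (hz : Φ p ∈ src (n := n) z) :
    wscal m (gram S'.g x) (S'.φ ∘ chartInv x) (extChartAt (𝓡∂ n) x p)
      = s⁻¹ * wscal m (gram S.g z) (S.φ ∘ chartInv z) (extChartAt (𝓡∂ n) z (Φ p)) := by
  have e : chartInv x (extChartAt (𝓡∂ n) x p) = p := (extChartAt (𝓡∂ n) x).left_inv hp
  have hy : extChartAt (𝓡∂ n) x p ∈ transDom x z Φ :=
    ⟨(extChartAt (𝓡∂ n) x).map_source hp, by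
      rw [mem_preimage, e]; exact hz⟩
  have := (isPullback_gram hs Φ h x z).wscal_eq hy m (φ := S.φ ∘ chartInv z)
    (φ' := S'.φ ∘ chartInv x) (c := c) (fun w hw => S.smoothH_φ hw) fun w hw => by
      simp only [Function.comp]
      rw [chartInv_transMap hw, hφ]
  rw [this, transMap, e]

/-- The curvature at `p` is defined in the chart centred at `p`, which varies with `p`. Naturality
under the identity lets one fixed chart be used near a point, as continuity and integration require.
-/
theorem SMMS.weightedScalarCurvature_chart (S : SMMS n M m) {z p : M} (hz : p ∈ src (n := n) z) :
    S.weightedScalarCurvature p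
      = wscal m (gram S.g z) (S.φ ∘ chartInv z) (extChartAt (𝓡∂ n) z p) := by
  have := S.weightedScalarCurvature_pullback (S' := S) (s := 1) (c := 0) one_ne_zero
    (Diffeomorph.refl (𝓡∂ n) M ∞) (fun p v w => by simp; rfl) (fun p => by simp) (x := p) (z := z)
    (mem_extChartAt_source p) hz
  rw [S.weightedScalarCurvature_eq, this]
  simp

theorem SMMS.continuous_weightedScalarCurvature (S : SMMS n M m) :
    Continuous S.weightedScalarCurvature := by
  refine continuous_iff_continuousAt.2 fun p => ?_
  have hy : extChartAt (𝓡∂ n) p p ∈ tgt p := mem_extChartAt_target p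
  have h1 := ((isMetricOn_gram S.g p).smooth_wscal hy (S.smoothH_φ hy) m).continuousWithinAt
  have h2 : ContinuousAt (fun q => wscal m (gram S.g p) (S.φ ∘ chartInv p)
      (extChartAt (𝓡∂ n) p q)) p := by
    refine h1.tendsto.comp (tendsto_nhdsWithin_iff.2 ⟨continuousAt_extChartAt p, ?_⟩)
    filter_upwards [extChartAt_source_mem_nhds (I := 𝓡∂ n) p] with q hq
    exact extChartAt_target_subset_range p ((extChartAt (𝓡∂ n) p).map_source hq)
  refine h2.congr ?_
  filter_upwards [extChartAt_source_mem_nhds (I := 𝓡∂ n) p] with q hq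
  exact (S.weightedScalarCurvature_chart hq).symm

theorem SMMS.weightedScalarCurvature_diffeo {S' S : SMMS n M m} {s c : ℝ} (hs : s ≠ 0)
    (Φ : M ≃ₘ^∞⟮𝓡∂ n, 𝓡∂ n⟯ M)
    (h : ∀ (p : M) (v w : TangentSpace (𝓡∂ n) p), S'.g.inner p v w = s *
      S.g.inner (Φ p) (mfderiv (𝓡∂ n) (𝓡∂ n) Φ p v) (mfderiv (𝓡∂ n) (𝓡∂ n) Φ p w))
    (hφ : ∀ p, S'.φ p = S.φ (Φ p) + c) (p : M) :
    S'.weightedScalarCurvature p = s⁻¹ * S.weightedScalarCurvature (Φ p) := by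
  rw [S'.weightedScalarCurvature_eq, S.weightedScalarCurvature_eq]
  exact SMMS.weightedScalarCurvature_pullback hs Φ h hφ (mem_extChartAt_source p)
    (mem_extChartAt_source (Φ p))

end Link

open MeasureTheory

/-! ### Gluing measures along a cover -/

section Glue

/-- Induction on the finite cover: a new set contributes its own measure only on the part not
covered before, and agreement on overlaps keeps the restrictions correct. -/
theorem exists_measure_of_cover {α ι : Type*} [MeasurableSpace α] {U : ι → Set α}
    (hU : ∀ i, MeasurableSet (U i)) {ν : ι → Measure α}
    (h : ∀ i j, (ν i).restrict (U i ∩ U j) = (ν j).restrict (U i ∩ U j)) {t : Finset ι}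
    (ht : ⋃ i ∈ t, U i = univ) :
    ∃ μ : Measure α, ∀ j, μ.restrict (U j) = (ν j).restrict (U j) := by
  classical
  have key : ∀ t : Finset ι, ∃ μ : Measure α, ∀ j,
      μ.restrict (U j) = (ν j).restrict (U j ∩ ⋃ i ∈ t, U i) := by
    intro t
    induction t using Finset.induction_on with
    | empty => exact ⟨0, fun j => by simp⟩
    | insert a t _ ih =>
      obtain ⟨μ, hμ⟩ := ih
      set W := ⋃ i ∈ t, U i with hW
      have hWm : MeasurableSet W := Finset.measurableSet_biUnion t fun i _ => hU i
      refine ⟨μ + (ν a).restrict (U a \ W), fun j => ?_⟩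
      have e1 : (ν a).restrict (U j ∩ (U a \ W)) = (ν j).restrict (U j ∩ (U a \ W)) := by
        have e : U j ∩ (U a \ W) = (U j ∩ (U a \ W)) ∩ (U a ∩ U j) := by
          ext p; simp; tauto
        have hm : MeasurableSet (U j ∩ (U a \ W)) := (hU j).inter ((hU a).diff hWm)
        rw [e, ← Measure.restrict_restrict hm, h a j, Measure.restrict_restrict hm]
      have e2 : U j ∩ ⋃ i ∈ insert a t, U i = (U j ∩ W) ∪ (U j ∩ (U a \ W)) := by
        rw [Finset.set_biUnion_insert, ← hW]
        ext p; simp; tauto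
      rw [Measure.restrict_add, hμ, Measure.restrict_restrict (hU j), e1, e2,
        Measure.restrict_union _ ((hU j).inter ((hU a).diff hWm))]
      exact disjoint_left.2 fun p h1 h2 => h2.2.2 h1.2
  obtain ⟨μ, hμ⟩ := key t
  exact ⟨μ, fun j => by rw [hμ, ht, inter_univ]⟩

theorem measurableSet_inter_preimage_of_continuousOn {α β : Type*} [TopologicalSpace α]
    [MeasurableSpace α] [OpensMeasurableSpace α] [TopologicalSpace β] [MeasurableSpace β]
    [BorelSpace β] {f : α → β} {s : Set α} (hf : ContinuousOn f s) (hs : MeasurableSet s)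
    {A : Set β} (hA : MeasurableSet A) : MeasurableSet (s ∩ f ⁻¹' A) := by
  have h1 : Measurable fun p : s => f p := (continuousOn_iff_continuous_domRestrict.1 hf).measurable
  have h2 := hs.subtype_image (h1 hA)
  convert! h2 using 1
  ext p
  simp [and_comm]

end Glue

/-! ### The weighted volume measure -/

section Volume

variable {n : ℕ} [NeZero n] {M : Type*} [TopologicalSpace M]
  [ChartedSpace (EuclideanHalfSpace n) M] [IsManifold (𝓡∂ n) ∞ M] {m : ℝ}
  [MeasurableSpace M] [BorelSpace M]

theorem isClosed_half : IsClosed (half n) := (𝓡∂ n).isClosed_range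

theorem measurableSet_tgt (x : M) : MeasurableSet (tgt (n := n) x) := by
  rw [tgt, extChartAt_target]
  exact (((chartAt _ x).open_target.preimage (𝓡∂ n).continuous_symm).measurableSet).inter
    isClosed_half.measurableSet

/-- The weighted density in the chart at `x`. -/
def SMMS.dens (S : SMMS n M m) (x : M) : Euc n → ℝ := densM (gram S.g x) (S.φ ∘ chartInv x)

theorem SMMS.dens_nonneg (S : SMMS n M m) (x : M) (y : Euc n) : 0 ≤ S.dens x y :=
  mul_nonneg (Real.sqrt_nonneg _) (Real.exp_pos _).le

theorem SMMS.dens_pos (S : SMMS n M m) {x : M} {y : Euc n} (hy : y ∈ tgt x) : 0 < S.dens x y :=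
  mul_pos (Real.sqrt_pos.2 ((isMetricOn_gram S.g x).pos y hy).det_pos) (Real.exp_pos _)

theorem SMMS.continuousOn_dens (S : SMMS n M m) (x : M) : ContinuousOn (S.dens x) (tgt x) :=
  fun _ hy => ((isMetricOn_gram S.g x).smooth_dens hy (S.smoothH_φ hy)).continuousWithinAt.mono
    ((isMetricOn_gram S.g x).sub)

/-- The weighted volume measure of the chart at `x`. -/
def SMMS.chartMeasure (S : SMMS n M m) (x : M) : Measure M :=
  ((volume.restrict (tgt x)).withDensity fun y => ENNReal.ofReal (S.dens x y)).map (chartInv x)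

theorem SMMS.aemeasurable_dens (S : SMMS n M m) (x : M) :
    AEMeasurable (fun y => ENNReal.ofReal (S.dens x y)) (volume.restrict (tgt x)) :=
  ((S.continuousOn_dens x).aemeasurable (measurableSet_tgt x)).ennreal_ofReal

theorem SMMS.aemeasurable_chartInv (S : SMMS n M m) (x : M) : AEMeasurable (chartInv x)
    ((volume.restrict (tgt x)).withDensity fun y => ENNReal.ofReal (S.dens x y)) :=
  ((continuousOn_chartInv x).aemeasurable (measurableSet_tgt x)).mono_ac
    (withDensity_absolutelyContinuous _ _)

theorem SMMS.chartMeasure_apply (S : SMMS n M m) (x : M) {A : Set M} (hA : MeasurableSet A) :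
    S.chartMeasure x A = ∫⁻ y in tgt x ∩ chartInv x ⁻¹' A, ENNReal.ofReal (S.dens x y) := by
  rw [SMMS.chartMeasure, Measure.map_apply_of_aemeasurable (S.aemeasurable_chartInv x) hA,
    withDensity_apply', Measure.restrict_restrict' (measurableSet_tgt x), inter_comm]

/-- The root of the determinant contributes e^{na} and the absolute Jacobian, while the shift of the
weight contributes e^{ma}. -/
theorem SMMS.dens_pullback {S' S : SMMS n M m} {a : ℝ}
    (Φ : M ≃ₘ^∞⟮𝓡∂ n, 𝓡∂ n⟯ M)
    (h : ∀ (p : M) (v w : TangentSpace (𝓡∂ n) p), S'.g.inner p v w = Real.exp (2 * a) *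
      S.g.inner (Φ p) (mfderiv (𝓡∂ n) (𝓡∂ n) Φ p v) (mfderiv (𝓡∂ n) (𝓡∂ n) Φ p w))
    (hφ : ∀ p, S'.φ p = S.φ (Φ p) - m * a) {x z : M} {y : Euc n} (hy : y ∈ transDom x z Φ) :
    S'.dens x y = Real.exp ((n + m) * a) * (|(dH (transMap x z Φ) y).det| *
      S.dens z (transMap x z Φ y)) := by
  have hP := isPullback_gram (Real.exp_ne_zero _) Φ h x z
  have h1 := matrix_pullback (hP.eq y hy)
  have h2 : (gram S'.g x y).det = Real.exp (n * a) ^ 2 * ((dH (transMap x z Φ) y).det ^ 2 *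
      (gram S.g z (transMap x z Φ y)).det) := by
    rw [h1, Matrix.det_smul, Matrix.det_mul, Matrix.det_mul, Matrix.det_transpose, det_jac,
      Fintype.card_fin, ← Real.exp_nat_mul, ← Real.exp_nat_mul]
    have : (n : ℝ) * (2 * a) = ((2 : ℕ) : ℝ) * (n * a) := by push_cast; ring
    rw [this]
    ring
  simp only [SMMS.dens, densM, Function.comp]
  rw [h2, Real.sqrt_mul (by positivity), Real.sqrt_mul (by positivity),
    Real.sqrt_sq (Real.exp_pos _).le, Real.sqrt_sq_eq_abs, hφ, chartInv_transMap hy,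
    show -(S.φ (Φ (chartInv x y)) - m * a) = m * a + -S.φ (Φ (chartInv x y)) by ring,
    Real.exp_add, show ((n : ℝ) + m) * a = n * a + m * a by ring, Real.exp_add]
  ring

theorem transMap_symm (Φ : M ≃ₘ^∞⟮𝓡∂ n, 𝓡∂ n⟯ M) {x z : M} {y : Euc n}
    (hy : y ∈ transDom x z Φ) :
    extChartAt (𝓡∂ n) x (Φ.symm (chartInv z (transMap x z Φ y))) = y := by
  rw [chartInv_transMap hy, Φ.symm_apply_apply]
  exact (extChartAt (𝓡∂ n) x).right_inv hy.1

/-- The Jacobian in the law for densities is the one in the change of variables formula. With the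
identity this is agreement of chart measures on overlaps; with a soliton diffeomorphism it is the
scaling of volume. -/
theorem SMMS.chartMeasure_preimage {S' S : SMMS n M m} {a : ℝ}
    (Φ : M ≃ₘ^∞⟮𝓡∂ n, 𝓡∂ n⟯ M)
    (h : ∀ (p : M) (v w : TangentSpace (𝓡∂ n) p), S'.g.inner p v w = Real.exp (2 * a) *
      S.g.inner (Φ p) (mfderiv (𝓡∂ n) (𝓡∂ n) Φ p v) (mfderiv (𝓡∂ n) (𝓡∂ n) Φ p w))
    (hφ : ∀ p, S'.φ p = S.φ (Φ p) - m * a) {x z : M} {A : Set M} (hA : MeasurableSet A)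
    (hAz : A ⊆ src (n := n) z) (hAx : Φ ⁻¹' A ⊆ src (n := n) x) :
    S'.chartMeasure x (Φ ⁻¹' A) = ENNReal.ofReal (Real.exp ((n + m) * a)) * S.chartMeasure z A := by
  have hA' : MeasurableSet (Φ ⁻¹' A) := Φ.continuous.measurable hA
  rw [S'.chartMeasure_apply x hA', S.chartMeasure_apply z hA]
  set B := tgt (n := n) x ∩ chartInv x ⁻¹' (Φ ⁻¹' A) with hB
  have hBm : MeasurableSet B := measurableSet_inter_preimage_of_continuousOn
    (continuousOn_chartInv x) (measurableSet_tgt x) hA'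
  have hBT : B ⊆ transDom x z Φ := fun y hy => ⟨hy.1, hAz hy.2⟩
  have himg : transMap x z Φ '' B = tgt z ∩ chartInv z ⁻¹' A := by
    ext w
    constructor
    · rintro ⟨y, hy, rfl⟩
      refine ⟨transMap_mem (hBT hy), ?_⟩
      rw [mem_preimage, chartInv_transMap (hBT hy)]
      exact hy.2
    · rintro ⟨hw, hwA⟩
      have h1 : Φ.symm (chartInv z w) ∈ Φ ⁻¹' A := by
        rw [mem_preimage, Φ.apply_symm_apply]; exact hwA
      have h2 := hAx h1
      have h3 : chartInv x (extChartAt (𝓡∂ n) x (Φ.symm (chartInv z w)))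
          = Φ.symm (chartInv z w) := (extChartAt (𝓡∂ n) x).left_inv h2
      refine ⟨extChartAt (𝓡∂ n) x (Φ.symm (chartInv z w)),
        ⟨(extChartAt (𝓡∂ n) x).map_source h2, ?_⟩, ?_⟩
      · rw [mem_preimage, h3]; exact h1
      · rw [transMap, h3, Φ.apply_symm_apply]
        exact (extChartAt (𝓡∂ n) z).right_inv hw
  have hinj : InjOn (transMap x z Φ) B := fun y hy y' hy' e => by
    rw [← transMap_symm Φ (hBT hy), ← transMap_symm Φ (hBT hy'), e]
  have hder : ∀ y ∈ B, HasFDerivWithinAt (transMap x z Φ) (dH (transMap x z Φ) y) B y :=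
    fun y hy => (smoothH_transMap Φ.contMDiff (hBT hy)).hasFDeriv.mono
      fun w hw => extChartAt_target_subset_range x hw.1
  rw [← himg, lintegral_image_eq_lintegral_abs_det_fderiv_mul volume hBm hder hinj,
    ← lintegral_const_mul' _ _ ENNReal.ofReal_ne_top]
  refine setLIntegral_congr_fun hBm fun y hy => ?_
  rw [← ENNReal.ofReal_mul (abs_nonneg _), ← ENNReal.ofReal_mul (Real.exp_pos _).le,
    SMMS.dens_pullback Φ h hφ (hBT hy)]

variable [CompactSpace M]

theorem exists_finset_src : ∃ t : Finset M, ⋃ x ∈ t, src (n := n) x = univ := by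
  obtain ⟨t, ht⟩ := isCompact_univ.elim_nhds_subcover (fun x : M => src (n := n) x)
    fun x _ => extChartAt_source_mem_nhds x
  exact ⟨t, eq_univ_of_univ_subset ht.2⟩

theorem measurableSet_src (x : M) : MeasurableSet (src (n := n) x) := (isOpen_src x).measurableSet

theorem SMMS.exists_volume (S : SMMS n M m) :
    ∃ μ : Measure M, ∀ x, μ.restrict (src (n := n) x) = (S.chartMeasure x).restrict (src (n := n) x) := by
  obtain ⟨t, ht⟩ := exists_finset_src (n := n) (M := M)
  refine exists_measure_of_cover (fun x => measurableSet_src x) (fun x z => ?_) ht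
  ext A hA
  have hm := (measurableSet_src (n := n) x).inter (measurableSet_src (n := n) z)
  rw [Measure.restrict_apply hA, Measure.restrict_apply hA]
  have := SMMS.chartMeasure_preimage (S' := S) (S := S) (a := 0) (x := x) (z := z)
    (Diffeomorph.refl (𝓡∂ n) M ∞) (fun p v w => by simp; rfl) (fun p => by simp)
    (hA.inter hm) (fun p hp => hp.2.2) (fun p hp => hp.2.1)
  simpa using this

/-- The weighted volume measure `e^{-φ} dV_g`. -/
def SMMS.vol (S : SMMS n M m) : Measure M := S.exists_volume.choose

theorem SMMS.vol_restrict (S : SMMS n M m) (x : M) :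
    S.vol.restrict (src (n := n) x) = (S.chartMeasure x).restrict (src (n := n) x) :=
  S.exists_volume.choose_spec x

theorem SMMS.vol_apply (S : SMMS n M m) {x : M} {A : Set M} (hA : MeasurableSet A)
    (hx : A ⊆ src (n := n) x) : S.vol A = S.chartMeasure x A := by
  have := congrArg (fun μ => μ A) (S.vol_restrict x)
  simp only [Measure.restrict_apply hA, inter_eq_self_of_subset_left hx] at this
  exact this

/-- Both measures are compared on the pieces that lie in one chart and come from one chart; finitely
many of them cover by compactness. -/
theorem SMMS.map_vol {S' S : SMMS n M m} {a : ℝ} (Φ : M ≃ₘ^∞⟮𝓡∂ n, 𝓡∂ n⟯ M)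
    (h : ∀ (p : M) (v w : TangentSpace (𝓡∂ n) p), S'.g.inner p v w = Real.exp (2 * a) *
      S.g.inner (Φ p) (mfderiv (𝓡∂ n) (𝓡∂ n) Φ p v) (mfderiv (𝓡∂ n) (𝓡∂ n) Φ p w))
    (hφ : ∀ p, S'.φ p = S.φ (Φ p) - m * a) :
    S'.vol.map Φ = ENNReal.ofReal (Real.exp ((n + m) * a)) • S.vol := by
  obtain ⟨t, ht⟩ := exists_finset_src (n := n) (M := M)
  have hc : ⋃ q : t × t, (src (n := n) (q.1 : M) ∩ Φ ⁻¹' src (n := n) (q.2 : M)) = univ := by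
    refine eq_univ_of_forall fun p => ?_
    have h1 : p ∈ ⋃ x ∈ t, src (n := n) x := by rw [ht]; trivial
    have h2 : Φ p ∈ ⋃ x ∈ t, src (n := n) x := by rw [ht]; trivial
    simp only [mem_iUnion] at h1 h2 ⊢
    obtain ⟨x, hx, hx'⟩ := h1
    obtain ⟨z, hz, hz'⟩ := h2
    exact ⟨(⟨x, hx⟩, ⟨z, hz⟩), hx', hz'⟩
  have hc' : ⋃ q : t × t, (Φ.symm ⁻¹' src (n := n) (q.1 : M) ∩ src (n := n) (q.2 : M)) = univ := by
    refine eq_univ_of_forall fun p => ?_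
    have : Φ.symm p ∈ ⋃ q : t × t, (src (n := n) (q.1 : M) ∩ Φ ⁻¹' src (n := n) (q.2 : M)) := by
      rw [hc]; trivial
    simp only [mem_iUnion] at this ⊢
    obtain ⟨q, h1, h2⟩ := this
    exact ⟨q, h1, by rwa [mem_preimage, Φ.apply_symm_apply] at h2⟩
  refine Measure.ext_of_iUnion_eq_univ hc' fun q => ?_
  obtain ⟨⟨x, hx⟩, ⟨z, hz⟩⟩ := q
  ext A hA
  have hm : MeasurableSet (Φ.symm ⁻¹' src (n := n) x ∩ src (n := n) z) :=
    (Φ.symm.continuous.measurable (measurableSet_src x)).inter (measurableSet_src z)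
  rw [Measure.restrict_apply hA, Measure.restrict_apply hA]
  have hB := hA.inter hm
  rw [Measure.map_apply Φ.continuous.measurable hB, Measure.smul_apply, smul_eq_mul]
  have h1 : A ∩ (Φ.symm ⁻¹' src (n := n) x ∩ src (n := n) z) ⊆ src (n := n) z := fun p hp => hp.2.2
  have h2 : Φ ⁻¹' (A ∩ (Φ.symm ⁻¹' src (n := n) x ∩ src (n := n) z)) ⊆ src (n := n) x :=
    fun p hp => by
      have := hp.2.1
      rwa [mem_preimage, Φ.symm_apply_apply] at this
  rw [S'.vol_apply (Φ.continuous.measurable hB) h2, S.vol_apply hB h1]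
  exact SMMS.chartMeasure_preimage Φ h hφ hB h1 h2

theorem SMMS.vol_conformal {S' S : SMMS n M m} {f : M → ℝ} (hf : Continuous f)
    (h : ∀ x, ∀ y ∈ tgt (n := n) x, S'.dens x y
      = Real.exp ((n + m) * f (chartInv x y)) * S.dens x y) :
    S'.vol = S.vol.withDensity fun p => ENNReal.ofReal (Real.exp ((n + m) * f p)) := by
  obtain ⟨t, ht⟩ := exists_finset_src (n := n) (M := M)
  refine Measure.ext_of_biUnion_eq_univ (t.countable_toSet) ht fun x _ => ?_
  ext A hA
  have hB : MeasurableSet (A ∩ src (n := n) x) := hA.inter (measurableSet_src x)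
  have hc : Measurable fun p => ENNReal.ofReal (Real.exp (((n : ℝ) + m) * f p)) :=
    (by fun_prop : Continuous fun p => Real.exp (((n : ℝ) + m) * f p)).measurable.ennreal_ofReal
  rw [Measure.restrict_apply hA, Measure.restrict_apply hA, withDensity_apply _ hB,
    S'.vol_apply hB inter_subset_right, ← Measure.restrict_restrict hA, S.vol_restrict,
    Measure.restrict_restrict hA, ← withDensity_apply _ hB, S'.chartMeasure_apply x hB,
    withDensity_apply _ hB, ← lintegral_indicator hB, SMMS.chartMeasure,
    lintegral_map' (hc.indicator hB).aemeasurable (S.aemeasurable_chartInv x),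
    lintegral_withDensity_eq_lintegral_mul₀' (S.aemeasurable_dens x)]
  · have hBm : MeasurableSet (tgt (n := n) x ∩ chartInv x ⁻¹' (A ∩ src (n := n) x)) :=
      measurableSet_inter_preimage_of_continuousOn
        (continuousOn_chartInv x) (measurableSet_tgt x) hB
    rw [← lintegral_indicator hBm, ← lintegral_indicator (measurableSet_tgt x)]
    congr 1
    ext y
    by_cases hy : y ∈ tgt x
    · by_cases hy2 : chartInv x y ∈ A ∩ src (n := n) x
      · have hy3 : y ∈ tgt x ∩ chartInv x ⁻¹' (A ∩ src (n := n) x) := ⟨hy, hy2⟩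
        rw [indicator_of_mem hy3, indicator_of_mem hy, Pi.mul_apply, indicator_of_mem hy2, h x y hy,
          mul_comm (Real.exp _), ENNReal.ofReal_mul (S.dens_nonneg x y)]
      · have hy3 : y ∉ tgt x ∩ chartInv x ⁻¹' (A ∩ src (n := n) x) := fun h => hy2 h.2
        rw [indicator_of_notMem hy3, indicator_of_mem hy, Pi.mul_apply, indicator_of_notMem hy2,
          mul_zero]
    · have hy3 : y ∉ tgt x ∩ chartInv x ⁻¹' (A ∩ src (n := n) x) := fun h => hy h.1
      rw [indicator_of_notMem hy3, indicator_of_notMem hy]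
  · exact (hc.indicator hB).comp_aemeasurable (S.aemeasurable_chartInv x)

theorem SMMS.integral_vol (S : SMMS n M m) {z : M} {k : M → ℝ} (hk : Continuous k)
    (hz : ∀ p, p ∉ src (n := n) z → k p = 0) :
    ∫ p, k p ∂S.vol = ∫ y in tgt z, S.dens z y * k (chartInv z y) := by
  rw [← setIntegral_eq_integral_of_forall_compl_eq_zero hz, S.vol_restrict,
    setIntegral_eq_integral_of_forall_compl_eq_zero hz, SMMS.chartMeasure,
    integral_map (S.aemeasurable_chartInv z) hk.measurable.aestronglyMeasurable,
    integral_withDensity_eq_integral_toReal_smul₀ (S.aemeasurable_dens z)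
      (Eventually.of_forall fun _ => ENNReal.ofReal_lt_top)]
  congr 1
  ext y
  rw [ENNReal.toReal_ofReal (S.dens_nonneg z y), smul_eq_mul]

/-- In a chart a small closed half ball is compact and the density is continuous on it, so the
measure is locally finite; M is compact. -/
instance SMMS.isFiniteMeasure_vol (S : SMMS n M m) : IsFiniteMeasure S.vol := by
  refine ⟨?_⟩
  refine isCompact_univ.measure_lt_top_of_nhdsWithin fun p _ => ?_
  set y := extChartAt (𝓡∂ n) p p with hy
  have h1 : tgt p ∈ 𝓝[half n] y := extChartAt_target_mem_nhdsWithin p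
  obtain ⟨r, hr, hr'⟩ := (nhdsWithin_hasBasis Metric.nhds_basis_closedBall (half n)).mem_iff.1 h1
  set V := src (n := n) p ∩ extChartAt (𝓡∂ n) p ⁻¹' Metric.ball y r with hV
  have hVo : IsOpen V :=
    (continuousOn_extChartAt p).isOpen_inter_preimage (isOpen_src p) Metric.isOpen_ball
  have hVp : V ∈ 𝓝 p := hVo.mem_nhds ⟨mem_extChartAt_source p, Metric.mem_ball_self hr⟩
  refine ⟨V, by rw [nhdsWithin_univ]; exact hVp, ?_⟩
  rw [S.vol_apply hVo.measurableSet inter_subset_left, S.chartMeasure_apply p hVo.measurableSet]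
  set K := Metric.closedBall y r ∩ half n with hK
  have hKc : IsCompact K := (isCompact_closedBall y r).inter_right isClosed_half
  have hsub : tgt p ∩ chartInv p ⁻¹' V ⊆ K := by
    rintro w ⟨hw, hw'⟩
    refine ⟨?_, extChartAt_target_subset_range p hw⟩
    have : extChartAt (𝓡∂ n) p (chartInv p w) ∈ Metric.ball y r := hw'.2
    rw [show extChartAt (𝓡∂ n) p (chartInv p w) = w from (extChartAt (𝓡∂ n) p).right_inv hw] at this
    exact Metric.ball_subset_closedBall this
  refine (lintegral_mono_set hsub).trans_lt ?_
  have hint : IntegrableOn (S.dens p) K volume :=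
    ((S.continuousOn_dens p).mono hr').integrableOn_compact hKc
  exact hint.lintegral_lt_top

/-- Needed at the end, to pass from vanishing almost everywhere to vanishing everywhere. Even at a
boundary point, a relative neighbourhood contains an open set of the interior, where the density is
positive. -/
instance SMMS.isOpenPosMeasure_vol (S : SMMS n M m) : S.vol.IsOpenPosMeasure := by
  refine ⟨fun U hU hne h0 => ?_⟩
  obtain ⟨p, hp⟩ := hne
  have hV : IsOpen (U ∩ src (n := n) p) := hU.inter (isOpen_src p)
  have h1 : S.vol (U ∩ src (n := n) p) = 0 := measure_mono_null inter_subset_left h0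
  rw [S.vol_apply hV.measurableSet inter_subset_right, S.chartMeasure_apply p hV.measurableSet] at h1
  set B := tgt (n := n) p ∩ chartInv p ⁻¹' (U ∩ src (n := n) p) with hB
  have hBm : MeasurableSet B := measurableSet_inter_preimage_of_continuousOn
        (continuousOn_chartInv p) (measurableSet_tgt p) hV.measurableSet
  set y := extChartAt (𝓡∂ n) p p with hy
  have hyt : y ∈ tgt p := mem_extChartAt_target p
  have hyB : B ∈ 𝓝[half n] y := by
    refine inter_mem (tgt_nhd hyt) ((continuousWithinAt_chartInv hyt).preimage_mem_nhdsWithin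
      (hV.mem_nhds ?_))
    have : chartInv p y = p := (extChartAt (𝓡∂ n) p).left_inv (mem_extChartAt_source p)
    rw [this]
    exact ⟨hp, mem_extChartAt_source p⟩
  obtain ⟨O, hO, hyO, hOB⟩ := mem_nhdsWithin.1 hyB
  have hyh : y ∈ half n := extChartAt_target_subset_range p hyt
  have hne2 : (O ∩ interior (half n)).Nonempty :=
    mem_closure_iff.1 ((𝓡∂ n).range_subset_closure_interior hyh) O hO hyO
  have hpos : 0 < volume B := lt_of_lt_of_le
    ((hO.inter isOpen_interior).measure_pos volume hne2)
    (measure_mono fun w hw => hOB ⟨hw.1, interior_subset hw.2⟩)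
  have h2 : (fun y => ENNReal.ofReal (S.dens p y)) =ᵐ[volume.restrict B] 0 := by
    refine (lintegral_eq_zero_iff' ?_).1 h1
    exact (S.aemeasurable_dens p).mono_measure (Measure.restrict_mono inter_subset_left le_rfl)
  have h3 : ∀ᵐ w ∂(volume.restrict B), w ∈ B := ae_restrict_mem hBm
  have h4 : ∀ᵐ w ∂(volume.restrict B), False := by
    filter_upwards [h2, h3] with w hw hw'
    have := S.dens_pos hw'.1
    simp only [Pi.zero_apply, ENNReal.ofReal_eq_zero] at hw
    linarith
  have h5 : volume.restrict B = 0 := by simpa using h4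
  rw [Measure.restrict_eq_zero] at h5
  exact hpos.ne' h5

end Volume

/-! ### The divergence theorem on the half space -/

section HalfSpace

/-- The divergence theorem on the half space for compactly supported fields tangent to the
boundary. -/
theorem integral_half_divergence {k : ℕ} {X : Fin (k + 1) → Euc (k + 1) → ℝ}
    (hX : ∀ i, ∀ y ∈ half (k + 1), SmoothH (X i) y) {R : ℝ} (hR0 : 0 ≤ R)
    (hR : ∀ y ∈ half (k + 1), R ≤ ‖y‖ → ∀ i, X i y = 0)
    (h0 : ∀ y ∈ half (k + 1), y 0 = 0 → X 0 y = 0) :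
    ∫ y in half (k + 1), ∑ i, pderiv i (X i) y = 0 := by
  -- The box [0, R+1] × [-(R+1), R+1]^k contains the support. On every face but y₀ = 0 the field
  -- vanishes by the support condition, and on that face its normal component vanishes by `h0`.
  set a : Fin (k + 1) → ℝ := fun i => if i = 0 then 0 else -(R + 1) with ha
  set b : Fin (k + 1) → ℝ := fun _ => R + 1 with hb
  set e : Euc (k + 1) ≃L[ℝ] (Fin (k + 1) → ℝ) := EuclideanSpace.equiv (Fin (k + 1)) ℝ with he
  have heq : ∀ x, e.symm x = WithLp.toLp 2 x := fun x => rfl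
  have hle : a ≤ b := fun i => by
    simp only [ha, hb]; split_ifs <;> linarith
  have hmem : ∀ x ∈ Icc a b, e.symm x ∈ half (k + 1) := fun x hx => by
    rw [mem_half, heq]
    simpa [ha] using hx.1 0
  have hcoord : ∀ (y : Euc (k + 1)) (i : Fin (k + 1)), |y i| ≤ ‖y‖ := fun y i => by
    simpa using PiLp.norm_apply_le y i
  have hD : ContinuousOn (fun y => ∑ i, pderiv i (X i) y) (half (k + 1)) := by
    refine continuousOn_finsetSum _ fun i _ y hy => ?_
    exact (smoothH_pderiv (hX i y hy) hy i).continuousWithinAt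
  have hce : ContinuousOn e.symm (Icc a b) := e.symm.continuous.continuousOn
  have key := MeasureTheory.integral_divergence_of_hasFDerivAt_off_countable' a b hle
    (fun i x => X i (e.symm x))
    (fun i x => (dH (X i) (e.symm x)).comp (e.symm : (Fin (k + 1) → ℝ) →L[ℝ] Euc (k + 1))) ∅
    countable_empty
    (fun i => ContinuousOn.comp (t := half (k + 1))
      (fun y hy => (hX i y hy).continuousWithinAt) hce hmem)
    -- The box theorem asks for derivatives only in the open box, where the half space is a
    -- neighbourhood and the one-sided derivative is a full one.
    (fun x hx i => by
      have hx' : ∀ i, a i < x i ∧ x i < b i := fun i => hx.1 i (mem_univ i)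
      have h1 : half (k + 1) ∈ 𝓝 (e.symm x) := by
        have h2 : {y : Euc (k + 1) | 0 < y 0} ∈ 𝓝 (e.symm x) := by
          refine IsOpen.mem_nhds (isOpen_lt continuous_const (by fun_prop)) ?_
          have := (hx' 0).1
          simpa [heq, ha] using this
        exact mem_of_superset h2 fun y hy => mem_half.2 (le_of_lt hy)
      have h2 := (hX i (e.symm x) (mem_of_mem_nhds h1)).hasFDeriv.hasFDerivAt h1
      exact h2.comp x e.symm.hasFDerivAt)
    (by
      refine ContinuousOn.integrableOn_compact isCompact_Icc ?_
      exact hD.comp hce hmem)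
  have hfront : ∀ (i : Fin (k + 1)) (c : ℝ) (x : Fin k → ℝ),
      x ∈ Icc (a ∘ i.succAbove) (b ∘ i.succAbove) → a i ≤ c → c ≤ b i →
      e.symm (i.insertNth c x) ∈ half (k + 1) := fun i c x hx h1 h2 =>
    hmem _ (by
      refine ⟨fun j => ?_, fun j => ?_⟩ <;> refine Fin.succAboveCases i ?_ (fun j => ?_) j
      · simpa using h1
      · simpa using hx.1 j
      · simpa using h2
      · simpa using hx.2 j)
  rw [Finset.sum_eq_zero] at key
  · have hset : ∀ y ∈ half (k + 1), y ∉ e ⁻¹' Icc a b → ∑ i, pderiv i (X i) y = 0 := by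
      intro y hy hn
      have hlt : R < ‖y‖ := by
        by_contra! hc
        refine hn ⟨fun i => ?_, fun i => ?_⟩
        · have := hcoord y i
          have h2 := abs_le.1 (this.trans hc)
          simp only [ha]
          split_ifs with hi
          · subst hi; exact mem_half.1 hy
          · change _ ≤ y i
            linarith [h2.1]
        · change y i ≤ _
          have h2 := abs_le.1 ((hcoord y i).trans hc)
          simp only [hb]; linarith [h2.2]
      refine Finset.sum_eq_zero fun i _ => ?_
      have h1 : X i =ᶠ[𝓝[half (k + 1)] y] fun _ => 0 := by
        have h3 : {z : Euc (k + 1) | R < ‖z‖} ∈ 𝓝[half (k + 1)] y :=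
          mem_nhdsWithin_of_mem_nhds ((isOpen_lt continuous_const continuous_norm).mem_nhds hlt)
        filter_upwards [h3, self_mem_nhdsWithin] with z hz hz'
        exact hR z hz' (le_of_lt hz) i
      have h2 := dH_congr h1 hy
      have h3 : pderiv i (X i) y = dH (X i) y (stdv i) := rfl
      rw [h3, h2]
      simp [dH]
    have hsub : e ⁻¹' Icc a b ⊆ half (k + 1) := fun y hy => by
      have := hmem (e y) hy
      simpa using this
    rw [MeasureTheory.setIntegral_eq_of_subset_of_forall_sdiff_eq_zero isClosed_half.measurableSet
      hsub fun y hy => hset y hy.1 hy.2]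
    have hmp := (PiLp.volume_preserving_toLp (Fin (k + 1)))
    have hemb : MeasurableEmbedding (WithLp.toLp 2 : (Fin (k + 1) → ℝ) → Euc (k + 1)) :=
      (MeasurableEquiv.toLp 2 (Fin (k + 1) → ℝ)).measurableEmbedding
    rw [← hmp.setIntegral_preimage_emb hemb]
    exact key
  · intro i _
    have e1 : ∀ x ∈ Icc (a ∘ i.succAbove) (b ∘ i.succAbove),
        X i (e.symm (i.insertNth (b i) x)) = 0 := fun x hx => by
      refine hR _ (hfront i _ x hx (hle i) le_rfl) ?_ i
      refine le_trans ?_ (hcoord _ i)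
      simp [heq, hb, abs_of_nonneg (by linarith : (0:ℝ) ≤ R + 1)]
    have e2 : ∀ x ∈ Icc (a ∘ i.succAbove) (b ∘ i.succAbove),
        X i (e.symm (i.insertNth (a i) x)) = 0 := fun x hx => by
      by_cases hi : i = 0
      · subst hi
        refine h0 _ (hfront 0 _ x hx le_rfl (hle 0)) ?_
        simp [heq, ha]
      · refine hR _ (hfront i _ x hx le_rfl (hle i)) ?_ i
        refine le_trans ?_ (hcoord _ i)
        simp only [heq, ha, if_neg hi, Fin.insertNth_apply_same]
        rw [abs_neg, abs_of_nonneg (by linarith : (0:ℝ) ≤ R + 1)]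
        linarith
    rw [MeasureTheory.setIntegral_congr_fun measurableSet_Icc e1,
      MeasureTheory.setIntegral_congr_fun measurableSet_Icc e2]
    simp

variable {n : ℕ} [NeZero n] {G : Euc n → Matrix (Fin n) (Fin n) ℝ} {T : Set (Euc n)}

/-- The weighted divergence theorem for gradient fields with Neumann condition, in a chart. -/
theorem IsMetricOn.integral_divergence (h : IsMetricOn G T) (hT : MeasurableSet T)
    {φ f q : Euc n → ℝ} (hφ : ∀ y ∈ T, SmoothH φ y) (hf : ∀ y ∈ T, SmoothH f y)
    (hq : ∀ y ∈ T, SmoothH q y) {K : Set (Euc n)} (hK : IsCompact K) (hKT : K ⊆ T)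
    (hqK : ∀ y ∈ T, y ∉ K → q y = 0) (hN : ∀ y ∈ T, y 0 = 0 → grad G f y 0 = 0) :
    ∫ y in T, densM G φ y * (q y * (lap G f y - gradIn G φ f y) + gradIn G q f y) = 0 := by
  classical
  -- Extension by zero is smooth on the whole half space: each point is either in `T`, which is
  -- relatively open, or outside the compact set `K`, off which the field vanishes.
  set X : Fin n → Euc n → ℝ := fun i => T.indicator fun z => densM G φ z * q z * grad G f z i
    with hXd
  have hXK : ∀ i, ∀ y ∉ K, X i y = 0 := fun i y hy => by
    by_cases hyT : y ∈ T
    · simp [hXd, hyT, hqK y hyT hy]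
    · simp [hXd, hyT]
  have hXT : ∀ i, ∀ y ∈ T, X i =ᶠ[𝓝[half n] y] fun z => densM G φ z * q z * grad G f z i :=
    fun i y hy => by
      filter_upwards [h.nhd y hy] with z hz
      simp [hXd, hz]
  have hX0 : ∀ i, ∀ y ∈ half n, y ∉ K → X i =ᶠ[𝓝[half n] y] fun _ => 0 := fun i y _ hy => by
    filter_upwards [mem_nhdsWithin_of_mem_nhds (hK.isClosed.isOpen_compl.mem_nhds hy)] with z hz
    exact hXK i z hz
  have hX : ∀ i, ∀ y ∈ half n, SmoothH (X i) y := fun i y hy => by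
    by_cases hyT : y ∈ T
    · refine ContDiffWithinAt.congr_of_eventuallyEq ?_ (hXT i y hyT) ((hXT i y hyT).eq_of_nhdsWithin hy)
      have h1 := h.smooth_grad hyT (hf y hyT)
      exact ((h.smooth_dens hyT (hφ y hyT)).mul (hq y hyT)).mul (contDiffWithinAt_euclidean.1 h1 i)
    · have hyK : y ∉ K := fun hc => hyT (hKT hc)
      exact contDiffWithinAt_const.congr_of_eventuallyEq (hX0 i y hy hyK)
        ((hX0 i y hy hyK).eq_of_nhdsWithin hy)
  obtain ⟨R, hR⟩ := hK.isBounded.exists_norm_le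
  obtain ⟨k, rfl⟩ : ∃ k, n = k + 1 := ⟨n - 1, by have := NeZero.pos n; omega⟩
  -- The radius `max R 0 + 1` is nonnegative and strictly exceeds the norm of every point of `K`.
  have key := integral_half_divergence (X := X) hX (R := max R 0 + 1) (by positivity)
    (fun y _ hy i => hXK i y fun hc => by
      have := hR y hc
      have := le_max_left R 0
      linarith)
    (fun y _ hy0 => by
      by_cases hyT : y ∈ T
      · simp [hXd, hyT, hN y hyT hy0]
      · simp [hXd, hyT])
  rw [MeasureTheory.setIntegral_eq_of_subset_of_forall_sdiff_eq_zero isClosed_half.measurableSet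
      h.sub (fun y hy => ?_)] at key
  · rw [← key]
    refine MeasureTheory.setIntegral_congr_fun hT fun y hy => ?_
    rw [← h.divergence_eq hy (hφ y hy) (hq y hy) hf]
    refine Finset.sum_congr rfl fun i _ => ?_
    have := dH_congr (hXT i y hy) (h.sub hy)
    exact (congrArg (fun L => L (stdv i)) this).symm
  · refine Finset.sum_eq_zero fun i _ => ?_
    have := dH_congr (hX0 i y hy.1 fun hc => hy.2 (hKT hc)) hy.1
    refine (congrArg (fun L => L (stdv i)) this).trans ?_
    simp [dH]

end HalfSpace

/-! ### The Neumann condition and its independence of the chart -/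

section Neumann

variable {n : ℕ} [NeZero n]

theorem interior_half : interior (half n) = {y | 0 < y 0} := by
  have : half n = {y | 0 ≤ y 0} := by ext y; exact mem_half
  rw [this]
  exact interior_halfSpace 2 0 0

/-- The derivative of a map that preserves the half space and a boundary point preserves the
tangent space to the boundary. -/
theorem dH_apply_zero_of_tangent {F : Euc n → Euc n} {x v : Euc n} (hF : SmoothH F x)
    (hm : ∀ᶠ z in 𝓝[half n] x, F z ∈ half n) (hx : x 0 = 0) (hFx : F x 0 = 0) (hv : v 0 = 0) :
    dH F x v 0 = 0 := by
  have hc : ∀ t : ℝ, x + t • v ∈ half n := fun t => mem_half.2 (by simp [hx, hv])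
  have h1 : HasDerivAt (fun t : ℝ => x + t • v) v 0 := by
    simpa using ((hasDerivAt_id (0 : ℝ)).smul_const v).const_add x
  have hx0 : x + (0 : ℝ) • v = x := by simp
  have h2 : HasDerivAt (fun t : ℝ => F (x + t • v)) (dH F x v) 0 := by
    have h3 : HasFDerivWithinAt F (dH F x) (half n) (x + (0 : ℝ) • v) := by
      rw [hx0]; exact hF.hasFDeriv
    exact h3.comp_hasDerivAt 0 h1 (Eventually.of_forall hc)
  have h4 : HasDerivAt (fun t : ℝ => F (x + t • v) 0) (dH F x v 0) 0 :=
    (EuclideanSpace.proj 0 : Euc n →L[ℝ] ℝ).hasFDerivAt.comp_hasDerivAt 0 h2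
  -- The line x + tv stays in the boundary hyperplane for both signs of t, so coordinate 0 of `F`
  -- along it is nonnegative near t = 0 and zero there.
  refine IsLocalMin.hasDerivAt_eq_zero ?_ h4
  have h5 : Tendsto (fun t : ℝ => x + t • v) (𝓝 0) (𝓝[half n] x) := by
    refine tendsto_nhdsWithin_iff.2 ⟨?_, Eventually.of_forall hc⟩
    have := h1.continuousAt.tendsto
    rwa [hx0] at this
  filter_upwards [h5.eventually hm] with t ht
  rw [hx0, hFx]
  exact mem_half.1 ht

/-- For `s = 1` the derivative of `F` is an isometry, and the gradient is characterized by its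
pairing with vectors. -/
theorem IsPullback.dH_grad {F : Euc n → Euc n} {G' G : Euc n → Matrix (Fin n) (Fin n) ℝ}
    {T' T : Set (Euc n)} (h : IsPullback 1 F G' T' G T) {y : Euc n} (hy : y ∈ T') {f : Euc n → ℝ}
    (hf : SmoothH f (F y)) : dH F y (grad G' (fun z => f (F z)) y) = grad G f (F y) := by
  refine form_ext (h.met.pos _ (h.maps hy)) fun w => ?_
  obtain ⟨u, rfl⟩ := (h.bij y hy).2 w
  have h1 := h.eq y hy (grad G' (fun z => f (F z)) y) u
  rw [one_mul] at h1
  rw [← h1, h.met'.form_grad hy, h.met.form_grad (h.maps hy), h.dH_comp hy hf]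

theorem IsPullback.gradIn_eq {F : Euc n → Euc n} {G' G : Euc n → Matrix (Fin n) (Fin n) ℝ}
    {T' T : Set (Euc n)} {s : ℝ} (h : IsPullback s F G' T' G T) {y : Euc n} (hy : y ∈ T')
    {a b : Euc n → ℝ} (ha : SmoothH a (F y)) (hb : SmoothH b (F y)) :
    gradIn G' (fun z => a (F z)) (fun z => b (F z)) y = s⁻¹ * gradIn G a b (F y) :=
  contr_pullback h.ne (h.bij y hy) (h.eq y hy) fun u v => by
    rw [prodForm_apply, prodForm_apply, h.dH_comp hy ha, h.dH_comp hy hb]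

variable {M : Type*} [TopologicalSpace M]
  [ChartedSpace (EuclideanHalfSpace n) M] [IsManifold (𝓡∂ n) ∞ M] {m : ℝ}

theorem isPullback_refl (g : Metric n M) (x z : M) :
    IsPullback 1 (transMap x z id) (gram g x) (transDom x z id) (gram g z) (tgt z) :=
  isPullback_gram one_ne_zero (Diffeomorph.refl (𝓡∂ n) M ∞) (fun p v w => by simp; rfl) x z

theorem extChartAt_mem_transDom {x z p : M} (hx : p ∈ src (n := n) x) (hz : p ∈ src (n := n) z) :
    extChartAt (𝓡∂ n) x p ∈ transDom x z id :=
  ⟨(extChartAt (𝓡∂ n) x).map_source hx, by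
    change chartInv x (extChartAt (𝓡∂ n) x p) ∈ src z
    rw [chartInv, (extChartAt (𝓡∂ n) x).left_inv hx]; exact hz⟩

theorem transMap_extChartAt {x p : M} (z : M) (hx : p ∈ src (n := n) x) :
    transMap x z id (extChartAt (𝓡∂ n) x p) = extChartAt (𝓡∂ n) z p := by
  rw [transMap, chartInv, (extChartAt (𝓡∂ n) x).left_inv hx, id]

theorem comp_chartInv_eventuallyEq {α : Type*} (f : M → α) {x z : M} {y : Euc n}
    (hy : y ∈ transDom x z id) :
    f ∘ chartInv x =ᶠ[𝓝[half n] y] fun w => (f ∘ chartInv z) (transMap x z id w) := by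
  filter_upwards [transDom_nhd continuous_id hy] with w hw
  simp only [Function.comp]
  rw [chartInv_transMap hw, id]

theorem grad_congr {G : Euc n → Matrix (Fin n) (Fin n) ℝ} {a b : Euc n → ℝ} {y : Euc n}
    (h : dH a y = dH b y) : grad G a y = grad G b y := by
  ext k
  change ∑ j, (G y)⁻¹ k j * dH a y (stdv j) = ∑ j, (G y)⁻¹ k j * dH b y (stdv j)
  rw [h]

/-- The normal derivative of `f` vanishes on the boundary. -/
def IsNeumann (g : Metric n M) (f : M → ℝ) : Prop :=
  ∀ p ∈ (𝓡∂ n).boundary M, dH (f ∘ chartInv p) (extChartAt (𝓡∂ n) p p)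
    (nrm (gram g p) (extChartAt (𝓡∂ n) p p)) = 0

/-- The Neumann condition is stated in the chart centred at each boundary point, where it says that
the gradient is tangent to the boundary. Changes of charts map gradients to gradients and
boundary-tangent vectors to boundary-tangent vectors, so it holds in every chart. -/
theorem IsNeumann.grad_eq_zero {g : Metric n M} {f : M → ℝ} (hN : IsNeumann g f)
    (hf : ContMDiff (𝓡∂ n) 𝓘(ℝ, ℝ) ∞ f) {z : M} {y : Euc n} (hy : y ∈ tgt z) (hy0 : y 0 = 0) :
    grad (gram g z) (f ∘ chartInv z) y 0 = 0 := by
  set p := chartInv z y with hp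
  have hpz : p ∈ src (n := n) z := chartInv_mem_src hy
  have hpy : extChartAt (𝓡∂ n) z p = y := (extChartAt (𝓡∂ n) z).right_inv hy
  have hpp : p ∈ src (n := n) p := mem_extChartAt_source p
  have hb : p ∈ (𝓡∂ n).boundary M := by
    refine ((𝓡∂ n).isBoundaryPoint_iff_of_mem_atlas (n := ∞) (by simp) (chart_mem_atlas _ z)
      (by rwa [← extChartAt_source (𝓡∂ n)])).2 ?_
    change extChartAt (𝓡∂ n) z p ∈ frontier (tgt z)
    rw [hpy]
    refine ⟨subset_closure hy, fun hi => ?_⟩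
    have h1 := interior_mono (extChartAt_target_subset_range z) hi
    change y ∈ interior (half n) at h1
    rw [interior_half] at h1
    exact h1.ne' hy0
  set x := extChartAt (𝓡∂ n) p p with hx
  have hxt : x ∈ tgt p := mem_extChartAt_target p
  have hxD : x ∈ transDom p z id := extChartAt_mem_transDom hpp hpz
  have hxF : transMap p z id x = y := (transMap_extChartAt z hpp).trans hpy
  have hx0 : x 0 = 0 := by
    have h1 := mem_half.1 ((extChartAt_target_subset_range p) hxt)
    by_contra hne
    have h2 : x ∈ interior (half n) := by
      rw [interior_half]; exact lt_of_le_of_ne h1 (Ne.symm hne)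
    exact hb.2 h2
  have hpb := isPullback_refl g p z
  have h1 := hN p hb
  have hG := isMetricOn_gram g p
  rw [hG.dH_nrm hxt, div_eq_zero_iff, or_iff_left (Real.sqrt_ne_zero'.2 (hG.inv_pos hxt)),
    neg_eq_zero] at h1
  have h2 := dH_congr (comp_chartInv_eventuallyEq f hxD) (hG.sub hxt)
  rw [grad_congr h2] at h1
  have hfz : SmoothH (f ∘ chartInv z) (transMap p z id x) := by
    rw [hxF]; exact smoothH_comp_chartInv hf hy
  have h3 := hpb.dH_grad hxD hfz
  have h4 := dH_apply_zero_of_tangent (hpb.smooth x hxD) (by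
      filter_upwards [hpb.met'.nhd x hxD] with w hw using hpb.met.sub (hpb.maps hw))
    hx0 (by rw [hxF]; exact hy0) h1
  rwa [h3, hxF] at h4

/-- The inner product of the gradients of two functions. -/
def gradInM (g : Metric n M) (a b : M → ℝ) (p : M) : ℝ :=
  gradIn (gram g p) (a ∘ chartInv p) (b ∘ chartInv p) (extChartAt (𝓡∂ n) p p)

theorem gradInM_chart (g : Metric n M) {a b : M → ℝ} (ha : ContMDiff (𝓡∂ n) 𝓘(ℝ, ℝ) ∞ a)
    (hb : ContMDiff (𝓡∂ n) 𝓘(ℝ, ℝ) ∞ b) {z p : M} (hz : p ∈ src (n := n) z) :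
    gradInM g a b p
      = gradIn (gram g z) (a ∘ chartInv z) (b ∘ chartInv z) (extChartAt (𝓡∂ n) z p) := by
  have hp : p ∈ src (n := n) p := mem_extChartAt_source p
  have hD := extChartAt_mem_transDom hp hz
  have hF := transMap_extChartAt z hp
  have hh := extChartAt_target_subset_range p hD.1
  have hzt : extChartAt (𝓡∂ n) z p ∈ tgt z := (extChartAt (𝓡∂ n) z).map_source hz
  have h1 := (isPullback_refl g p z).gradIn_eq hD (a := a ∘ chartInv z) (b := b ∘ chartInv z)
    (by rw [hF]; exact smoothH_comp_chartInv ha hzt) (by rw [hF]; exact smoothH_comp_chartInv hb hzt)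
  rw [inv_one, one_mul, hF] at h1
  rw [← h1, gradInM, gradIn, gradIn, dH_congr (comp_chartInv_eventuallyEq a hD) hh,
    dH_congr (comp_chartInv_eventuallyEq b hD) hh]

theorem continuous_gradInM (g : Metric n M) {a b : M → ℝ} (ha : ContMDiff (𝓡∂ n) 𝓘(ℝ, ℝ) ∞ a)
    (hb : ContMDiff (𝓡∂ n) 𝓘(ℝ, ℝ) ∞ b) : Continuous (gradInM g a b) := by
  refine continuous_iff_continuousAt.2 fun p => ?_
  have hy : extChartAt (𝓡∂ n) p p ∈ tgt p := mem_extChartAt_target p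
  have h1 := ((isMetricOn_gram g p).smooth_gradIn hy (smoothH_comp_chartInv ha hy)
    (smoothH_comp_chartInv hb hy)).continuousWithinAt
  have h2 : ContinuousAt (fun q => gradIn (gram g p) (a ∘ chartInv p) (b ∘ chartInv p)
      (extChartAt (𝓡∂ n) p q)) p := by
    refine h1.tendsto.comp (tendsto_nhdsWithin_iff.2 ⟨continuousAt_extChartAt p, ?_⟩)
    filter_upwards [extChartAt_source_mem_nhds (I := 𝓡∂ n) p] with q hq
    exact extChartAt_target_subset_range p ((extChartAt (𝓡∂ n) p).map_source hq)
  refine h2.congr ?_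
  filter_upwards [extChartAt_source_mem_nhds (I := 𝓡∂ n) p] with q hq
  exact (gradInM_chart g ha hb hq).symm

theorem gradInM_eq_zero (g : Metric n M) {a b : M → ℝ} {p : M} (hp : p ∉ tsupport a) :
    gradInM g a b p = 0 := by
  have hy : extChartAt (𝓡∂ n) p p ∈ tgt p := mem_extChartAt_target p
  have hc : chartInv p (extChartAt (𝓡∂ n) p p) = p := extChartAt_to_inv p
  have h1 : a ∘ chartInv p =ᶠ[𝓝[half n] (extChartAt (𝓡∂ n) p p)] fun _ => 0 := by
    have h2 := (continuousWithinAt_chartInv hy).preimage_mem_nhdsWithin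
      (t := (tsupport a)ᶜ) (by rw [hc]; exact (isClosed_tsupport a).isOpen_compl.mem_nhds hp)
    filter_upwards [h2] with w hw
    exact image_eq_zero_of_notMem_tsupport (f := a) hw
  have h3 := dH_congr h1 (extChartAt_target_subset_range p hy)
  rw [gradInM, (isMetricOn_gram g p).gradIn_eq hy, h3]
  simp [dH]

/-- The sum of the functions is constant, so its differential vanishes. -/
theorem sum_gradInM (g : Metric n M) {ι : Type*} (s : Finset ι) {a : ι → M → ℝ} {b : M → ℝ}
    (ha : ∀ i, ContMDiff (𝓡∂ n) 𝓘(ℝ, ℝ) ∞ (a i)) (h : ∀ p, ∑ i ∈ s, a i p = 1) (p : M) :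
    ∑ i ∈ s, gradInM g (a i) b p = 0 := by
  have hy : extChartAt (𝓡∂ n) p p ∈ tgt p := mem_extChartAt_target p
  have hh := (isMetricOn_gram g p).sub hy
  simp only [gradInM, (isMetricOn_gram g p).gradIn_eq hy]
  have h1 : HasFDerivWithinAt (fun y : Euc n => ∑ i ∈ s, (a i ∘ chartInv p) y)
      (∑ i ∈ s, dH (a i ∘ chartInv p) (extChartAt (𝓡∂ n) p p)) (half n) (extChartAt (𝓡∂ n) p p) :=
    HasFDerivWithinAt.fun_sum fun i _ => (smoothH_comp_chartInv (n := n) (ha i) hy).hasFDeriv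
  have h2 : (fun y : Euc n => ∑ i ∈ s, (a i ∘ chartInv p) y) = fun _ => 1 :=
    funext fun y => h (chartInv p y)
  rw [h2] at h1
  have h3 := dH_eq h1 hh
  rw [← _root_.sum_apply, ← h3]
  simp [dH]

end Neumann

/-! ### The weighted divergence theorem on the manifold -/

section DivergenceTheorem

open MeasureTheory

variable {n : ℕ} [NeZero n] {M : Type*} [TopologicalSpace M] [T2Space M] [CompactSpace M]
  [ChartedSpace (EuclideanHalfSpace n) M] [IsManifold (𝓡∂ n) ∞ M] {m : ℝ}
  [MeasurableSpace M] [BorelSpace M]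

/-- The divergence theorem for the field `e^{αf} ∇f` with Neumann boundary condition. -/
theorem SMMS.integral_eq_zero_of_isNeumann (S : SMMS n M m) {f : M → ℝ}
    (hf : ContMDiff (𝓡∂ n) 𝓘(ℝ, ℝ) ∞ f) (hN : IsNeumann S.g f) (α : ℝ) {K : M → ℝ}
    (hKc : Continuous K) (hK : ∀ z, ∀ y ∈ tgt (n := n) z, K (chartInv z y)
      = Real.exp (α * f (chartInv z y)) * (lap (gram S.g z) (f ∘ chartInv z) y
        - gradIn (gram S.g z) (S.φ ∘ chartInv z) (f ∘ chartInv z) y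
        + α * gradIn (gram S.g z) (f ∘ chartInv z) (f ∘ chartInv z) y)) :
    ∫ p, K p ∂S.vol = 0 := by
  obtain ⟨t, ht⟩ := exists_finset_src (n := n) (M := M)
  obtain ⟨ρ, hρ⟩ := SmoothPartitionOfUnity.exists_isSubordinate (𝓡∂ n) (M := M) (ι := t)
    isClosed_univ (fun z => src (n := n) (z : M)) (fun z => isOpen_src _)
    (fun p _ => by
      have h : p ∈ ⋃ x ∈ t, src (n := n) x := by rw [ht]; trivial
      simp only [mem_iUnion] at h ⊢
      obtain ⟨x, hx, hx'⟩ := h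
      exact ⟨⟨x, hx⟩, hx'⟩)
  have hsm : ∀ z, ContMDiff (𝓡∂ n) 𝓘(ℝ, ℝ) ∞ (ρ z) := fun z => (ρ z).contMDiff
  have hsum : ∀ p, ∑ z, ρ z p = 1 := fun p => by
    rw [← ρ.sum_eq_one (mem_univ p), finsum_eq_sum_of_fintype]
  have hfc : Continuous f := hf.continuous
  -- Each `k z` is the weighted divergence of ρ_z e^{αf}∇f, supported in one chart. The terms with
  -- gradients of the ρ_z add up to zero, so the `k z` sum to `K`.
  set k : t → M → ℝ := fun z p => ρ z p * K p + Real.exp (α * f p) * gradInM S.g (ρ z) f p with hk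
  have hkc : ∀ z, Continuous (k z) := fun z => by
    have h1 := continuous_gradInM S.g (hsm z) hf
    have h2 := (hsm z).continuous
    simp only [hk]
    fun_prop
  have hkK : ∀ p, ∑ z, k z p = K p := fun p => by
    simp only [hk, Finset.sum_add_distrib, ← Finset.sum_mul, ← Finset.mul_sum, hsum]
    rw [sum_gradInM S.g _ hsm hsum]
    ring
  have hk0 : ∀ z, ∀ p ∉ tsupport (ρ z), k z p = 0 := fun z p hp => by
    simp only [hk]
    rw [gradInM_eq_zero S.g hp, image_eq_zero_of_notMem_tsupport hp]
    ring
  have hki : ∀ z, Integrable (k z) S.vol := fun z =>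
    (hkc z).integrable_of_hasCompactSupport (HasCompactSupport.of_compactSpace _)
  simp only [← hkK]
  rw [integral_finsetSum _ fun z _ => hki z]
  refine Finset.sum_eq_zero fun z _ => ?_
  rw [S.integral_vol (z := z) (hkc z) fun p hp => hk0 z p fun h => hp (hρ z h)]
  have hG := isMetricOn_gram S.g (z : M)
  set q : Euc n → ℝ := fun y => ρ z (chartInv (z : M) y) * Real.exp (α * f (chartInv (z : M) y)) with hq
  have hs1 : ∀ y ∈ tgt (z : M), SmoothH (f ∘ chartInv (z : M)) y :=
    fun y hy => smoothH_comp_chartInv hf hy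
  have hs2 : ∀ y ∈ tgt (z : M), SmoothH (ρ z ∘ chartInv (z : M)) y :=
    fun y hy => smoothH_comp_chartInv (hsm z) hy
  have hs3 : ∀ y ∈ tgt (z : M), SmoothH (fun w => Real.exp (α * f (chartInv (z : M) w))) y :=
    fun y hy => (contDiffWithinAt_const.mul (hs1 y hy)).exp
  have hqs : ∀ y ∈ tgt (z : M), SmoothH q y := fun y hy => (hs2 y hy).mul (hs3 y hy)
  have key := hG.integral_divergence (measurableSet_tgt (z : M)) (φ := S.φ ∘ chartInv (z : M))
    (f := f ∘ chartInv (z : M)) (q := q) (fun y hy => S.smoothH_φ hy) hs1 hqs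
    (K := extChartAt (𝓡∂ n) (z : M) '' tsupport (ρ z))
    ((isClosed_tsupport _).isCompact.image_of_continuousOn
      ((continuousOn_extChartAt (z : M)).mono (hρ z)))
    (by
      rintro _ ⟨p, hp, rfl⟩
      exact (extChartAt (𝓡∂ n) (z : M)).map_source (hρ z hp))
    (fun y hy hyK => by
      have : chartInv (z : M) y ∉ tsupport (ρ z) := fun hc =>
        hyK ⟨_, hc, (extChartAt (𝓡∂ n) (z : M)).right_inv hy⟩
      simp only [hq, image_eq_zero_of_notMem_tsupport this, zero_mul])
    (fun y hy hy0 => hN.grad_eq_zero hf hy hy0)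
  rw [← key]
  refine setIntegral_congr_fun (measurableSet_tgt (z : M)) fun y hy => ?_
  have hh := hG.sub hy
  have h1 : HasFDerivWithinAt q (ρ z (chartInv (z : M) y) •
        (Real.exp (α * f (chartInv (z : M) y)) • (α • dH (f ∘ chartInv (z : M)) y))
      + Real.exp (α * f (chartInv (z : M) y)) • dH (ρ z ∘ chartInv (z : M)) y) (half n) y :=
    (hs2 y hy).hasFDeriv.mul (((hs1 y hy).hasFDeriv.const_mul α).exp)
  have h2 := dH_eq h1 hh
  have h3 : gradInM S.g (ρ z) f (chartInv (z : M) y)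
      = gradIn (gram S.g (z : M)) (ρ z ∘ chartInv (z : M)) (f ∘ chartInv (z : M)) y := by
    rw [gradInM_chart S.g (hsm z) hf (chartInv_mem_src hy), chartInv,
      (extChartAt (𝓡∂ n) (z : M)).right_inv hy]
  simp only [hk]
  rw [h3, hK z y hy, SMMS.dens, hG.gradIn_eq hy q, h2, hG.gradIn_eq hy (ρ z ∘ _),
    hG.gradIn_eq hy (f ∘ _)]
  simp only [hq, add_apply, smul_apply, smul_eq_mul]
  ring

end DivergenceTheorem

/-! ### Weighted conformal changes on the manifold -/

section Conformal

open MeasureTheory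

variable {n : ℕ} [NeZero n] {M : Type*} [TopologicalSpace M]
  [ChartedSpace (EuclideanHalfSpace n) M] [IsManifold (𝓡∂ n) ∞ M] {m : ℝ}

theorem contMDiff_of_smoothH {f : M → ℝ}
    (h : ∀ p, SmoothH (n := n) (f ∘ chartInv p) (extChartAt (𝓡∂ n) p p)) :
    ContMDiff (𝓡∂ n) 𝓘(ℝ, ℝ) ∞ f := by
  intro p
  refine contMDiffAt_iff.2 ⟨?_, h p⟩
  have h2 : ContinuousAt (fun q => (f ∘ chartInv p) (extChartAt (𝓡∂ n) p q)) p := by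
    refine (h p).continuousWithinAt.tendsto.comp
      (tendsto_nhdsWithin_iff.2 ⟨continuousAt_extChartAt p, ?_⟩)
    filter_upwards [extChartAt_source_mem_nhds (I := 𝓡∂ n) p] with q hq
    exact extChartAt_target_subset_range p ((extChartAt (𝓡∂ n) p).map_source hq)
  refine h2.congr ?_
  filter_upwards [extChartAt_source_mem_nhds (I := 𝓡∂ n) p] with q hq
  simp only [Function.comp]
  rw [chartInv, (extChartAt (𝓡∂ n) p).left_inv hq]

/-- `S'` is the conformal change of `S` with logarithmic factor `f`. -/
structure SMMS.ConformalTo (S' S : SMMS n M m) (f : M → ℝ) : Prop where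
  metric : ∀ (p : M) (v w : TangentSpace (𝓡∂ n) p),
    S'.g.inner p v w = Real.exp (2 * f p) * S.g.inner p v w
  weight : ∀ p, S'.φ p = S.φ p - m * f p

variable {S' S : SMMS n M m} {f : M → ℝ}

theorem SMMS.ConformalTo.gram_eq (h : S'.ConformalTo S f) (x : M) (y : Euc n) :
    gram S'.g x y = Real.exp (2 * f (chartInv x y)) • gram S.g x y := by
  ext i j
  simp only [gram, Matrix.of_apply, Matrix.smul_apply, smul_eq_mul]
  exact h.metric _ _ _

/-- Smoothness of the factor is not assumed: in a chart it is half the logarithm of the ratio of two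
positive smooth diagonal entries of the Gram matrices. -/
theorem SMMS.ConformalTo.contMDiff (h : S'.ConformalTo S f) : ContMDiff (𝓡∂ n) 𝓘(ℝ, ℝ) ∞ f := by
  refine contMDiff_of_smoothH fun p => ?_
  have hy : extChartAt (𝓡∂ n) p p ∈ tgt p := mem_extChartAt_target p
  have h0 := fun g : Metric n M => ((isMetricOn_gram g p).pos _ hy).diag_pos (i := 0)
  have e : ∀ y ∈ tgt (n := n) p, (f ∘ chartInv p) y
      = 1 / 2 * (Real.log (gram S'.g p y 0 0) - Real.log (gram S.g p y 0 0)) := fun y hy => by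
    have h1 := ((isMetricOn_gram S.g p).pos _ hy).diag_pos (i := 0)
    rw [h.gram_eq p y, Matrix.smul_apply, smul_eq_mul, Real.log_mul (Real.exp_ne_zero _) h1.ne',
      Real.log_exp]
    simp only [Function.comp]
    ring
  have h1 : SmoothH (fun y => 1 / 2 * (Real.log (gram S'.g p y 0 0) - Real.log (gram S.g p y 0 0)))
      (extChartAt (𝓡∂ n) p p) :=
    contDiffWithinAt_const.mul (((smoothH_gram S'.g p hy 0 0).log (h0 _).ne').sub
      ((smoothH_gram S.g p hy 0 0).log (h0 _).ne'))
  refine h1.congr_of_eventuallyEq ?_ (e _ hy)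
  filter_upwards [tgt_nhd hy] with y hy using e y hy

theorem SMMS.ConformalTo.isConformal (h : S'.ConformalTo S f) (x : M) :
    IsConformal (f ∘ chartInv x) (gram S'.g x) (gram S.g x) (tgt x) where
  met' := isMetricOn_gram S'.g x
  met := isMetricOn_gram S.g x
  smooth := fun _ hy => smoothH_comp_chartInv h.contMDiff hy
  eq := fun y _ => h.gram_eq x y

theorem SMMS.ConformalTo.dens_eq (h : S'.ConformalTo S f) (x : M) (y : Euc n) :
    S'.dens x y = Real.exp ((n + m) * f (chartInv x y)) * S.dens x y := by
  have e : Real.exp (2 * f (chartInv x y)) ^ n = Real.exp (n * f (chartInv x y)) ^ 2 := by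
    rw [← Real.exp_nat_mul, ← Real.exp_nat_mul]
    congr 1
    push_cast
    ring
  simp only [SMMS.dens, densM, Function.comp]
  rw [h.gram_eq, Matrix.det_smul, Fintype.card_fin, e, Real.sqrt_mul (by positivity),
    Real.sqrt_sq (Real.exp_pos _).le, h.weight, add_mul, Real.exp_add, neg_sub,
    Real.exp_sub, Real.exp_neg]
  field_simp

/-- The coefficient collects n - 1 from the mean curvature and -εm from the normal derivative of the
shifted weight. -/
theorem SMMS.ConformalTo.weightedMeanCurvature_eq (h : S'.ConformalTo S f) (ε : ℝ) (p : M) :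
    S'.weightedMeanCurvature ε p = Real.exp (-f p) * (S.weightedMeanCurvature ε p
      + (n - 1 - ε * m) * dH (f ∘ chartInv p) (extChartAt (𝓡∂ n) p p)
        (nrm (gram S.g p) (extChartAt (𝓡∂ n) p p))) := by
  have hy : extChartAt (𝓡∂ n) p p ∈ tgt p := mem_extChartAt_target p
  have hc := h.isConformal p
  have hh := hc.met.sub hy
  have hp : (f ∘ chartInv p) (extChartAt (𝓡∂ n) p p) = f p :=
    congrArg f (extChartAt_to_inv p)
  have h1 : HasFDerivWithinAt (S'.φ ∘ chartInv p) (dH (S.φ ∘ chartInv p) (extChartAt (𝓡∂ n) p p)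
      - m • dH (f ∘ chartInv p) (extChartAt (𝓡∂ n) p p)) (half n) (extChartAt (𝓡∂ n) p p) := by
    have e : S'.φ ∘ chartInv (n := n) p = fun y => (S.φ ∘ chartInv p) y - m * (f ∘ chartInv p) y :=
      funext fun y => h.weight _
    rw [e]
    exact (S.smoothH_φ hy).hasFDeriv.sub ((hc.smooth _ hy).hasFDeriv.const_mul m)
  rw [S'.weightedMeanCurvature_eq, S.weightedMeanCurvature_eq, hc.meanC_eq hy, hc.nrm_eq hy,
    dH_eq h1 hh, hp]
  simp only [map_smul, sub_apply, smul_apply, smul_eq_mul]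
  ring

theorem SMMS.ConformalTo.isNeumann (h : S'.ConformalTo S f) {ε : ℝ}
    (hε : (n : ℝ) - 1 - ε * m ≠ 0)
    (h' : ∀ p ∈ (𝓡∂ n).boundary M, S'.weightedMeanCurvature ε p = 0)
    (h₀ : ∀ p ∈ (𝓡∂ n).boundary M, S.weightedMeanCurvature ε p = 0) : IsNeumann S.g f := by
  intro p hp
  have := h.weightedMeanCurvature_eq ε p
  rw [h' p hp, h₀ p hp, zero_add] at this
  exact (mul_eq_zero_iff_left hε).1 ((mul_eq_zero_iff_left (Real.exp_ne_zero _)).1 this.symm)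

variable [T2Space M] [CompactSpace M] [MeasurableSpace M] [BorelSpace M]

theorem SMMS.ConformalTo.vol_eq (h : S'.ConformalTo S f) :
    S'.vol = S.vol.withDensity fun p => ENNReal.ofReal (Real.exp ((n + m) * f p)) :=
  SMMS.vol_conformal h.contMDiff.continuous fun x y _ => h.dens_eq x y

/-- The weighted scalar curvature equation, integrated. -/
theorem SMMS.ConformalTo.integral_eq (h : S'.ConformalTo S f) (hN : IsNeumann S.g f) :
    ∫ p, Real.exp ((n + m - 2) / 2 * f p) * (S.weightedScalarCurvature p
      - Real.exp (2 * f p) * S'.weightedScalarCurvature p) ∂S.vol = 0 := by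
  -- This exponent makes (N-1)(N-2)|∇f|² equal to 2(N-1)α|∇f|², so the conformal law times e^{αf} is
  -- 2(N-1) times a weighted divergence.
  set α : ℝ := (n + m - 2) / 2 with hα
  have hf := h.contMDiff.continuous
  have hR := S.continuous_weightedScalarCurvature
  have hR' := S'.continuous_weightedScalarCurvature
  -- Below one divides by 2(N - 1); if N = 1 the conformal law already makes the integrand vanish
  -- pointwise.
  by_cases hc : (n : ℝ) + m - 1 = 0
  · have : ∀ p, Real.exp (α * f p) * (S.weightedScalarCurvature p
      - Real.exp (2 * f p) * S'.weightedScalarCurvature p) = 0 := fun p => by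
      have hp : p ∈ src (n := n) p := mem_extChartAt_source p
      have e := (h.isConformal p).wscal_eq (mem_extChartAt_target p)
        (φ := S.φ ∘ chartInv p) (φ' := S'.φ ∘ chartInv p) (m := m)
        (fun z hz => S.smoothH_φ hz) (fun hm z => S.φ_eq_zero hm _) fun z => h.weight _
      have e1 : (f ∘ chartInv p) (extChartAt (𝓡∂ n) p p) = f p :=
        congrArg f (extChartAt_to_inv p)
      rw [← S'.weightedScalarCurvature_eq, ← S.weightedScalarCurvature_eq, hc, e1] at e
      rw [e]; ring
    simp [this]
  · have key := S.integral_eq_zero_of_isNeumann h.contMDiff hN α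
      (K := fun p => (2 * (n + m - 1))⁻¹ * (Real.exp (α * f p) * (S.weightedScalarCurvature p
      - Real.exp (2 * f p) * S'.weightedScalarCurvature p))) (by fun_prop) fun z y hy => by
        have hp := chartInv_mem_src hy
        have e := (h.isConformal z).wscal_eq hy
          (φ := S.φ ∘ chartInv z) (φ' := S'.φ ∘ chartInv z) (m := m)
          (fun z hz => S.smoothH_φ hz) (fun hm z => S.φ_eq_zero hm _) fun z => h.weight _
        have e1 : extChartAt (𝓡∂ n) z (chartInv z y) = y := (extChartAt (𝓡∂ n) z).right_inv hy
        rw [S.weightedScalarCurvature_chart hp, S'.weightedScalarCurvature_chart hp, e1]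
        simp only [Function.comp_apply] at e
        rw [e, hα]
        field_simp
        ring
    rw [integral_const_mul] at key
    exact (mul_eq_zero_iff_left (inv_ne_zero (mul_ne_zero two_ne_zero hc))).1 key

end Conformal

/-! ### The flow stays in a weighted conformal class -/

section FlowLevel

variable {n : ℕ} [NeZero n] {M : Type*} [TopologicalSpace M]
  [ChartedSpace (EuclideanHalfSpace n) M] [IsManifold (𝓡∂ n) ∞ M] {m : ℝ}

theorem convex_timeInterval (T : EReal) : Convex ℝ (timeInterval T) := by
  refine OrdConnected.convex ⟨fun a ha b hb c hc => ⟨ha.1.trans hc.1, ?_⟩⟩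
  exact lt_of_le_of_lt (EReal.coe_le_coe_iff.2 hc.2) hb.2

theorem zero_mem_timeInterval {T : EReal} (hT : 0 < T) : (0 : ℝ) ∈ timeInterval T :=
  ⟨le_rfl, by simpa using hT⟩

theorem eq_zero_of_hasDerivWithinAt_zero {T : EReal} (hT : 0 < T) {a : ℝ → ℝ}
    (h : ∀ t ∈ timeInterval T, HasDerivWithinAt a 0 (timeInterval T) t) {t : ℝ}
    (ht : t ∈ timeInterval T) : a t = a 0 := by
  have := (convex_timeInterval T).norm_image_sub_le_of_norm_hasDerivWithin_le (C := 0) h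
    (fun x _ => by simp) (zero_mem_timeInterval hT) ht
  rw [zero_mul] at this
  exact sub_eq_zero.1 (norm_le_zero_iff.1 this)

/-- The logarithmic conformal factor relating two metrics in the same conformal class. -/
def logFactor (g' g : Metric n M) (p : M) : ℝ :=
  1 / 2 * (Real.log (g'.inner p (stdv 0 : Euc n) (stdv 0 : Euc n))
    - Real.log (g.inner p (stdv 0 : Euc n) (stdv 0 : Euc n)))

theorem inner_stdv_pos (g : Metric n M) (p : M) :
    0 < g.inner p (stdv 0 : Euc n) (stdv 0 : Euc n) :=
  g.pos p _ fun h => by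
    have : (stdv 0 : Euc n) 0 = 0 := by rw [show (stdv 0 : Euc n) = 0 from h]; rfl
    simp [stdv] at this

theorem IsUnnormalizedFlow.hasDerivWithinAt_logFactor {ε : ℝ} {T : EReal} {S₀ : SMMS n M m}
    {S : ℝ → SMMS n M m} (h : IsUnnormalizedFlow ε T S₀ S) {t : ℝ} (ht : t ∈ timeInterval T) (p : M) :
    HasDerivWithinAt (fun s => logFactor (S s).g S₀.g p)
      (-(1 / 2) * (S t).weightedScalarCurvature p) (timeInterval T) t := by
  have h1 := inner_stdv_pos (S t).g p
  have h2 := (((h.metric_eq t ht p (stdv 0 : Euc n) (stdv 0 : Euc n)).log h1.ne').sub_const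
    (Real.log (S₀.g.inner p (stdv 0 : Euc n) (stdv 0 : Euc n)))).const_mul (1 / 2 : ℝ)
  refine h2.congr_deriv ?_
  field_simp

/-- Since ∂_t f = -R/2, the quantities g(v, w) e^{-2f} and φ + m f have zero time derivative at each
fixed point. Only pointwise differentiability in time is used. -/
theorem IsUnnormalizedFlow.conformalTo {ε : ℝ} {T : EReal} (hT : 0 < T) {S₀ : SMMS n M m}
    {S : ℝ → SMMS n M m} (h : IsUnnormalizedFlow ε T S₀ S) {t : ℝ} (ht : t ∈ timeInterval T) :
    (S t).ConformalTo S₀ (logFactor (S t).g S₀.g) where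
  metric := fun p v w => by
    have hd : ∀ s ∈ timeInterval T, HasDerivWithinAt (fun s => (S s).g.inner p v w
        * Real.exp (-(2 * logFactor (S s).g S₀.g p))) 0 (timeInterval T) s := fun s hs => by
      have := (h.metric_eq s hs p v w).mul
        (((h.hasDerivWithinAt_logFactor hs p).const_mul 2).neg.exp)
      refine this.congr_deriv ?_
      ring
    have h1 := eq_zero_of_hasDerivWithinAt_zero hT hd ht
    rw [h.initial] at h1
    have h2 : logFactor S₀.g S₀.g p = 0 := by simp [logFactor]
    rw [h2, Real.exp_neg] at h1
    have hne := Real.exp_ne_zero (2 * logFactor (S t).g S₀.g p)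
    simp only [mul_zero, neg_zero, Real.exp_zero, mul_one] at h1
    rw [← h1]
    field_simp
  weight := fun p => by
    have hd : ∀ s ∈ timeInterval T, HasDerivWithinAt (fun s => (S s).φ p
        + m * logFactor (S s).g S₀.g p) 0 (timeInterval T) s := fun s hs => by
      have := (h.weight_eq s hs p).add ((h.hasDerivWithinAt_logFactor hs p).const_mul m)
      refine this.congr_deriv ?_
      ring
    have h1 := eq_zero_of_hasDerivWithinAt_zero hT hd ht
    rw [h.initial] at h1
    have h2 : logFactor S₀.g S₀.g p = 0 := by simp [logFactor]
    rw [h2] at h1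
    linarith

end FlowLevel

/-! ### Solitons: first order comparison at time zero -/

section Soliton

open MeasureTheory

theorem timeInterval_mem_nhdsGE {T : EReal} (hT : 0 < T) : timeInterval T ∈ 𝓝[≥] (0 : ℝ) := by
  obtain ⟨c, hc, hcT⟩ := EReal.lt_iff_exists_real_btwn.1 hT
  filter_upwards [Ico_mem_nhdsGE (EReal.coe_pos.1 hc)] with t ht
  exact ⟨ht.1, (EReal.coe_lt_coe_iff.2 ht.2).trans hcT⟩

theorem HasDerivWithinAt.tendsto_div {T : EReal} (hT : 0 < T) {a : ℝ → ℝ} {a' : ℝ}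
    (h : HasDerivWithinAt a a' (timeInterval T) 0) :
    Tendsto (fun t => (a t - a 0) / t) (𝓝[>] 0) (𝓝 a') := by
  have h1 : HasDerivWithinAt a a' (Ici 0) 0 :=
    h.mono_of_mem_nhdsWithin (timeInterval_mem_nhdsGE hT)
  have h2 := (hasDerivWithinAt_iff_tendsto_slope' self_notMem_Ioi).1 (h1.mono Ioi_subset_Ici_self)
  refine h2.congr fun t => ?_
  rw [slope_def_field, sub_zero]

/-- Differentiation under the integral sign at the left end of a time interval. -/
theorem integral_eq_of_tendsto_div {α : Type*} [MeasurableSpace α] {μ : Measure α}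
    [IsFiniteMeasure μ] {T : EReal} (hT : 0 < T) {F : ℝ → α → ℝ} {G : α → ℝ} {c : ℝ → ℝ} {c' C : ℝ}
    (hF : ∀ᶠ t in 𝓝[>] (0 : ℝ), AEStronglyMeasurable (F t) μ)
    (hC : ∀ᶠ t in 𝓝[>] (0 : ℝ), ∀ p, |F t p| ≤ C * t)
    (hG : ∀ p, Tendsto (fun t => F t p / t) (𝓝[>] 0) (𝓝 (G p)))
    (hc : ∀ᶠ t in 𝓝[>] (0 : ℝ), ∫ p, F t p ∂μ = c t - c 0)
    (hc' : HasDerivWithinAt c c' (timeInterval T) 0) : ∫ p, G p ∂μ = c' := by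
  have h1 : Tendsto (fun t => ∫ p, F t p / t ∂μ) (𝓝[>] 0) (𝓝 (∫ p, G p ∂μ)) := by
    refine tendsto_integral_filter_of_dominated_convergence (fun _ => C) ?_ ?_
      (integrable_const C) (Eventually.of_forall hG)
    · filter_upwards [hF] with t ht
      simp only [div_eq_mul_inv]
      exact ht.mul_const _
    · filter_upwards [hC, self_mem_nhdsWithin] with t ht ht0
      refine Eventually.of_forall fun p => ?_
      have ht0 : 0 < t := ht0
      rw [Real.norm_eq_abs, abs_div, abs_of_pos ht0, div_le_iff₀ ht0]
      exact ht p
  refine tendsto_nhds_unique h1 ((HasDerivWithinAt.tendsto_div hT hc').congr' ?_)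
  filter_upwards [hc] with t ht
  rw [integral_div, ht]

variable {n : ℕ} [NeZero n] {M : Type*} [TopologicalSpace M]
  [ChartedSpace (EuclideanHalfSpace n) M] [IsManifold (𝓡∂ n) ∞ M] {m : ℝ}
  {ε : ℝ} {T : EReal} {S₀ : SMMS n M m} {S : ℝ → SMMS n M m}
  {σ : ℝ → ℝ} {ψ : ℝ → (M ≃ₘ^∞⟮𝓡∂ n, 𝓡∂ n⟯ M)}

theorem IsSoliton.weightedScalarCurvature_eq (h : IsSoliton ε T S₀ S σ ψ) {t : ℝ}
    (ht : t ∈ timeInterval T) (p : M) :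
    (S t).weightedScalarCurvature p = (σ t)⁻¹ * S₀.weightedScalarCurvature (ψ t p) :=
  SMMS.weightedScalarCurvature_diffeo (c := -(m / 2 * Real.log (σ t))) (h.σ_pos t ht).ne' (ψ t)
    (h.metric_selfSimilar t ht) (fun p => h.weight_selfSimilar t ht p) p

theorem IsSoliton.tendsto_σ (h : IsSoliton ε T S₀ S σ ψ) (hT : 0 < T) :
    Tendsto σ (𝓝[≥] 0) (𝓝 1) := by
  have h1 := (h.σ_diff 0 (zero_mem_timeInterval hT)).continuousWithinAt
  rw [← h.σ_zero]
  exact h1.mono_of_mem_nhdsWithin (timeInterval_mem_nhdsGE hT)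

theorem IsSoliton.tendsto_weightedScalarCurvature (h : IsSoliton ε T S₀ S σ ψ) (hT : 0 < T) (p : M) :
    Tendsto (fun t => (S t).weightedScalarCurvature p) (𝓝[>] 0)
      (𝓝 (S₀.weightedScalarCurvature p)) := by
  have hle : 𝓝[>] (0 : ℝ) ≤ 𝓝[≥] 0 := nhdsWithin_mono _ Ioi_subset_Ici_self
  have h1 : Tendsto (fun t => ψ t p) (𝓝[>] 0) (𝓝 (ψ 0 p)) := by
    have h2 := (h.ψ_smooth (0, p) ⟨zero_mem_timeInterval hT, mem_univ _⟩).continuousWithinAt.tendsto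
    have h3 : Tendsto (fun t : ℝ => (t, p)) (𝓝[>] 0) (𝓝[timeInterval T ×ˢ univ] (0, p)) := by
      refine tendsto_nhdsWithin_iff.2 ⟨(Continuous.prodMk_left p).continuousAt.continuousWithinAt, ?_⟩
      filter_upwards [hle (timeInterval_mem_nhdsGE hT)] with t ht using ⟨ht, mem_univ _⟩
    exact h2.comp h3
  rw [h.ψ_zero] at h1
  have h3 := (((h.tendsto_σ hT).mono_left hle).inv₀ one_ne_zero).mul
    ((S₀.continuous_weightedScalarCurvature.tendsto p).comp h1)
  rw [inv_one, one_mul] at h3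
  refine h3.congr' ?_
  filter_upwards [hle (timeInterval_mem_nhdsGE hT)] with t ht
  exact (h.weightedScalarCurvature_eq ht p).symm

/-- Uniform bounds for dominated convergence. Near t = 0 one has σ > 1/2, so R_t = σ⁻¹ R₀∘ψ_t is at
most twice the bound for R₀; the mean value inequality in time then bounds the factor linearly in t,
uniformly in space. -/
theorem IsSoliton.exists_bound [CompactSpace M] (h : IsSoliton ε T S₀ S σ ψ) (hT : 0 < T) :
    ∃ K : ℝ, 0 ≤ K ∧ (∀ p, |S₀.weightedScalarCurvature p| ≤ K) ∧
      (∀ᶠ t in 𝓝[>] (0 : ℝ), ∀ p, |(S t).weightedScalarCurvature p| ≤ K) ∧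
      ∀ᶠ t in 𝓝[>] (0 : ℝ), ∀ p, |logFactor (S t).g S₀.g p| ≤ K * t := by
  obtain ⟨K, hK⟩ := isCompact_univ.exists_bound_of_continuousOn
    S₀.continuous_weightedScalarCurvature.continuousOn
  have hK' : ∀ p, |S₀.weightedScalarCurvature p| ≤ max K 0 := fun p =>
    (hK p (mem_univ p)).trans (le_max_left _ _)
  set K' := max K 0 with hK'd
  have hK0 : 0 ≤ K' := le_max_right _ _
  have hev : ∀ᶠ t in 𝓝[≥] (0 : ℝ), t ∈ timeInterval T ∧
      ∀ p, |(S t).weightedScalarCurvature p| ≤ 2 * K' := by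
    filter_upwards [timeInterval_mem_nhdsGE hT,
      (h.tendsto_σ hT).eventually (lt_mem_nhds (by norm_num : (1 / 2 : ℝ) < 1))] with t ht hσ
    refine ⟨ht, fun p => ?_⟩
    have hpos := h.σ_pos t ht
    rw [h.weightedScalarCurvature_eq ht, abs_mul, abs_of_pos (inv_pos.2 hpos)]
    refine mul_le_mul ?_ (hK' _) (abs_nonneg _) zero_le_two
    rw [inv_le_comm₀ hpos two_pos]
    linarith
  obtain ⟨δ, hδ, hδ'⟩ := (mem_nhdsGE_iff_exists_Icc_subset).1 hev
  have hδ0 : 0 < δ := hδ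
  refine ⟨2 * K', by positivity, fun p => (hK' p).trans (by linarith), ?_, ?_⟩
  · filter_upwards [nhdsWithin_mono _ Ioi_subset_Ici_self hev] with t ht using ht.2
  · filter_upwards [Ioo_mem_nhdsGT hδ0] with t ht p
    have h1 := (convex_Icc 0 δ).norm_image_sub_le_of_norm_hasDerivWithin_le (C := 2 * K')
      (f := fun s => logFactor (S s).g S₀.g p)
      (f' := fun s => -(1 / 2) * (S s).weightedScalarCurvature p)
      (fun s hs => (h.flow.hasDerivWithinAt_logFactor (hδ' hs).1 p).mono fun r hr => (hδ' hr).1)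
      (fun s hs => by
        have := (hδ' hs).2 p
        rw [Real.norm_eq_abs, abs_mul]
        norm_num
        linarith [abs_nonneg ((S s).weightedScalarCurvature p)])
      (left_mem_Icc.2 hδ0.le) ⟨ht.1.le, ht.2.le⟩
    simp only [h.flow.initial] at h1
    have h2 : logFactor S₀.g S₀.g p = 0 := by simp [logFactor]
    rwa [h2, sub_zero, sub_zero, Real.norm_eq_abs, Real.norm_eq_abs, abs_of_pos ht.1] at h1

variable [T2Space M] [CompactSpace M] [MeasurableSpace M] [BorelSpace M]

/-- The measure at time t is computed in two ways: as e^{Nf} times the initial one by conformality,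
and by pushing forward under `ψ t` with a = ½ log σ by self-similarity. -/
theorem IsSoliton.integral_comp (h : IsSoliton ε T S₀ S σ ψ) (hT : 0 < T) {t : ℝ}
    (ht : t ∈ timeInterval T) {k : M → ℝ} (hk : Continuous k) :
    ∫ p, Real.exp ((n + m) * logFactor (S t).g S₀.g p) * k (ψ t p) ∂S₀.vol
      = Real.exp ((n + m) / 2 * Real.log (σ t)) * ∫ p, k p ∂S₀.vol := by
  have hc := h.flow.conformalTo hT ht
  have h1 := SMMS.map_vol (a := 1 / 2 * Real.log (σ t)) (S' := S t) (S := S₀) (ψ t)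
    (fun p v w => by
      rw [h.metric_selfSimilar t ht]
      congr 1
      rw [← mul_assoc]
      norm_num
      exact (Real.exp_log (h.σ_pos t ht)).symm)
    (fun p => by rw [h.weight_selfSimilar t ht]; ring)
  have h2 : ∫ p, k p ∂((S t).vol.map (ψ t)) = ∫ p, k (ψ t p) ∂(S t).vol :=
    integral_map (ψ t).continuous.measurable.aemeasurable hk.measurable.aestronglyMeasurable
  have hf : Continuous fun p => Real.exp ((n + m) * logFactor (S t).g S₀.g p) := by
    have := hc.contMDiff.continuous
    fun_prop
  rw [h1, integral_smul_measure, hc.vol_eq, integral_withDensity_eq_integral_toReal_smul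
    hf.measurable.ennreal_ofReal (Eventually.of_forall fun _ => ENNReal.ofReal_lt_top),
    ENNReal.toReal_ofReal (Real.exp_pos _).le] at h2
  simp only [ENNReal.toReal_ofReal (Real.exp_pos _).le, smul_eq_mul] at h2
  rw [← h2]
  congr 2
  ring

/-- The volume identity gives E = -κV, and the integrated conformal law combined with
self-similarity gives ∫ R₀² = -κE. Together they make ∫ (R₀ + κ)² vanish. -/
theorem IsSoliton.weightedScalarCurvature_zero (h : IsSoliton ε T S₀ S σ ψ) (hT : 0 < T)
    (hN : 2 < (n : ℝ) + m) (hε : (n : ℝ) - 1 - ε * m ≠ 0) :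
    ∃ c, ∀ p, S₀.weightedScalarCurvature p = c := by
  have h0 := zero_mem_timeInterval hT
  obtain ⟨κ, hκ⟩ : ∃ κ, HasDerivWithinAt σ κ (timeInterval T) 0 :=
    ⟨_, (h.σ_diff 0 h0).hasDerivWithinAt⟩
  set N : ℝ := n + m with hNd
  set α : ℝ := (N - 2) / 2 with hα
  have hαp : 0 < α := by rw [hα]; linarith
  set f : ℝ → M → ℝ := fun t => logFactor (S t).g S₀.g with hf
  have hf0 : ∀ p, f 0 p = 0 := fun p => by simp [hf, h.flow.initial, logFactor]
  set R : ℝ → M → ℝ := fun t => (S t).weightedScalarCurvature with hR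
  set R₀ : M → ℝ := S₀.weightedScalarCurvature with hR₀
  obtain ⟨K, hK0, hKR₀, hKR, hKf⟩ := h.exists_bound hT
  have hI : ∀ᶠ t in 𝓝[>] (0 : ℝ), t ∈ timeInterval T :=
    nhdsWithin_mono _ Ioi_subset_Ici_self (timeInterval_mem_nhdsGE hT)
  have hfc : ∀ t ∈ timeInterval T, Continuous (f t) := fun t ht =>
    (h.flow.conformalTo hT ht).contMDiff.continuous
  have hRc : ∀ t, Continuous (R t) := fun t => (S t).continuous_weightedScalarCurvature
  have hR₀c : Continuous R₀ := S₀.continuous_weightedScalarCurvature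
  -- bounds for the powers of the conformal factor
  have hexp : ∀ β, 0 ≤ β → ∀ᶠ t in 𝓝[>] (0 : ℝ), ∀ p,
      |Real.exp (β * f t p) - 1| ≤ 2 * β * K * t ∧ Real.exp (β * f t p) ≤ 3 := fun β hβ => by
    have hs : ∀ᶠ t in 𝓝[>] (0 : ℝ), t < 1 / (β * K + 1) :=
      nhdsWithin_le_nhds (gt_mem_nhds (by positivity))
    filter_upwards [hKf, hs, self_mem_nhdsWithin] with t ht hts ht0 p
    have ht0 : 0 < t := ht0
    have h1 : |β * f t p| ≤ β * K * t := by
      rw [abs_mul, abs_of_nonneg hβ, mul_assoc]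
      exact mul_le_mul_of_nonneg_left (ht p) hβ
    have h2 : β * K * t ≤ 1 := by
      rw [lt_div_iff₀ (by positivity)] at hts
      nlinarith
    have h3 := Real.abs_exp_sub_one_le (h1.trans h2)
    refine ⟨by linarith, ?_⟩
    linarith [le_abs_self (Real.exp (β * f t p) - 1), abs_nonneg (β * f t p)]
  have hdexp : ∀ β p, Tendsto (fun t => (Real.exp (β * f t p) - 1) / t) (𝓝[>] 0)
      (𝓝 (-(β / 2) * R₀ p)) := fun β p => by
    have h1 := ((h.flow.hasDerivWithinAt_logFactor h0 p).const_mul β).exp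
    have h2 := HasDerivWithinAt.tendsto_div hT h1
    have e : logFactor (S 0).g S₀.g p = 0 := hf0 p
    simp only [e, mul_zero, Real.exp_zero] at h2
    have e1 : -(β / 2) * R₀ p = 1 * (β * (-(1 / 2) * (S 0).weightedScalarCurvature p)) := by
      rw [h.flow.initial]
      ring
    rw [e1]
    exact h2
  have hσe : ∀ β, HasDerivWithinAt (fun t => Real.exp (β * Real.log (σ t))) (β * κ)
      (timeInterval T) 0 := fun β => by
    have h1 := ((hκ.log (by rw [h.σ_zero]; exact one_ne_zero)).const_mul β).exp
    rw [h.σ_zero] at h1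
    simpa using h1
  set V : ℝ := ∫ _, (1 : ℝ) ∂S₀.vol with hV
  set E : ℝ := ∫ p, R₀ p ∂S₀.vol with hE
  have hint : ∀ {k : M → ℝ}, Continuous k → Integrable k S₀.vol := fun hk =>
    hk.integrable_of_hasCompactSupport (HasCompactSupport.of_compactSpace _)
  -- the derivative of the total weighted volume
  have hE1 : ∫ p, -(N / 2) * R₀ p ∂S₀.vol = N / 2 * κ * V := by
    refine integral_eq_of_tendsto_div hT (F := fun t p => Real.exp (N * f t p) - 1)
      (c := fun t => Real.exp (N / 2 * Real.log (σ t)) * V) (C := 2 * N * K) ?_ ?_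
      (fun p => hdexp N p) ?_ ((hσe (N / 2)).mul_const V)
    · filter_upwards [hI] with t ht
      have := hfc t ht
      exact (by fun_prop : Continuous fun p => Real.exp (N * f t p) - 1).measurable.aestronglyMeasurable
    · filter_upwards [hexp N (by linarith)] with t ht p using (ht p).1
    · filter_upwards [hI] with t ht
      have h1 := h.integral_comp hT ht (k := fun _ => 1) continuous_const
      simp only [mul_one] at h1
      have h2 := hfc t ht
      rw [integral_sub (hint (by fun_prop)) (hint continuous_const)]
      change ∫ p, Real.exp (N * f t p) ∂S₀.vol = _ at h1
      rw [h1, h.σ_zero, Real.log_one, mul_zero, Real.exp_zero, one_mul]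
  have hE2 : E = -κ * V := by
    rw [integral_const_mul] at hE1
    have : N / 2 * (E + κ * V) = 0 := by linear_combination -hE1
    have h3 := (mul_eq_zero_iff_left (by linarith : N / 2 ≠ 0)).1 this
    linarith
  -- the second variation
  have hE3 : ∫ p, -α * R₀ p ^ 2 ∂S₀.vol = α * κ * E := by
    -- Both summands carry the factor e^{αf} - 1 = O(t), so after division by t the curvature R_t
    -- enters only through its limit. Each summand contributes -(α/2) R₀².
    refine integral_eq_of_tendsto_div hT (F := fun t p =>
        R t p * Real.exp (2 * f t p) * Real.exp (α * f t p) * (Real.exp (α * f t p) - 1)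
          + R₀ p * (Real.exp (α * f t p) - 1))
      (c := fun t => Real.exp (α * Real.log (σ t)) * E) (C := K * 3 * 3 * (2 * α * K) + K * (2 * α * K))
      ?_ ?_ (fun p => ?_) ?_ ((hσe α).mul_const E)
    · filter_upwards [hI] with t ht
      have h1 := hfc t ht
      have h2 := hRc t
      exact (by fun_prop : Continuous fun p =>
        R t p * Real.exp (2 * f t p) * Real.exp (α * f t p) * (Real.exp (α * f t p) - 1)
          + R₀ p * (Real.exp (α * f t p) - 1)).measurable.aestronglyMeasurable
    · filter_upwards [hexp 2 zero_le_two, hexp α hαp.le, hKR, self_mem_nhdsWithin] with t h1 h2 h3 ht0 p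
      have ht0 : 0 < t := ht0
      refine (abs_add_le _ _).trans ?_
      rw [abs_mul, abs_mul, abs_mul, abs_mul, Real.abs_exp, Real.abs_exp, add_mul]
      have h4 := (h2 p).1
      have h5 := (h2 p).2
      have h6 := (h1 p).2
      have h7 : |R t p| ≤ K := h3 p
      have h8 := hKR₀ p
      refine add_le_add ?_ ?_
      · calc _ ≤ K * 3 * 3 * (2 * α * K * t) := by gcongr
          _ = _ := by ring
      · calc _ ≤ K * (2 * α * K * t) := by gcongr
          _ = _ := by ring
    · have h1 := hdexp α p
      have h2 := h.tendsto_weightedScalarCurvature hT p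
      have h3 : ∀ β, Tendsto (fun t => Real.exp (β * f t p)) (𝓝[>] 0) (𝓝 1) := fun β => by
        have h4 := ((h.flow.hasDerivWithinAt_logFactor h0 p).const_mul β).exp.continuousWithinAt
        have h5 := (h4.mono_of_mem_nhdsWithin (timeInterval_mem_nhdsGE hT)).mono
          (Ioi_subset_Ici_self (a := (0 : ℝ)))
        have e : logFactor (S 0).g S₀.g p = 0 := hf0 p
        have h6 := h5.tendsto
        rwa [e, mul_zero, Real.exp_zero] at h6
      have h4 := (((h2.mul (h3 2)).mul (h3 α)).mul h1).add (h1.const_mul (R₀ p))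
      have e : -α * R₀ p ^ 2 = R₀ p * 1 * 1 * (-(α / 2) * R₀ p) + R₀ p * (-(α / 2) * R₀ p) := by
        ring
      rw [e]
      refine h4.congr fun t => ?_
      ring
    · filter_upwards [hI] with t ht
      have h1 := hfc t ht
      have h2 := hRc t
      have h3 := h.integral_comp hT ht hR₀c
      have hc := h.flow.conformalTo hT ht
      have h4 := hc.integral_eq (hc.isNeumann hε (h.flow.boundary_eq t ht)
        (by have := h.flow.boundary_eq 0 h0; rwa [h.flow.initial] at this))
      have hσ := h.σ_pos t ht
      -- Here N = 2 + 2α; the factor σ cancels one power on the right side of the scaling identity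
      -- and leaves σ^α.
      have e1 : ∀ p, Real.exp (N * f t p) * R₀ (ψ t p)
          = σ t * (R t p * Real.exp (2 * f t p) * Real.exp (α * f t p) * Real.exp (α * f t p)) :=
        fun p => by
          have : R t p = (σ t)⁻¹ * R₀ (ψ t p) := h.weightedScalarCurvature_eq ht p
          have e : Real.exp (N * f t p)
              = Real.exp (2 * f t p) * Real.exp (α * f t p) * Real.exp (α * f t p) := by
            rw [← Real.exp_add, ← Real.exp_add]
            congr 1
            rw [hα]; ring
          rw [this, e]
          field_simp
      change ∫ p, Real.exp (N * f t p) * R₀ (ψ t p) ∂S₀.vol = _ at h3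
      simp only [e1] at h3
      have e2 : Real.exp (N / 2 * Real.log (σ t)) = σ t * Real.exp (α * Real.log (σ t)) := by
        conv_rhs => rw [← Real.exp_log hσ, Real.log_exp, ← Real.exp_add]
        congr 1
        rw [hα]; ring
      rw [integral_const_mul, e2, mul_assoc] at h3
      have h5 := mul_left_cancel₀ hσ.ne' h3
      change ∫ p, Real.exp (α * f t p) * (R₀ p - Real.exp (2 * f t p) * R t p) ∂S₀.vol = 0 at h4
      -- The three groups on the right have integrals σ^α E, 0 (the conformal identity) and E.
      have e3 : ∀ p, R t p * Real.exp (2 * f t p) * Real.exp (α * f t p) * (Real.exp (α * f t p) - 1)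
          + R₀ p * (Real.exp (α * f t p) - 1)
          = R t p * Real.exp (2 * f t p) * Real.exp (α * f t p) * Real.exp (α * f t p)
            + Real.exp (α * f t p) * (R₀ p - Real.exp (2 * f t p) * R t p) - R₀ p := fun p => by
        ring
      simp only [e3]
      rw [integral_sub (hint (by fun_prop)) (hint hR₀c), integral_add (hint (by fun_prop))
        (hint (by fun_prop)), h4, h5, h.σ_zero]
      simp [hE]
  have hE4 : ∫ p, R₀ p ^ 2 ∂S₀.vol = -κ * E := by
    rw [integral_const_mul] at hE3
    have : α * (∫ p, R₀ p ^ 2 ∂S₀.vol + κ * E) = 0 := by linear_combination -hE3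
    have h3 := (mul_eq_zero_iff_left hαp.ne').1 this
    linarith
  have hE5 : ∫ p, (R₀ p + κ) ^ 2 ∂S₀.vol = 0 := by
    have e : ∀ p, (R₀ p + κ) ^ 2 = R₀ p ^ 2 + 2 * κ * R₀ p + κ ^ 2 * 1 := fun p => by ring
    simp only [e]
    -- The total is -κE + 2κE + κ²V = κ(E + κV), which vanishes because E = -κV.
    rw [integral_add (hint (by fun_prop)) (hint (by fun_prop)), integral_add (hint (by fun_prop))
      (hint (by fun_prop)), integral_const_mul, integral_const_mul, hE4]
    change -κ * E + 2 * κ * E + κ ^ 2 * V = 0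
    rw [hE2]; ring
  refine ⟨-κ, fun p => ?_⟩
  have hcont : Continuous fun p => (R₀ p + κ) ^ 2 := by fun_prop
  have h1 := (integral_eq_zero_iff_of_nonneg (fun p => sq_nonneg (R₀ p + κ)) (hint hcont)).1 hE5
  have h2 := (hcont.ae_eq_iff_eq S₀.vol continuous_const).1 h1
  have h3 : (R₀ p + κ) ^ 2 = 0 := congrFun h2 p
  have := pow_eq_zero_iff (two_ne_zero) |>.1 h3
  linarith

end Soliton

end WeightedYamabe

end

theorem mainTheorem4 (n : ℕ) [NeZero n] (hn : 3 ≤ n)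
    (M : Type*) [TopologicalSpace M] [T2Space M] [CompactSpace M]
    [ChartedSpace (EuclideanHalfSpace n) M] [IsManifold (𝓡∂ n) ∞ M]
    (m : ℝ) (hm : 0 ≤ m)
    (ε : ℝ) (hε : ε = -1 ∨ (ε = 1 ∧ m ≠ (n : ℝ) - 1))
    (T : EReal) (hT : 0 < T)
    (S₀ : WeightedYamabe.SMMS n M m) (S : ℝ → WeightedYamabe.SMMS n M m)
    (σ : ℝ → ℝ) (ψ : ℝ → (M ≃ₘ^∞⟮𝓡∂ n, 𝓡∂ n⟯ M))
    (hS : WeightedYamabe.IsSoliton ε T S₀ S σ ψ) :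
    ∀ t ∈ WeightedYamabe.timeInterval T,
      (∃ c : ℝ, ∀ p : M, (S t).weightedScalarCurvature p = c) ∧
      (∀ p ∈ (𝓡∂ n).boundary M, (S t).weightedMeanCurvature ε p = 0) := by
  have h3 : (3 : ℝ) ≤ n := by exact_mod_cast hn
  -- This is the coefficient of ∂f/∂ν in the conformal law of the mean curvature: n - 1 + m > 0 for
  -- ε = -1, and n - 1 - m for ε = 1, which is where m ≠ n - 1 is needed.
  have hε' : (n : ℝ) - 1 - ε * m ≠ 0 := by
    rcases hε with rfl | ⟨rfl, hne⟩
    · have : 0 < (n : ℝ) - 1 - -1 * m := by linarith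
      exact this.ne'
    · rw [one_mul]
      exact sub_ne_zero.2 (Ne.symm hne)
  -- The statement involves no measure; the Borel structure is introduced only for the integrals of
  -- the proof.
  let _ : MeasurableSpace M := borel M
  have : BorelSpace M := ⟨rfl⟩
  obtain ⟨c, hc⟩ := hS.weightedScalarCurvature_zero hT (by linarith) hε'
  exact fun t ht => ⟨⟨(σ t)⁻¹ * c, fun p => by rw [hS.weightedScalarCurvature_eq ht, hc]⟩,
    hS.flow.boundary_eq t ht⟩
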